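/- **Setting.** Consider $H^*=\min_{x\in\mathbb R^n}\max_{y\in\mathbb R^m}\{H(x,y):=h(x,y)+p(x)-q(y)\}$, where $p,q$ are proper closed convex functions with compact domains, and $h$ is concave in $y$ and $L$-smooth on $\operatorname{dom}p\times\operatorname{dom}q$ (differentiable there, with $L$-Lipschitz gradient), $L>0$. Let $D_p,D_q$ be the diameters of $\operatorname{dom}p,\operatorname{dom}q$, with $D_q>0$. There is a stochastic gradient $\hat\nabla h(x,y;\omega)=(\hat\nabla_xh,\hat\nabla_yh)$ with $\mathbb E[\hat\nabla h]=\nabla h$ and $\mathbb E\|\hat\nabla h-\nabla h\|^2\le\delta^2$ on $\operatorname{dom}p\times\operatorname{dom}q$, $\delta>0$. Fix $\epsilon,\hat\epsilon>0$. With $\partial$ the (Fréchet) subdifferential, a random point $(x,y)\in\operatorname{dom}p\times\operatorname{dom}q$ is a *$\rho$-primal-dual stationary point in expectation* if $\mathbb E\,\mathrm{dist}(0,\partial_xH(x,y))\le\rho$ and $\mathbb E\,\mathrm{dist}(0,\partial_y(-H)(x,y))\le\rho$. It is a *nearly* $\rho$-primal-dual stationary point in expectation if it is within $\rho$ in expectation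 of a random point with this property. **SAPD.** Put $\sigma_x=L$, $\sigma_y=\epsilon/(2D_q)$, $\bar L=L+\max\{2L,\epsilon/(2D_q)\}$, $\beta=\min\{\frac12,\frac{\sigma_y}{\sigma_x},\frac{\sigma_x}{\sigma_y}\}$, $\Psi=\min\{\sqrt{\frac{\beta\sigma_x}{2\sigma_y}},\frac{1-\beta}4\}$, $\Xi^x=1+\Psi$, $\Xi^y=\frac{27+3\beta}2+\frac{\sigma_y}{\sigma_x}\Psi$, $$\theta_1=1-\tfrac{\beta(\bar L+\sigma_x)\sigma_y}{4\bar L^2}\Big(\sqrt{1+\tfrac{8\sigma_x\bar L^2}{\beta\sigma_y(\bar L+\sigma_x)^2}}-1\Big),\qquad \theta_2=1-\tfrac{(1-\beta)^2\sigma_y^2}{32\bar L^2}\Big(\sqrt{1+\tfrac{64\bar L^2}{(1-\beta)^2\sigma_y^2}}-1\Big),$$ $$\theta_3=\max\Big\{0,1-\tfrac{\sigma_x\hat\epsilon^2}{12\Xi^x\delta^2}\Big\},\qquad \theta_4=\max\Big\{0,1-\tfrac{\sigma_y\hat\epsilon^2}{12\Xi^y\delta^2}\Big\},$$ $\theta=\max_i\theta_i$,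 $\tau=\frac{1-\theta}{\sigma_x\theta}$, $\sigma=\frac{1-\theta}{\sigma_y\theta}$, and $T=\max\{0,\lceil1+\ln(\frac{6\sigma_xD_p^2+6\sigma_yD_q^2}{\hat\epsilon^2})\max_i(1-\theta_i)^{-1}\rceil\}$. For a stochastic gradient $\hat\nabla\bar h$, SAPD started at $(u^0,v^0)$ performs, for $t=0,\dots,T-1$, with $r^0=0$ and $r^t=\hat\nabla_y\bar h(u^t,v^t;\omega_y^t)-\hat\nabla_y\bar h(u^{t-1},v^{t-1};\omega_y^{t-1})$ for $t\ge1$, $$v^{t+1}=\mathrm{prox}_{\sigma q}\big(v^t+\sigma(\hat\nabla_y\bar h(u^t,v^t;\omega_y^t)+\theta r^t)\big),\qquad u^{t+1}=\mathrm{prox}_{\tau p}\big(u^t-\tau\hat\nabla_x\bar h(u^t,v^{t+1};\omega_x^t)\big),$$ and returns $(u^T,v^T)$. **Proximal point method.** Start at a (possibly random) $(x^0,y^0)\in\operatorname{dom}p\times\operatorname{dom}q$ with $\mathbb E|\max_yH(x^0,y)|<\infty$. For $k=0,\dots,K-1$ let $(x^{k+1},y^{k+1})$ be the output of SAPD started at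 $(x^k,y^k)$ with $$\hat\nabla\bar h(x,y;\omega)=\hat\nabla h(x,y;\omega)+\big(2L(x-x^k),\,-\tfrac{\epsilon}{2D_q}(y-y^0)\big),$$ using fresh independent samples (also independent of $(x^0,y^0)$). Return $(x^\epsilon,y^\epsilon)=(x^{k'+1},y^{k'+1})$ with $k'$ uniform on $\{0,\dots,K-1\}$ and independent of everything else. **Theorem.** Let $K=\big\lceil(\mathbb E[\max_yH(x^0,y)]-H^*+\epsilon D_q/4)\hat\epsilon^{-2}\big\rceil$, $N=KC$ and $$C=\max\Big\{1,\Big\lceil1+\ln\Big(\tfrac{6LD_p^2+3\epsilon D_q}{\hat\epsilon^2}\Big)\Big[\Big(L+\max\{2L,\tfrac{\epsilon}{2D_q}\}\Big)\Big(\tfrac{2\sqrt{2D_q}}{\sqrt{L\epsilon}}+\tfrac3L+\tfrac{24D_q}\epsilon\Big)+\tfrac{\delta^2}{\hat\epsilon^2}\Big(\tfrac{21}L+\tfrac{360D_q}\epsilon\Big)\Big]\Big\rceil\Big\}.$$ Then there is a random point $(\hat x,\hat y)\in\operatorname{dom}p\times\operatorname{dom}q$ such that $$\mathbb E\|(x^\epsilon,y^\epsilon)-(\hat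 x,\hat y)\|\le\max\Big\{\tfrac{\hat\epsilon}{\sqrt L},\tfrac{\hat\epsilon}{\sqrt{\epsilon/(2D_q)}}\Big\},$$ $(\hat x,\hat y)$ is a $\max\{2\sqrt{2L}\,\hat\epsilon,\frac\epsilon2\}$-primal-dual stationary point in expectation, and $$\mathbb E\big[\max_yH(\hat x,y)\big]\le2\,\mathbb E\big[\max_yH(x^0,y)\big]-H^*+\epsilon D_q/2 .$$ Consequently $(x^\epsilon,y^\epsilon)$ is a nearly $\max\{2\sqrt{2L}\,\hat\epsilon,\frac\epsilon2,\frac{\hat\epsilon}{\sqrt L},\frac{\hat\epsilon}{\sqrt{\epsilon/(2D_q)}}\}$-primal-dual stationary point in expectation. The whole run uses at most $N$ oracle calls, that is, at most $N$ evaluations of $\hat\nabla_xh$ and at most $N$ of $\hat\nabla_yh$. -/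

import Mathlib

open MeasureTheory ProbabilityTheory
open scoped ENNReal Topology

noncomputable section

namespace CompositeMinimax

/-- `ℝⁿ` with its Euclidean norm. -/
abbrev Vec (n : ℕ) := EuclideanSpace ℝ (Fin n)

/-- The Euclidean distance of two points of `ℝⁿ × ℝᵐ`. -/
def jointDist {n m : ℕ} (x : Vec n) (y : Vec m) (x' : Vec n) (y' : Vec m) : ℝ :=
  Real.sqrt (‖x - x'‖ ^ 2 + ‖y - y'‖ ^ 2)

/-- The subdifferential at `x` of the extended-valued function that is `f` on its domain `D` and
`+∞` off `D`: all `v` with `f x' ≥ f x + ⟪v, x' - x⟫ + o(‖x' - x‖)`. -/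
def subdifferential {n : ℕ} (D : Set (Vec n)) (f : Vec n → ℝ) (x : Vec n) : Set (Vec n) :=
  {v | x ∈ D ∧ ∀ c : ℝ, 0 < c →
    ∀ᶠ x' in 𝓝[D] x, f x + inner ℝ v (x' - x) - c * ‖x' - x‖ ≤ f x'}

/-- `prox_{τ f} (x)`, the minimizer over the domain `D` of `f` of `‖u - x‖² / 2 + τ f u`. -/
def prox {n : ℕ} (D : Set (Vec n)) (f : Vec n → ℝ) (τ : ℝ) (x : Vec n) : Vec n :=
  Classical.epsilon fun u => u ∈ D ∧ IsMinOn (fun u' => 1 / 2 * ‖u' - x‖ ^ 2 + τ * f u') D u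

/-- The data of `min_x max_y h x y + p x - q y`. The extended-valued functions `p` and `q` are
given by their effective domains `P = dom p` and `Q = dom q` and by their finite values there; the
values of `p` and `q` off their domains are never used. -/
structure Problem (n m : ℕ) where
  P : Set (Vec n)
  p : Vec n → ℝ
  Q : Set (Vec m)
  q : Vec m → ℝ
  h : Vec n → Vec m → ℝ

/-- The function that is `f` on `D` and `+∞` off `D` is proper, closed and convex with compact
domain `D` (as `D` is closed, its lower semicontinuity is that of `f` on `D`). -/
structure IsProperClosedConvex {n : ℕ} (D : Set (Vec n)) (f : Vec n → ℝ) : Prop where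
  nonempty : D.Nonempty
  isCompact : IsCompact D
  convexOn : ConvexOn ℝ D f
  lowerSemicontinuousOn : LowerSemicontinuousOn f D

namespace Problem

variable {n m : ℕ}

/-- `∇_x h (x, y)`. -/
def gradX (pr : Problem n m) (x : Vec n) (y : Vec m) : Vec n :=
  gradient (fun x' => pr.h x' y) x

/-- `∇_y h (x, y)`. -/
def gradY (pr : Problem n m) (x : Vec n) (y : Vec m) : Vec m :=
  gradient (fun y' => pr.h x y') y

/-- `p` and `q` are proper closed convex with compact domains, and `h` is concave in `y` and
`L`-smooth on `dom p × dom q`. -/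
structure Admissible (pr : Problem n m) (L : ℝ) : Prop where
  p_closed : IsProperClosedConvex pr.P pr.p
  q_closed : IsProperClosedConvex pr.Q pr.q
  concave : ∀ x ∈ pr.P, ConcaveOn ℝ pr.Q (fun y => pr.h x y)
  differentiable : ∀ x ∈ pr.P, ∀ y ∈ pr.Q,
    DifferentiableAt ℝ (fun z : Vec n × Vec m => pr.h z.1 z.2) (x, y)
  smooth : ∀ x ∈ pr.P, ∀ y ∈ pr.Q, ∀ x' ∈ pr.P, ∀ y' ∈ pr.Q,
    jointDist (pr.gradX x y) (pr.gradY x y) (pr.gradX x' y') (pr.gradY x' y')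
      ≤ L * jointDist x y x' y'

/-- `H (x, y) = h (x, y) + p x - q y`, for `x ∈ dom p` and `y ∈ dom q`. -/
def H (pr : Problem n m) (x : Vec n) (y : Vec m) : ℝ := pr.h x y + pr.p x - pr.q y

/-- `max_y H (x, y)`. -/
def maxH (pr : Problem n m) (x : Vec n) : ℝ := sSup ((fun y => pr.H x y) '' pr.Q)

/-- `H^* = min_x max_y H (x, y)`. -/
def Hstar (pr : Problem n m) : ℝ := sInf (pr.maxH '' pr.P)

/-- `D_p`, the diameter of `dom p`. -/
def Dp (pr : Problem n m) : ℝ := Metric.diam pr.P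

/-- `D_q`, the diameter of `dom q`. -/
def Dq (pr : Problem n m) : ℝ := Metric.diam pr.Q

/-- `dist (0, ∂_x H (x, y))`, which is `∞` if the subdifferential is empty. -/
def distX (pr : Problem n m) (x : Vec n) (y : Vec m) : ℝ≥0∞ :=
  Metric.infEDist 0 (subdifferential pr.P (fun x' => pr.H x' y) x)

/-- `dist (0, ∂_y (-H (x, y)))`, which is `∞` if the subdifferential is empty. -/
def distY (pr : Problem n m) (x : Vec n) (y : Vec m) : ℝ≥0∞ :=
  Metric.infEDist 0 (subdifferential pr.Q (fun y' => -pr.H x y') y)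

end Problem

/-- `E[f] ≤ c`. For a nonnegative `f` that is not known to be measurable this bounds the upper
expectation, the smallest expectation of a measurable function above `f`. -/
def ExpectationLE {Ω : Type*} [MeasurableSpace Ω] (Pb : Measure Ω) (f : Ω → ℝ≥0∞) (c : ℝ) : Prop :=
  ∃ g : Ω → ℝ≥0∞, Measurable g ∧ (∀ ω, f ω ≤ g ω) ∧ ∫⁻ ω, g ω ∂Pb ≤ ENNReal.ofReal c

/-- The random point `(x, y)` of `dom p × dom q` is a `ρ`-primal-dual stationary point in
expectation. -/
def StationaryInExpectation {n m : ℕ} {Ω : Type*} [MeasurableSpace Ω] (Pb : Measure Ω)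
    (pr : Problem n m) (ρ : ℝ) (x : Ω → Vec n) (y : Ω → Vec m) : Prop :=
  (∀ ω, x ω ∈ pr.P ∧ y ω ∈ pr.Q) ∧
  ExpectationLE Pb (fun ω => pr.distX (x ω) (y ω)) ρ ∧
  ExpectationLE Pb (fun ω => pr.distY (x ω) (y ω)) ρ

/-- The random point `(x, y)` is within `R` in expectation of the random point `(x', y')`. -/
def NearInExpectation {n m : ℕ} {Ω : Type*} [MeasurableSpace Ω] (Pb : Measure Ω) (R : ℝ)
    (x : Ω → Vec n) (y : Ω → Vec m) (x' : Ω → Vec n) (y' : Ω → Vec m) : Prop :=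
  Integrable (fun ω => jointDist (x ω) (y ω) (x' ω) (y' ω)) Pb ∧
  ∫ ω, jointDist (x ω) (y ω) (x' ω) (y' ω) ∂Pb ≤ R

/-- The random point `(x, y)` is a nearly `ρ`-primal-dual stationary point in expectation. -/
def NearlyStationaryInExpectation {n m : ℕ} {Ω : Type*} [MeasurableSpace Ω] (Pb : Measure Ω)
    (pr : Problem n m) (ρ : ℝ) (x : Ω → Vec n) (y : Ω → Vec m) : Prop :=
  ∃ (x' : Ω → Vec n) (y' : Ω → Vec m), Measurable x' ∧ Measurable y' ∧
    NearInExpectation Pb ρ x y x' y' ∧ StationaryInExpectation Pb pr ρ x' y'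

/-! ### The stochastic oracle -/

/-- A stochastic gradient estimator of `h`: its `x`-part and its `y`-part at `(x, y)` and a sample
in `W`. -/
structure Oracle (n m : ℕ) (W : Type*) where
  gx : Vec n → Vec m → W → Vec n
  gy : Vec n → Vec m → W → Vec m

/-- For samples of law `μ` the estimator is unbiased with variance at most `δ²` on
`dom p × dom q`. -/
structure Oracle.Admissible {n m : ℕ} {W : Type*} [MeasurableSpace W] (G : Oracle n m W)
    (pr : Problem n m) (μ : Measure W) (δ : ℝ) : Prop where
  measurable_gx : Measurable (fun z : Vec n × Vec m × W => G.gx z.1 z.2.1 z.2.2)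
  measurable_gy : Measurable (fun z : Vec n × Vec m × W => G.gy z.1 z.2.1 z.2.2)
  unbiased_x : ∀ x ∈ pr.P, ∀ y ∈ pr.Q, ∫ w, G.gx x y w ∂μ = pr.gradX x y
  unbiased_y : ∀ x ∈ pr.P, ∀ y ∈ pr.Q, ∫ w, G.gy x y w ∂μ = pr.gradY x y
  integrable_sq : ∀ x ∈ pr.P, ∀ y ∈ pr.Q,
    Integrable (fun w => ‖G.gx x y w - pr.gradX x y‖ ^ 2 + ‖G.gy x y w - pr.gradY x y‖ ^ 2) μ
  variance_le : ∀ x ∈ pr.P, ∀ y ∈ pr.Q,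
    ∫ w, (‖G.gx x y w - pr.gradX x y‖ ^ 2 + ‖G.gy x y w - pr.gradY x y‖ ^ 2) ∂μ ≤ δ ^ 2

/-! ### Parameters of SAPD

Below, `L` is the smoothness constant, `a` and `b` are the moduli of strong convexity in `x` and of
strong concavity in `y`, `δ ^ 2` is the variance bound, and `e` is the target accuracy. -/

def sapdBeta (a b : ℝ) : ℝ := min (1 / 2) (min (b / a) (a / b))

def sapdPsi (a b : ℝ) : ℝ :=
  min (Real.sqrt (sapdBeta a b / 2 * (a / b))) ((1 - sapdBeta a b) / 4)

def sapdXiX (a b : ℝ) : ℝ := 1 + sapdPsi a b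

def sapdXiY (a b : ℝ) : ℝ := (27 + 3 * sapdBeta a b) / 2 + b / a * sapdPsi a b

def sapdTheta₁ (L a b : ℝ) : ℝ :=
  1 - sapdBeta a b * (L + a) * b / (4 * L ^ 2) *
    (Real.sqrt (1 + 8 * a * L ^ 2 / (sapdBeta a b * b * (L + a) ^ 2)) - 1)

def sapdTheta₂ (L a b : ℝ) : ℝ :=
  1 - (1 - sapdBeta a b) ^ 2 / 32 * (b ^ 2 / L ^ 2) *
    (Real.sqrt (1 + 64 * L ^ 2 / ((1 - sapdBeta a b) ^ 2 * b ^ 2)) - 1)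

def sapdTheta₃ (a b δ e : ℝ) : ℝ :=
  max 0 (1 - 1 / (12 * sapdXiX a b) * (a / δ ^ 2) * e ^ 2)

def sapdTheta₄ (a b δ e : ℝ) : ℝ :=
  max 0 (1 - 1 / (12 * sapdXiY a b) * (b / δ ^ 2) * e ^ 2)

/-- The momentum parameter `θ`. -/
def sapdTheta (L a b δ e : ℝ) : ℝ :=
  max (max (sapdTheta₁ L a b) (sapdTheta₂ L a b)) (max (sapdTheta₃ a b δ e) (sapdTheta₄ a b δ e))

/-- The step size `τ` in `x`. -/
def sapdTau (L a b δ e : ℝ) : ℝ :=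
  (1 - sapdTheta L a b δ e) / (a * sapdTheta L a b δ e)

/-- The step size `σ` in `y`. -/
def sapdSigma (L a b δ e : ℝ) : ℝ :=
  (1 - sapdTheta L a b δ e) / (b * sapdTheta L a b δ e)

/-- The number of iterations `T`, for domains of diameters `dp` and `dq`. -/
def sapdT (L a b δ e dp dq : ℝ) : ℕ :=
  ⌈1 + Real.log ((6 * a * dp ^ 2 + 6 * b * dq ^ 2) / e ^ 2) *
    max (max (1 - sapdTheta₁ L a b)⁻¹ (1 - sapdTheta₂ L a b)⁻¹)
      (max (1 - sapdTheta₃ a b δ e)⁻¹ (1 - sapdTheta₄ a b δ e)⁻¹)⌉₊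

/-! ### The algorithms

Both keep count of their evaluations of the `x`-part and of the `y`-part of the stochastic
gradient. -/

/-- The state of SAPD: the current point, the stochastic `y`-gradient at the previous point (if
there is one), and the evaluation counts. -/
structure SAPDState (n m : ℕ) where
  x : Vec n
  y : Vec m
  prev : Option (Vec m)
  xCalls : ℕ
  yCalls : ℕ

/-- One iteration of SAPD with stochastic gradient `G` and samples `wx` and `wy`. -/
def sapdStep {n m : ℕ} {W : Type*} (pr : Problem n m) (G : Oracle n m W) (τ σ θ : ℝ)
    (wx wy : W) (s : SAPDState n m) : SAPDState n m :=
  let g := G.gy s.x s.y wy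
  let d := match s.prev with
    | none => 0
    | some g₀ => g - g₀
  let y' := prox pr.Q pr.q σ (s.y + σ • (g + θ • d))
  let x' := prox pr.P pr.p τ (s.x - τ • G.gx s.x y' wx)
  ⟨x', y', some g, s.xCalls + 1, s.yCalls + 1⟩

/-- `t` iterations of SAPD, where iteration `i` uses the samples `wx i` and `wy i`. -/
def sapdRun {n m : ℕ} {W : Type*} (pr : Problem n m) (G : Oracle n m W) (τ σ θ : ℝ)
    (wx wy : ℕ → W) (s : SAPDState n m) : ℕ → SAPDState n m
  | 0 => s
  | t + 1 => sapdStep pr G τ σ θ (wx t) (wy t) (sapdRun pr G τ σ θ wx wy s t)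

/-- SAPD started at `(x, y)`, with all of its parameters. -/
def sapd {n m : ℕ} {W : Type*} (pr : Problem n m) (G : Oracle n m W) (L a b δ e : ℝ)
    (wx wy : ℕ → W) (x : Vec n) (y : Vec m) : SAPDState n m :=
  sapdRun pr G (sapdTau L a b δ e) (sapdSigma L a b δ e) (sapdTheta L a b δ e) wx wy
    ⟨x, y, none, 0, 0⟩ (sapdT L a b δ e pr.Dp pr.Dq)

/-- The stochastic gradient of
`h (x, y) - ε ‖y - y₀‖² / (4 D_q) + L ‖x - xc‖²` that comes from that of `h`. -/
def subproblemOracle {n m : ℕ} {W : Type*} (pr : Problem n m) (G : Oracle n m W) (L ε : ℝ)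
    (xc : Vec n) (y₀ : Vec m) : Oracle n m W where
  gx x y w := G.gx x y w + (2 * L) • (x - xc)
  gy x y w := G.gy x y w - (ε / (2 * pr.Dq)) • (y - y₀)

/-- The current point of the inexact proximal point method, with the evaluation counts. -/
structure OuterState (n m : ℕ) where
  x : Vec n
  y : Vec m
  xCalls : ℕ
  yCalls : ℕ

/-- `k` main iterations of the stochastic inexact proximal point method. Main iteration `i` runs
SAPD from the current point on the subproblem centred there, with samples `wx i` and `wy i`. -/
def outerRun {n m : ℕ} {W : Type*} (pr : Problem n m) (G : Oracle n m W) (L δ ε e : ℝ)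
    (x₀ : Vec n) (y₀ : Vec m) (wx wy : ℕ → ℕ → W) : ℕ → OuterState n m
  | 0 => ⟨x₀, y₀, 0, 0⟩
  | k + 1 =>
    let s := outerRun pr G L δ ε e x₀ y₀ wx wy k
    let r := sapd pr (subproblemOracle pr G L ε s.x y₀)
      (L + max (2 * L) (ε / (2 * pr.Dq))) L (ε / (2 * pr.Dq)) δ e (wx k) (wy k) s.x s.y
    ⟨r.x, r.y, s.xCalls + r.xCalls, s.yCalls + r.yCalls⟩

/-- The stochastic inexact proximal point method: perform `K` main iterations and return the point
that main iteration `k` has produced, with the evaluation counts of the whole run. -/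
def proximalPoint {n m : ℕ} {W : Type*} (pr : Problem n m) (G : Oracle n m W) (L δ ε e : ℝ)
    (K : ℕ) (x₀ : Vec n) (y₀ : Vec m) (wx wy : ℕ → ℕ → W) (k : ℕ) : OuterState n m :=
  let s := outerRun pr G L δ ε e x₀ y₀ wx wy (k + 1)
  let f := outerRun pr G L δ ε e x₀ y₀ wx wy K
  ⟨s.x, s.y, f.xCalls, f.yCalls⟩

/-- All of the samples, indexed by a disjoint union. -/
def allSamples {Ω W : Type*} (wx wy : ℕ → ℕ → Ω → W) : (ℕ × ℕ) ⊕ (ℕ × ℕ) → Ω → W :=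
  Sum.elim (fun i => wx i.1 i.2) (fun i => wy i.1 i.2)

/-- The randomness of a run: an initial point in `dom p × dom q` (possibly random), independent
samples of law `μ`, and an index uniform on `{0, …, K - 1}`, all independent of each other. -/
structure IsRandomInput {n m : ℕ} {W Ω : Type*} [MeasurableSpace W] [MeasurableSpace Ω]
    (Pb : Measure Ω) (pr : Problem n m) (μ : Measure W) (K : ℕ) (x₀ : Ω → Vec n) (y₀ : Ω → Vec m)
    (wx wy : ℕ → ℕ → Ω → W) (k' : Ω → ℕ) : Prop where
  measurable_x₀ : Measurable x₀
  measurable_y₀ : Measurable y₀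
  mem : ∀ ω, x₀ ω ∈ pr.P ∧ y₀ ω ∈ pr.Q
  measurable_sample : ∀ i, Measurable (allSamples wx wy i)
  law_sample : ∀ i, Measure.map (allSamples wx wy i) Pb = μ
  indep_samples : iIndepFun (allSamples wx wy) Pb
  measurable_index : Measurable k'
  law_index : ∀ j < K, Pb (k' ⁻¹' {j}) = (K : ℝ≥0∞)⁻¹
  indep_samples_index : IndepFun (fun ω i => allSamples wx wy i ω) k' Pb
  indep_init : IndepFun (fun ω => (x₀ ω, y₀ ω)) (fun ω => (fun i => allSamples wx wy i ω, k' ω)) Pb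

/-- The number of main iterations,
`K = ⌈(V - H^* + ε D_q / 4) / e²⌉` with `V = E[max_y H (x⁰, y)]`. -/
def outerIterations {n m : ℕ} (pr : Problem n m) (ε e V : ℝ) : ℕ :=
  ⌈(V - pr.Hstar + ε * pr.Dq / 4) * (e ^ 2)⁻¹⌉₊

/-- The bound `C` on the cost of one call of SAPD. The maximum with `1` plays a role only if the
logarithm is negative. -/
def innerBound {n m : ℕ} (pr : Problem n m) (L δ ε e : ℝ) : ℕ :=
  max 1 ⌈1 + Real.log ((6 * L * pr.Dp ^ 2 + 3 * ε * pr.Dq) / e ^ 2) *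
    ((L + max (2 * L) (ε / (2 * pr.Dq))) *
        (2 * Real.sqrt (2 * pr.Dq) / Real.sqrt (L * ε) + 3 / L + 24 * pr.Dq / ε)
      + δ ^ 2 / e ^ 2 * (21 / L + 360 * pr.Dq / ε))⌉₊

end CompositeMinimax

end

open CompositeMinimax

/-!
The method is a proximal point method for the primal function `x ↦ max_y H (x, y)`, whose
proximal steps are saddle point problems solved by SAPD. Write `b = ε / (2 D_q)`. For a centre
`c ∈ dom p` the function `H (x, y) + L ‖x - c‖² - b / 2 ‖y - y₀‖²` is `L`-strongly convex in `x`
and `b`-strongly concave in `y`, so it has a saddle point `(x*, y*)`, which depends continuously,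
hence measurably, on `(c, y₀)` (`Problem.saddle`, `Problem.Admissible.continuous_saddle`).

*The saddle points are nearly stationary.* The optimality conditions of the subproblem give
`dist (0, ∂_x H (x*, y*)) ≤ 2 L ‖x* - c‖` and `dist (0, ∂_y (-H) (x*, y*)) ≤ b ‖y* - y₀‖ ≤ ε / 2`
(`Problem.Admissible.distX_saddle_le`, `Problem.Admissible.distY_saddle_le`). It remains to make
`‖x* - c‖` small on average and to show that the iterate which follows `c` is close to `(x*, y*)`.

*One call of SAPD.* A Lyapunov function that combines the weighted squared distance to the saddle
point with the momentum term decreases by the factor `θ` at each iteration, up to terms in the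
errors of the oracle (`Problem.Admissible.lyapunov_step`). The dangerous terms are inner products
of an error with an iterate that depends on it. Comparing that iterate with the one that the exact
gradient would have produced splits them into a part that is conditionally centred and a part
bounded, by nonexpansiveness of the proximal map, by the step size times the squared error
(`inner_errors_le_pathNoise`, `pathNoise_expectation`). The choice of `θ` makes the accumulated
noise at most a fraction of `e²`, and that of `T` makes the contribution of the initial distance
equally small, whence the mean weighted squared error is at most `e²` (`sapdPath_accuracy`).

*The outer loop.* Let `M_k` be the saddle value of the subproblem centred at `x^k`. Testing the
subproblem centred at `x^{k+1}` with the point `x*_k` gives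
`M_{k+1} + L ‖x*_k - x^k‖² ≤ M_k + L ‖x^{k+1} - x*_k‖²`, where the last term has mean at most `e²`.
Summing over `k < K` bounds the average of `L ‖x*_k - x^k‖²` by `2 e²`, by the choice of `K`, and
bounds the mean of `max_y H (x*_k, y)` (`IsInexactProx.sum_integral_step_le`,
`IsInexactProx.integrable_maxH_saddle`). As the index `k'` is uniform and independent of the
iterates, means at `k'` are averages over `k < K` (`integral_uniform_index`).

*Complexity.* Each call makes `T` evaluations of either gradient, and elementary bounds on the
`(1 - θ_i)⁻¹` give `T ≤ C` (`sapdT_le_innerBound`).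
-/

noncomputable section

namespace CompositeMinimax

/-! ### Strongly convex functions -/

section StrongConvexity

variable {E : Type*} [NormedAddCommGroup E] [InnerProductSpace ℝ E]

theorem strongConvexOn_of_inner_le {D : Set E} (hD : Convex ℝ D) {f : E → ℝ} {g : E → E} {c : ℝ}
    (h : ∀ x ∈ D, ∀ x' ∈ D, f x + inner ℝ (g x) (x' - x) + c / 2 * ‖x' - x‖ ^ 2 ≤ f x') :
    StrongConvexOn D c f := by
  refine ⟨hD, fun x hx y hy s t hs ht hst => ?_⟩
  have hz := hD hx hy hs ht hst
  have h1 := h _ hz x hx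
  have h2 := h _ hz y hy
  set z := s • x + t • y with hzdef
  have ht' : t = 1 - s := by linarith
  have e1 : x - z = t • (x - y) := by rw [hzdef, ht']; module
  have e2 : y - z = (-s) • (x - y) := by rw [hzdef, ht']; module
  rw [e1, inner_smul_right, norm_smul, mul_pow, Real.norm_eq_abs, sq_abs] at h1
  rw [e2, inner_smul_right, norm_smul, mul_pow, Real.norm_eq_abs, sq_abs] at h2
  simp only [smul_eq_mul]
  have h3 := mul_le_mul_of_nonneg_left h1 hs
  have h4 := mul_le_mul_of_nonneg_left h2 ht
  subst ht'
  nlinarith [h3, h4]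

/-- A strongly convex function grows quadratically away from its minimizer. -/
theorem _root_.StrongConvexOn.add_sq_le_of_isMinOn {D : Set E} {f : E → ℝ} {c : ℝ}
    (hf : StrongConvexOn D c f) {u : E} (hu : u ∈ D) (hmin : IsMinOn f D u) {x : E} (hx : x ∈ D) :
    f u + c / 2 * ‖x - u‖ ^ 2 ≤ f x := by
  -- Strong convexity along the segment from `u` to `x`; the claim is the limit `t → 0`.
  have key : ∀ t : ℝ, 0 < t → t < 1 → f u + (1 - t) * (c / 2 * ‖x - u‖ ^ 2) ≤ f x := by
    intro t ht ht1
    have h1 := hf.2 hx hu ht.le (by linarith : 0 ≤ 1 - t) (by ring)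
    have h2 : f u ≤ f (t • x + (1 - t) • u) :=
      hmin (hf.1 hx hu ht.le (by linarith) (by ring))
    simp only [smul_eq_mul] at h1
    have : 0 ≤ t * (f x - f u - (1 - t) * (c / 2 * ‖x - u‖ ^ 2)) := by nlinarith
    have := nonneg_of_mul_nonneg_right this ht
    linarith
  have hlim : Filter.Tendsto (fun t : ℝ => f u + (1 - t) * (c / 2 * ‖x - u‖ ^ 2)) (𝓝[>] 0)
      (𝓝 (f u + (1 - 0) * (c / 2 * ‖x - u‖ ^ 2))) := by
    apply Filter.Tendsto.mono_left _ nhdsWithin_le_nhds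
    exact (by fun_prop : Continuous fun t : ℝ => f u + (1 - t) * (c / 2 * ‖x - u‖ ^ 2)).tendsto 0
  have := le_of_tendsto hlim (by
    filter_upwards [Ioo_mem_nhdsGT (show (0 : ℝ) < 1 by norm_num)] with t ht using key t ht.1 ht.2)
  simpa using this

theorem strongConvexOn_sq_dist {D : Set E} (hD : Convex ℝ D) (c : ℝ) (x : E) :
    StrongConvexOn D c (fun u => c / 2 * ‖u - x‖ ^ 2) := by
  refine strongConvexOn_of_inner_le hD (g := fun u => c • (u - x)) fun u _ u' _ => ?_
  have : u' - x = (u - x) + (u' - u) := by abel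
  rw [this, norm_add_sq_real, real_inner_smul_left]
  linarith

theorem _root_.StrongConvexOn.add_of_convexOn {D : Set E} {f g : E → ℝ} {c : ℝ}
    (hf : StrongConvexOn D c f) (hg : ConvexOn ℝ D g) :
    StrongConvexOn D c (fun x => f x + g x) := by
  have := UniformConvexOn.add hf (uniformConvexOn_zero.2 hg)
  rwa [add_zero] at this

theorem norm_sub_sq_eq (x' x z : E) :
    ‖x' - z‖ ^ 2 = ‖x - z‖ ^ 2 + 2 * inner ℝ (x - z) (x' - x) + ‖x' - x‖ ^ 2 := by
  have : x' - z = (x - z) + (x' - x) := by abel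
  rw [this, norm_add_sq_real]

end StrongConvexity

/-! ### The proximal map -/

namespace IsProperClosedConvex

variable {n : ℕ} {D : Set (Vec n)} {f : Vec n → ℝ}

theorem prox_spec (hf : IsProperClosedConvex D f) {τ : ℝ} (hτ : 0 < τ) (x : Vec n) :
    prox D f τ x ∈ D ∧
      IsMinOn (fun u => 1 / 2 * ‖u - x‖ ^ 2 + τ * f u) D (prox D f τ x) := by
  have : LowerSemicontinuousOn (fun u => 1 / 2 * ‖u - x‖ ^ 2 + τ * f u) D := by
    apply LowerSemicontinuousOn.add
    · have hc : Continuous fun u : Vec n => 1 / 2 * ‖u - x‖ ^ 2 := by fun_prop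
      exact hc.lowerSemicontinuous.lowerSemicontinuousOn D
    · exact (continuous_const_mul τ).comp_lowerSemicontinuousOn hf.lowerSemicontinuousOn
        fun u v huv => mul_le_mul_of_nonneg_left huv hτ.le
  obtain ⟨u, hu, hmin⟩ := this.exists_isMinOn hf.nonempty hf.isCompact
  exact Classical.epsilon_spec (p := fun u => u ∈ D ∧
    IsMinOn (fun u' => 1 / 2 * ‖u' - x‖ ^ 2 + τ * f u') D u) ⟨u, hu, hmin⟩

theorem prox_mem (hf : IsProperClosedConvex D f) {τ : ℝ} (hτ : 0 < τ) (x : Vec n) :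
    prox D f τ x ∈ D := (hf.prox_spec hτ x).1

/-- The objective of the proximal map is `1`-strongly convex, hence grows quadratically away from
its minimizer. -/
theorem prox_three_point (hf : IsProperClosedConvex D f) {τ : ℝ} (hτ : 0 < τ) (x : Vec n)
    {u : Vec n} (hu : u ∈ D) :
    1 / 2 * ‖prox D f τ x - x‖ ^ 2 + τ * f (prox D f τ x) + 1 / 2 * ‖u - prox D f τ x‖ ^ 2
      ≤ 1 / 2 * ‖u - x‖ ^ 2 + τ * f u := by
  have h1 : StrongConvexOn D 1 (fun u => 1 / 2 * ‖u - x‖ ^ 2 + τ * f u) := by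
    have h0 := strongConvexOn_sq_dist hf.convexOn.1 1 x
    have h2 : ConvexOn ℝ D (fun u => τ * f u) := hf.convexOn.smul hτ.le
    exact h0.add_of_convexOn h2
  have := h1.add_sq_le_of_isMinOn (hf.prox_spec hτ x).1 (hf.prox_spec hτ x).2 hu
  linarith

/-- The proximal map is nonexpansive. -/
theorem norm_prox_sub_prox_le (hf : IsProperClosedConvex D f) {τ : ℝ} (hτ : 0 < τ) (x x' : Vec n) :
    ‖prox D f τ x - prox D f τ x'‖ ≤ ‖x - x'‖ := by
  have h1 := hf.prox_three_point hτ x (hf.prox_mem hτ x')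
  have h2 := hf.prox_three_point hτ x' (hf.prox_mem hτ x)
  set u := prox D f τ x
  set u' := prox D f τ x'
  have h3 : ‖u - u'‖ ^ 2 ≤ inner ℝ (x - x') (u - u') := by
    have e1 := norm_sub_sq_eq u' u x
    have e2 := norm_sub_sq_eq u u' x'
    have e3 : inner ℝ (u - x) (u' - u) + inner ℝ (u' - x') (u - u')
        = inner ℝ (x - x') (u - u') - ‖u - u'‖ ^ 2 := by
      rw [← real_inner_self_eq_norm_sq]
      simp only [inner_sub_left, inner_sub_right]; ring
    rw [norm_sub_rev u' u] at *
    linarith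
  have h4 := real_inner_le_norm (x - x') (u - u')
  by_contra! hlt
  have : 0 < ‖u - u'‖ := lt_of_le_of_lt (norm_nonneg _) hlt
  nlinarith

theorem continuous_prox (hf : IsProperClosedConvex D f) {τ : ℝ} (hτ : 0 < τ) :
    Continuous (prox D f τ) := by
  have : LipschitzWith 1 (prox D f τ) := LipschitzWith.of_dist_le_mul fun x y => by
    simpa [dist_eq_norm] using hf.norm_prox_sub_prox_le hτ x y
  exact this.continuous

end IsProperClosedConvex

/-! ### First-order inequalities for the coupling function -/

namespace Problem

variable {n m : ℕ} {pr : Problem n m} {L : ℝ}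

theorem Admissible.hasGradientAt_x (hpr : pr.Admissible L) {x : Vec n} {y : Vec m}
    (hx : x ∈ pr.P) (hy : y ∈ pr.Q) :
    HasGradientAt (fun x' => pr.h x' y) (pr.gradX x y) x := by
  apply DifferentiableAt.hasGradientAt
  have h := hpr.differentiable x hx y hy
  exact DifferentiableAt.comp (f := fun x' : Vec n => (x', y)) x h
    (differentiableAt_id.prodMk (differentiableAt_const y))

theorem Admissible.hasGradientAt_y (hpr : pr.Admissible L) {x : Vec n} {y : Vec m}
    (hx : x ∈ pr.P) (hy : y ∈ pr.Q) :
    HasGradientAt (fun y' => pr.h x y') (pr.gradY x y) y := by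
  apply DifferentiableAt.hasGradientAt
  have h := hpr.differentiable x hx y hy
  exact DifferentiableAt.comp (f := fun y' : Vec m => (x, y')) y h
    ((differentiableAt_const x).prodMk differentiableAt_id)

theorem norm_le_jointDist_left (x x' : Vec n) (y y' : Vec m) : ‖x - x'‖ ≤ jointDist x y x' y' :=
  Real.le_sqrt_of_sq_le (by nlinarith [sq_nonneg ‖y - y'‖])

theorem norm_le_jointDist_right (x x' : Vec n) (y y' : Vec m) : ‖y - y'‖ ≤ jointDist x y x' y' :=
  Real.le_sqrt_of_sq_le (by nlinarith [sq_nonneg ‖x - x'‖])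

theorem jointDist_self_right (x x' : Vec n) (y : Vec m) : jointDist x y x' y = ‖x - x'‖ := by
  simp [jointDist]

theorem jointDist_self_left (x : Vec n) (y y' : Vec m) : jointDist x y x y' = ‖y - y'‖ := by
  simp [jointDist]

theorem hasDerivAt_line {f : Vec n → ℝ} {x d g : Vec n} {t : ℝ}
    (h : HasGradientAt f g (x + t • d)) :
    HasDerivAt (fun s : ℝ => f (x + s • d)) (inner ℝ g d) t := by
  have h1 : HasDerivAt (fun s : ℝ => x + s • d) d t := by
    simpa using ((hasDerivAt_id t).smul_const d).const_add x
  have h2 := h.hasFDerivAt.comp_hasDerivAt t h1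
  simpa [Function.comp_def] using! h2

/-- The two-sided quadratic bound for a function with Lipschitz gradient on a convex set. -/
theorem abs_sub_inner_le_of_lipschitz {D : Set (Vec n)} (hD : Convex ℝ D) {f : Vec n → ℝ}
    {g : Vec n → Vec n} {c : ℝ} (hf : ∀ x ∈ D, HasGradientAt f (g x) x)
    (hg : ∀ x ∈ D, ∀ x' ∈ D, ‖g x - g x'‖ ≤ c * ‖x - x'‖) {x x' : Vec n} (hx : x ∈ D)
    (hx' : x' ∈ D) :
    |f x' - f x - inner ℝ (g x) (x' - x)| ≤ c / 2 * ‖x' - x‖ ^ 2 := by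
  set d := x' - x with hd
  have hmem : ∀ t ∈ Set.Icc (0 : ℝ) 1, x + t • d ∈ D := fun t ht =>
    hD.add_smul_sub_mem hx hx' ht
  have hder : ∀ t ∈ Set.Icc (0 : ℝ) 1,
      HasDerivAt (fun s : ℝ => f (x + s • d)) (inner ℝ (g (x + t • d)) d) t := fun t ht =>
    hasDerivAt_line (hf _ (hmem t ht))
  have hbd : ∀ t ∈ Set.Icc (0 : ℝ) 1,
      |inner ℝ (g (x + t • d)) d - inner ℝ (g x) d| ≤ c * t * ‖d‖ ^ 2 := by
    intro t ht
    rw [← inner_sub_left]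
    refine (abs_real_inner_le_norm _ _).trans ?_
    have := hg _ (hmem t ht) x hx
    rw [add_sub_cancel_left, norm_smul, Real.norm_eq_abs, abs_of_nonneg ht.1] at this
    nlinarith [norm_nonneg d]
  -- Up to the sign `s`, the deviation from the tangent minus the quadratic bound is a function of
  -- the position on the segment that vanishes at `0` and has nonpositive derivative.
  have aux : ∀ s : ℝ, (s = 1 ∨ s = -1) →
      s * (f x' - f x - inner ℝ (g x) d) ≤ c / 2 * ‖d‖ ^ 2 := by
    intro s hs
    have hψ : ∀ t ∈ Set.Icc (0 : ℝ) 1, HasDerivAt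
        (fun t : ℝ => s * (f (x + t • d) - t * inner ℝ (g x) d) - c / 2 * t ^ 2 * ‖d‖ ^ 2)
        (s * (inner ℝ (g (x + t • d)) d - inner ℝ (g x) d) - c * t * ‖d‖ ^ 2) t := by
      intro t ht
      have h1 := (((hder t ht).sub ((hasDerivAt_id t).mul_const (inner ℝ (g x) d))).const_mul s).sub
        ((((hasDerivAt_id t).pow 2).const_mul (c / 2)).mul_const (‖d‖ ^ 2))
      convert! h1 using 1
      simp only [id_eq, Nat.cast_ofNat]
      ring
    have hanti : AntitoneOn
        (fun t : ℝ => s * (f (x + t • d) - t * inner ℝ (g x) d) - c / 2 * t ^ 2 * ‖d‖ ^ 2)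
        (Set.Icc 0 1) := by
      apply antitoneOn_of_hasDerivWithinAt_nonpos (convex_Icc 0 1)
        (fun t ht => (hψ t ht).continuousAt.continuousWithinAt)
        (fun t ht => (hψ t (interior_subset ht)).hasDerivWithinAt)
      intro t ht
      have := abs_le.1 (hbd t (interior_subset ht))
      rcases hs with rfl | rfl <;> linarith
    have := hanti (Set.left_mem_Icc.2 zero_le_one) (Set.right_mem_Icc.2 zero_le_one) zero_le_one
    simp [hd] at this
    simp only [hd]
    linarith
  rw [abs_le]
  exact ⟨by linarith [aux (-1) (Or.inr rfl)], by linarith [aux 1 (Or.inl rfl)]⟩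

theorem Admissible.lipschitz_gradX (hpr : pr.Admissible L) {x x' : Vec n} {y : Vec m}
    (hx : x ∈ pr.P) (hx' : x' ∈ pr.P) (hy : y ∈ pr.Q) :
    ‖pr.gradX x y - pr.gradX x' y‖ ≤ L * ‖x - x'‖ := by
  have := hpr.smooth x hx y hy x' hx' y hy
  rw [jointDist_self_right] at this
  exact (norm_le_jointDist_left _ _ _ _).trans this

theorem Admissible.lipschitz_gradY_left (hpr : pr.Admissible L) {x x' : Vec n} {y : Vec m}
    (hx : x ∈ pr.P) (hx' : x' ∈ pr.P) (hy : y ∈ pr.Q) :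
    ‖pr.gradY x y - pr.gradY x' y‖ ≤ L * ‖x - x'‖ := by
  have := hpr.smooth x hx y hy x' hx' y hy
  rw [jointDist_self_right] at this
  exact (norm_le_jointDist_right _ _ _ _).trans this

theorem Admissible.lipschitz_gradY_right (hpr : pr.Admissible L) {x : Vec n} {y y' : Vec m}
    (hx : x ∈ pr.P) (hy : y ∈ pr.Q) (hy' : y' ∈ pr.Q) :
    ‖pr.gradY x y - pr.gradY x y'‖ ≤ L * ‖y - y'‖ := by
  have := hpr.smooth x hx y hy x hx y' hy'
  rw [jointDist_self_left] at this
  exact (norm_le_jointDist_right _ _ _ _).trans this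

theorem Admissible.abs_sub_inner_gradX_le (hpr : pr.Admissible L) {x x' : Vec n} {y : Vec m}
    (hx : x ∈ pr.P) (hx' : x' ∈ pr.P) (hy : y ∈ pr.Q) :
    |pr.h x' y - pr.h x y - inner ℝ (pr.gradX x y) (x' - x)| ≤ L / 2 * ‖x' - x‖ ^ 2 :=
  abs_sub_inner_le_of_lipschitz hpr.p_closed.convexOn.1
    (fun _ h => hpr.hasGradientAt_x h hy) (fun _ h _ h' => hpr.lipschitz_gradX h h' hy) hx hx'

/-- The tangent inequality. As `h` is concave in `y` on `dom q` only, the derivative at `y` is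
compared with the slopes of the secants towards `y'`. -/
theorem Admissible.le_add_inner_gradY (hpr : pr.Admissible L) {x : Vec n} {y y' : Vec m}
    (hx : x ∈ pr.P) (hy : y ∈ pr.Q) (hy' : y' ∈ pr.Q) :
    pr.h x y' ≤ pr.h x y + inner ℝ (pr.gradY x y) (y' - y) := by
  have hder : HasDerivAt (fun s : ℝ => pr.h x (y + s • (y' - y)))
      (inner ℝ (pr.gradY x y) (y' - y)) 0 := by
    apply hasDerivAt_line (f := fun y => pr.h x y)
    simpa using hpr.hasGradientAt_y hx hy
  have hslope := (hasDerivAt_iff_tendsto_slope.1 hder).mono_left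
    (nhdsGT_le_nhdsNE (0 : ℝ))
  have := ge_of_tendsto hslope (b := pr.h x y' - pr.h x y) (by
    filter_upwards [Ioo_mem_nhdsGT (show (0 : ℝ) < 1 by norm_num)] with t ht
    have hc := (hpr.concave x hx).2 hy hy' (by linarith [ht.2] : 0 ≤ 1 - t) ht.1.le (by ring)
    have e : (1 - t) • y + t • y' = y + t • (y' - y) := by module
    rw [e] at hc
    simp only [smul_eq_mul] at hc
    rw [slope_def_field, le_div_iff₀ (by linarith [ht.1])]
    simp only [zero_smul, add_zero]
    linarith)
  linarith

end Problem

/-! ### Saddle points of the subproblems -/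

namespace Problem

variable {n m : ℕ} {pr : Problem n m} {L b : ℝ}

/-- The objective `H (x, y) + L ‖x - c‖² - b / 2 ‖y - y₀‖²` of a subproblem with the pair of
centres `z = (c, y₀)`. -/
def subH (pr : Problem n m) (L b : ℝ) (z : Vec n × Vec m) (x : Vec n) (y : Vec m) : ℝ :=
  pr.H x y + L * ‖x - z.1‖ ^ 2 - b / 2 * ‖y - z.2‖ ^ 2

/-- A saddle point of `subH` on `dom p × dom q`. -/
def saddle (pr : Problem n m) (L b : ℝ) (z : Vec n × Vec m) : Vec n × Vec m :=
  Classical.epsilon fun s => s.1 ∈ pr.P ∧ s.2 ∈ pr.Q ∧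
    IsSaddlePointOn pr.P pr.Q (pr.subH L b z) s.1 s.2

/-- The minimax value of a subproblem. As a function of the centre `c` it is a Moreau envelope of
`x ↦ max_y (H (x, y) - b / 2 ‖y - y₀‖²)`. -/
def saddleValue (pr : Problem n m) (L b : ℝ) (z : Vec n × Vec m) : ℝ :=
  pr.subH L b z (pr.saddle L b z).1 (pr.saddle L b z).2

theorem Admissible.continuousOn_left (hpr : pr.Admissible L) {y : Vec m} (hy : y ∈ pr.Q) :
    ContinuousOn (fun x => pr.h x y) pr.P := fun _ hx =>
  (hpr.hasGradientAt_x hx hy).continuousAt.continuousWithinAt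

theorem Admissible.continuousOn_right (hpr : pr.Admissible L) {x : Vec n} (hx : x ∈ pr.P) :
    ContinuousOn (fun y => pr.h x y) pr.Q := fun _ hy =>
  (hpr.hasGradientAt_y hx hy).continuousAt.continuousWithinAt

theorem Admissible.lowerSemicontinuousOn_H (hpr : pr.Admissible L) {y : Vec m} (hy : y ∈ pr.Q) :
    LowerSemicontinuousOn (fun x => pr.H x y) pr.P := by
  have h1 := (hpr.continuousOn_left hy).lowerSemicontinuousOn.add
    hpr.p_closed.lowerSemicontinuousOn
  have h2 := h1.add (lowerSemicontinuousOn_const (s := pr.P) (z := -pr.q y))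
  simpa [H, sub_eq_add_neg] using h2

theorem Admissible.upperSemicontinuousOn_H (hpr : pr.Admissible L) {x : Vec n} (hx : x ∈ pr.P) :
    UpperSemicontinuousOn (fun y => pr.H x y) pr.Q := by
  have h0 : UpperSemicontinuousOn (fun y => -pr.q y) pr.Q :=
    hpr.q_closed.lowerSemicontinuousOn.neg
  have h1 := ((hpr.continuousOn_right hx).upperSemicontinuousOn.add
    (upperSemicontinuousOn_const (z := pr.p x))).add h0
  simpa [H, sub_eq_add_neg] using h1

theorem Admissible.strongConvexOn_subH (hpr : pr.Admissible L) (z : Vec n × Vec m) {y : Vec m}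
    (hy : y ∈ pr.Q) : StrongConvexOn pr.P L (fun x => pr.subH L b z x y) := by
  have h1 : StrongConvexOn pr.P L
      (fun x => pr.h x y + L * ‖x - z.1‖ ^ 2 + (-pr.q y - b / 2 * ‖y - z.2‖ ^ 2)) := by
    refine strongConvexOn_of_inner_le hpr.p_closed.convexOn.1
      (g := fun x => pr.gradX x y + (2 * L) • (x - z.1)) fun x hx x' hx' => ?_
    have h1 := abs_le.1 (hpr.abs_sub_inner_gradX_le hx hx' hy)
    have h2 := norm_sub_sq_eq x' x z.1
    rw [inner_add_left, real_inner_smul_left, h2]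
    linarith
  have h2 := h1.add_of_convexOn hpr.p_closed.convexOn
  refine (congrArg (StrongConvexOn _ _) (funext fun _ => ?_)).mp h2
  simp only [subH, H]; ring

theorem Admissible.strongConvexOn_neg_subH (hpr : pr.Admissible L) (z : Vec n × Vec m)
    {x : Vec n} (hx : x ∈ pr.P) : StrongConvexOn pr.Q b (fun y => -pr.subH L b z x y) := by
  have h1 : StrongConvexOn pr.Q b
      (fun y => -pr.h x y + b / 2 * ‖y - z.2‖ ^ 2 + (-pr.p x - L * ‖x - z.1‖ ^ 2)) := by
    refine strongConvexOn_of_inner_le hpr.q_closed.convexOn.1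
      (g := fun y => -pr.gradY x y + b • (y - z.2)) fun y hy y' hy' => ?_
    have h1 := hpr.le_add_inner_gradY hx hy hy'
    have h2 := norm_sub_sq_eq y' y z.2
    rw [inner_add_left, real_inner_smul_left, inner_neg_left, h2]
    linarith
  have h2 := h1.add_of_convexOn hpr.q_closed.convexOn
  refine (congrArg (StrongConvexOn _ _) (funext fun _ => ?_)).mp h2
  simp only [subH, H]; ring

/-- The saddle point exists by Sion's minimax theorem. -/
theorem Admissible.saddle_spec (hpr : pr.Admissible L) (hL : 0 < L) (hb : 0 < b)
    (z : Vec n × Vec m) :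
    (pr.saddle L b z).1 ∈ pr.P ∧ (pr.saddle L b z).2 ∈ pr.Q ∧
      IsSaddlePointOn pr.P pr.Q (pr.subH L b z) (pr.saddle L b z).1 (pr.saddle L b z).2 := by
  obtain ⟨x, hx, y, hy, h⟩ := Sion.exists_isSaddlePointOn (f := pr.subH L b z)
    hpr.p_closed.nonempty hpr.p_closed.convexOn.1
    hpr.p_closed.isCompact
    (fun y hy => by
      have h1 := (hpr.lowerSemicontinuousOn_H hy).add
        ((by fun_prop : Continuous fun x : Vec n =>
          L * ‖x - z.1‖ ^ 2 - b / 2 * ‖y - z.2‖ ^ 2).lowerSemicontinuous.lowerSemicontinuousOn pr.P)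
      simpa [subH, add_sub_assoc] using h1)
    (fun y hy => ((hpr.strongConvexOn_subH z hy).convexOn
      (fun r => by dsimp only [Pi.zero_apply]; positivity)).quasiconvexOn)
    hpr.q_closed.convexOn.1 hpr.q_closed.nonempty hpr.q_closed.isCompact
    (fun x hx => by
      have h1 := (hpr.upperSemicontinuousOn_H hx).add
        ((by fun_prop : Continuous fun y : Vec m =>
          L * ‖x - z.1‖ ^ 2 - b / 2 * ‖y - z.2‖ ^ 2).upperSemicontinuous.upperSemicontinuousOn pr.Q)
      simpa [subH, add_sub_assoc] using h1)
    (fun x hx => by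
      have h1 := ((hpr.strongConvexOn_neg_subH (b := b) z hx).convexOn
        (fun r => by dsimp only [Pi.zero_apply]; positivity)).neg
      rw [show -(fun y => -pr.subH L b z x y) = fun y => pr.subH L b z x y from
        funext fun _ => neg_neg _] at h1
      exact h1.quasiconcaveOn)
  exact Classical.epsilon_spec (p := fun s : Vec n × Vec m => s.1 ∈ pr.P ∧ s.2 ∈ pr.Q ∧
    IsSaddlePointOn pr.P pr.Q (pr.subH L b z) s.1 s.2) ⟨(x, y), hx, hy, h⟩

section Saddle

variable (hpr : pr.Admissible L) (hL : 0 < L) (hb : 0 < b) (z z' : Vec n × Vec m)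
include hpr hL hb

theorem Admissible.saddle_mem_left : (pr.saddle L b z).1 ∈ pr.P := (hpr.saddle_spec hL hb z).1

theorem Admissible.saddle_mem_right : (pr.saddle L b z).2 ∈ pr.Q := (hpr.saddle_spec hL hb z).2.1

theorem Admissible.saddleValue_le {x : Vec n} (hx : x ∈ pr.P) :
    pr.saddleValue L b z ≤ pr.subH L b z x (pr.saddle L b z).2 :=
  (hpr.saddle_spec hL hb z).2.2 x hx _ (hpr.saddle_mem_right hL hb z)

theorem Admissible.le_saddleValue {y : Vec m} (hy : y ∈ pr.Q) :
    pr.subH L b z (pr.saddle L b z).1 y ≤ pr.saddleValue L b z :=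
  (hpr.saddle_spec hL hb z).2.2 _ (hpr.saddle_mem_left hL hb z) y hy

theorem Admissible.saddleValue_add_sq_le {x : Vec n} (hx : x ∈ pr.P) :
    pr.saddleValue L b z + L / 2 * ‖x - (pr.saddle L b z).1‖ ^ 2
      ≤ pr.subH L b z x (pr.saddle L b z).2 :=
  (hpr.strongConvexOn_subH z (hpr.saddle_mem_right hL hb z)).add_sq_le_of_isMinOn
    (hpr.saddle_mem_left hL hb z) (fun _ h => hpr.saddleValue_le hL hb z h) hx

theorem Admissible.add_sq_le_saddleValue {y : Vec m} (hy : y ∈ pr.Q) :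
    pr.subH L b z (pr.saddle L b z).1 y + b / 2 * ‖y - (pr.saddle L b z).2‖ ^ 2
      ≤ pr.saddleValue L b z := by
  have := (hpr.strongConvexOn_neg_subH (b := b) z
    (hpr.saddle_mem_left hL hb z)).add_sq_le_of_isMinOn (hpr.saddle_mem_right hL hb z)
    (fun _ h => neg_le_neg (hpr.le_saddleValue hL hb z h)) hy
  simp only [saddleValue]
  linarith

/-- Strong convexity and concavity make the saddle point depend continuously on the centres. -/
theorem Admissible.sq_saddle_sub_saddle_le :
    L * ‖(pr.saddle L b z').1 - (pr.saddle L b z).1‖ ^ 2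
      + b * ‖(pr.saddle L b z').2 - (pr.saddle L b z).2‖ ^ 2
      ≤ 4 * L * ‖z'.1 - z.1‖ ^ 2 + b * ‖z'.2 - z.2‖ ^ 2 := by
  have h1 := hpr.saddleValue_add_sq_le hL hb z (hpr.saddle_mem_left hL hb z')
  have h2 := hpr.add_sq_le_saddleValue hL hb z (hpr.saddle_mem_right hL hb z')
  have h3 := hpr.saddleValue_add_sq_le hL hb z' (hpr.saddle_mem_left hL hb z)
  have h4 := hpr.add_sq_le_saddleValue hL hb z' (hpr.saddle_mem_right hL hb z)
  set x := (pr.saddle L b z).1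
  set y := (pr.saddle L b z).2
  set x' := (pr.saddle L b z').1
  set y' := (pr.saddle L b z').2
  simp only [subH] at h1 h2 h3 h4
  rw [norm_sub_rev x x'] at h3
  rw [norm_sub_rev y y'] at h4
  have e1 : ‖x' - z.1‖ ^ 2 - ‖x' - z'.1‖ ^ 2 - ‖x - z.1‖ ^ 2 + ‖x - z'.1‖ ^ 2
      = 2 * inner ℝ (x' - x) (z'.1 - z.1) := by
    simp only [norm_sub_sq_real, inner_sub_left, inner_sub_right]; ring
  have e2 : ‖y' - z.2‖ ^ 2 - ‖y' - z'.2‖ ^ 2 - ‖y - z.2‖ ^ 2 + ‖y - z'.2‖ ^ 2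
      = 2 * inner ℝ (y' - y) (z'.2 - z.2) := by
    simp only [norm_sub_sq_real, inner_sub_left, inner_sub_right]; ring
  have f1 := real_inner_le_norm (x' - x) (z'.1 - z.1)
  have f2 := real_inner_le_norm (y' - y) (z'.2 - z.2)
  have g1 : 2 * inner ℝ (x' - x) (z'.1 - z.1) ≤ 1 / 2 * ‖x' - x‖ ^ 2 + 2 * ‖z'.1 - z.1‖ ^ 2 := by
    nlinarith [sq_nonneg (‖x' - x‖ - 2 * ‖z'.1 - z.1‖)]
  have g2 : 2 * inner ℝ (y' - y) (z'.2 - z.2) ≤ ‖y' - y‖ ^ 2 + ‖z'.2 - z.2‖ ^ 2 := by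
    nlinarith [sq_nonneg (‖y' - y‖ - ‖z'.2 - z.2‖)]
  have k1 := mul_le_mul_of_nonneg_left g1 hL.le
  have k2 := mul_le_mul_of_nonneg_left g2 hb.le
  have k3 := congrArg (fun t => L * t) e1
  have k4 := congrArg (fun t => b / 2 * t) e2
  beta_reduce at k3 k4
  linarith

theorem Admissible.continuous_saddle : Continuous (pr.saddle L b) := by
  have key : ∀ z : Vec n × Vec m, Filter.Tendsto
      (fun z' : Vec n × Vec m => 4 * L * ‖z'.1 - z.1‖ ^ 2 + b * ‖z'.2 - z.2‖ ^ 2) (𝓝 z) (𝓝 0) := by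
    intro z
    have : Continuous
        (fun z' : Vec n × Vec m => 4 * L * ‖z'.1 - z.1‖ ^ 2 + b * ‖z'.2 - z.2‖ ^ 2) := by fun_prop
    simpa using this.tendsto z
  have sq : ∀ {l : Filter (Vec n × Vec m)} {f : Vec n × Vec m → ℝ}, (∀ z, 0 ≤ f z) →
      Filter.Tendsto (fun z => f z ^ 2) l (𝓝 0) → Filter.Tendsto f l (𝓝 0) := by
    intro l f hf h
    have := (Real.continuous_sqrt.tendsto 0).comp h
    simpa [Function.comp_def, Real.sqrt_sq (hf _)] using this
  refine continuous_prodMk.2 ?_ |> fun h => (h : Continuous fun z => ((pr.saddle L b z).1,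
    (pr.saddle L b z).2))
  constructor
  · refine continuous_iff_continuousAt.2 fun z => tendsto_iff_norm_sub_tendsto_zero.2 ?_
    refine sq (fun _ => norm_nonneg _) ?_
    have h0 := (key z).div_const L
    rw [zero_div] at h0
    refine squeeze_zero (fun _ => sq_nonneg _) (fun z' => ?_) h0
    rw [le_div_iff₀ hL]
    have := hpr.sq_saddle_sub_saddle_le hL hb z z'
    nlinarith [mul_nonneg hb.le (sq_nonneg ‖(pr.saddle L b z').2 - (pr.saddle L b z).2‖)]
  · refine continuous_iff_continuousAt.2 fun z => tendsto_iff_norm_sub_tendsto_zero.2 ?_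
    refine sq (fun _ => norm_nonneg _) ?_
    have h0 := (key z).div_const b
    rw [zero_div] at h0
    refine squeeze_zero (fun _ => sq_nonneg _) (fun z' => ?_) h0
    rw [le_div_iff₀ hb]
    have := hpr.sq_saddle_sub_saddle_le hL hb z z'
    nlinarith [mul_nonneg hL.le (sq_nonneg ‖(pr.saddle L b z').1 - (pr.saddle L b z).1‖)]

end Saddle

end Problem

/-! ### The primal function and near-stationarity of the saddle points -/

namespace Problem

variable {n m : ℕ} {pr : Problem n m} {L b : ℝ}

theorem Admissible.exists_maxH_eq (hpr : pr.Admissible L) {x : Vec n} (hx : x ∈ pr.P) :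
    ∃ y ∈ pr.Q, IsMaxOn (fun y => pr.H x y) pr.Q y ∧ pr.maxH x = pr.H x y := by
  obtain ⟨y, hy, hmax⟩ := (hpr.upperSemicontinuousOn_H hx).exists_isMaxOn hpr.q_closed.nonempty
    hpr.q_closed.isCompact
  exact ⟨y, hy, hmax, IsGreatest.csSup_eq
    ⟨⟨y, hy, rfl⟩, fun _ ⟨y', hy', h⟩ => h ▸ hmax hy'⟩⟩

theorem Admissible.H_le_maxH (hpr : pr.Admissible L) {x : Vec n} (hx : x ∈ pr.P) {y : Vec m}
    (hy : y ∈ pr.Q) : pr.H x y ≤ pr.maxH x := by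
  obtain ⟨y', _, hmax, h⟩ := hpr.exists_maxH_eq hx
  exact h ▸ hmax hy

theorem Admissible.lowerSemicontinuousOn_maxH (hpr : pr.Admissible L) :
    LowerSemicontinuousOn pr.maxH pr.P := by
  intro x hx c hc
  obtain ⟨y, hy, -, h⟩ := hpr.exists_maxH_eq hx
  filter_upwards [hpr.lowerSemicontinuousOn_H hy x hx c (lt_of_lt_of_eq hc h), self_mem_nhdsWithin]
    with x' h1 h2 using h1.trans_le (hpr.H_le_maxH h2 hy)

/-- As `maxH` attains its minimum over `dom p`, the infimum `Hstar` is over a set that is bounded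
below. -/
theorem Admissible.Hstar_le_maxH (hpr : pr.Admissible L) {x : Vec n} (hx : x ∈ pr.P) :
    pr.Hstar ≤ pr.maxH x := by
  obtain ⟨x', _, hmin⟩ := hpr.lowerSemicontinuousOn_maxH.exists_isMinOn hpr.p_closed.nonempty
    hpr.p_closed.isCompact
  exact csInf_le ⟨pr.maxH x', fun _ ⟨u, hu, h⟩ => h ▸ hmin hu⟩ ⟨x, hx, rfl⟩

theorem Admissible.measurable_maxH_comp (hpr : pr.Admissible L) {Ω : Type*} [MeasurableSpace Ω]
    {X : Ω → Vec n} (hX : Measurable X) (hmem : ∀ ω, X ω ∈ pr.P) :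
    Measurable fun ω => pr.maxH (X ω) := by
  have h1 := (lowerSemicontinuous_restrict_iff.2 hpr.lowerSemicontinuousOn_maxH).measurable
  exact h1.comp (hX.subtype_mk (h := hmem))

theorem Admissible.norm_sub_le_Dp (hpr : pr.Admissible L) {x x' : Vec n} (hx : x ∈ pr.P)
    (hx' : x' ∈ pr.P) : ‖x - x'‖ ≤ pr.Dp := by
  rw [← dist_eq_norm]
  exact Metric.dist_le_diam_of_mem hpr.p_closed.isCompact.isBounded hx hx'

theorem Admissible.norm_sub_le_Dq (hpr : pr.Admissible L) {y y' : Vec m} (hy : y ∈ pr.Q)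
    (hy' : y' ∈ pr.Q) : ‖y - y'‖ ≤ pr.Dq := by
  rw [← dist_eq_norm]
  exact Metric.dist_le_diam_of_mem hpr.q_closed.isCompact.isBounded hy hy'

section Saddle

variable (hpr : pr.Admissible L) (hL : 0 < L) (hb : 0 < b)
include hpr hL hb

theorem Admissible.saddleValue_le_maxH {c : Vec n} (hc : c ∈ pr.P) (y₀ : Vec m) :
    pr.saddleValue L b (c, y₀) ≤ pr.maxH c := by
  have h1 := hpr.saddleValue_le hL hb (c, y₀) hc
  have h2 := hpr.H_le_maxH hc (hpr.saddle_mem_right hL hb (c, y₀))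
  simp only [subH, sub_self, norm_zero] at h1
  have : 0 ≤ b / 2 * ‖(pr.saddle L b (c, y₀)).2 - y₀‖ ^ 2 := by positivity
  linarith

/-- The regularization in `y` changes the primal function by at most `b / 2` times the squared
diameter of `dom q`. -/
theorem Admissible.maxH_saddle_le (c : Vec n) {y₀ : Vec m} (hy₀ : y₀ ∈ pr.Q) :
    pr.maxH (pr.saddle L b (c, y₀)).1 + L * ‖(pr.saddle L b (c, y₀)).1 - c‖ ^ 2
      ≤ pr.saddleValue L b (c, y₀) + b / 2 * pr.Dq ^ 2 := by
  obtain ⟨y, hy, -, h⟩ := hpr.exists_maxH_eq (hpr.saddle_mem_left hL hb (c, y₀))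
  have h1 := hpr.le_saddleValue hL hb (c, y₀) hy
  have h2 : ‖y - y₀‖ ^ 2 ≤ pr.Dq ^ 2 := by gcongr; exact hpr.norm_sub_le_Dq hy hy₀
  have h3 : b / 2 * ‖y - y₀‖ ^ 2 ≤ b / 2 * pr.Dq ^ 2 := by gcongr
  simp only [subH] at h1
  linarith

/-- The saddle point of one subproblem is a test point for the next one. -/
theorem Admissible.saddleValue_step (c c' : Vec n) (y₀ : Vec m) :
    pr.saddleValue L b (c', y₀) ≤ pr.saddleValue L b (c, y₀)
      + L * (‖(pr.saddle L b (c, y₀)).1 - c'‖ ^ 2 - ‖(pr.saddle L b (c, y₀)).1 - c‖ ^ 2) := by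
  have h1 := hpr.saddleValue_le hL hb (c', y₀) (hpr.saddle_mem_left hL hb (c, y₀))
  have h2 := hpr.le_saddleValue hL hb (c, y₀) (hpr.saddle_mem_right hL hb (c', y₀))
  simp only [subH] at h1 h2
  linarith

omit hpr hL hb in
/-- If `f + (c / 2) ‖· - z‖²` has a minimum over `D` at `x`, then `-c (x - z)` is a subgradient. -/
theorem smul_mem_subdifferential {D : Set (Vec n)} {f : Vec n → ℝ} {x z : Vec n} {c : ℝ}
    (hx : x ∈ D) (hmin : ∀ x' ∈ D, f x + c / 2 * ‖x - z‖ ^ 2 ≤ f x' + c / 2 * ‖x' - z‖ ^ 2) :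
    (-c) • (x - z) ∈ subdifferential D f x := by
  refine ⟨hx, fun d hd => ?_⟩
  have hlim : Filter.Tendsto (fun x' => c / 2 * ‖x' - x‖) (𝓝[D] x) (𝓝 0) := by
    have : Continuous fun x' => c / 2 * ‖x' - x‖ := by fun_prop
    have h0 := this.tendsto x
    rw [sub_self, norm_zero, mul_zero] at h0
    exact h0.mono_left nhdsWithin_le_nhds
  filter_upwards [hlim.eventually_lt_const hd, self_mem_nhdsWithin] with x' h1 h2
  have h3 := hmin x' h2
  rw [norm_sub_sq_eq x' x z] at h3
  rw [real_inner_smul_left]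
  have h4 := mul_le_mul_of_nonneg_right h1.le (norm_nonneg (x' - x))
  nlinarith

theorem Admissible.distX_saddle_le (c : Vec n) (y₀ : Vec m) :
    pr.distX (pr.saddle L b (c, y₀)).1 (pr.saddle L b (c, y₀)).2
      ≤ ENNReal.ofReal (2 * L * ‖(pr.saddle L b (c, y₀)).1 - c‖) := by
  have h : (-(2 * L)) • ((pr.saddle L b (c, y₀)).1 - c) ∈ subdifferential pr.P
      (fun x' => pr.H x' (pr.saddle L b (c, y₀)).2) (pr.saddle L b (c, y₀)).1 := by
    refine smul_mem_subdifferential (hpr.saddle_mem_left hL hb _) fun x' hx' => ?_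
    have := hpr.saddleValue_le hL hb (c, y₀) hx'
    simp only [saddleValue, subH] at this
    linarith
  refine (Metric.infEDist_le_edist_of_mem h).trans ?_
  rw [edist_dist, dist_zero_left, norm_smul, norm_neg, Real.norm_of_nonneg (by positivity)]

theorem Admissible.distY_saddle_le (c : Vec n) (y₀ : Vec m) :
    pr.distY (pr.saddle L b (c, y₀)).1 (pr.saddle L b (c, y₀)).2
      ≤ ENNReal.ofReal (b * ‖(pr.saddle L b (c, y₀)).2 - y₀‖) := by
  have h : (-b) • ((pr.saddle L b (c, y₀)).2 - y₀) ∈ subdifferential pr.Q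
      (fun y' => -pr.H (pr.saddle L b (c, y₀)).1 y') (pr.saddle L b (c, y₀)).2 := by
    refine smul_mem_subdifferential (hpr.saddle_mem_right hL hb _) fun y' hy' => ?_
    have := hpr.le_saddleValue hL hb (c, y₀) hy'
    simp only [saddleValue, subH] at this
    linarith
  refine (Metric.infEDist_le_edist_of_mem h).trans ?_
  rw [edist_dist, dist_zero_left, norm_smul, norm_neg, Real.norm_of_nonneg (by positivity)]

end Saddle

end Problem

/-! ### One iteration of SAPD -/

/-- The three-point inequality for a proximal step from `x` in the direction `-v`. -/
theorem IsProperClosedConvex.prox_inner_le {n : ℕ} {D : Set (Vec n)} {f : Vec n → ℝ}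
    (hf : IsProperClosedConvex D f) {τ : ℝ} (hτ : 0 < τ) (x v : Vec n) {w : Vec n} (hw : w ∈ D) :
    f (prox D f τ (x - τ • v)) + inner ℝ v (prox D f τ (x - τ • v) - w)
      + τ⁻¹ / 2 * (‖prox D f τ (x - τ • v) - x‖ ^ 2 + ‖prox D f τ (x - τ • v) - w‖ ^ 2
        - ‖x - w‖ ^ 2) ≤ f w := by
  have h := hf.prox_three_point hτ (x - τ • v) hw
  set u := prox D f τ (x - τ • v)
  have e1 : ‖u - (x - τ • v)‖ ^ 2 = ‖u - x‖ ^ 2 + 2 * (τ * inner ℝ v (u - x)) + ‖τ • v‖ ^ 2 := by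
    rw [show u - (x - τ • v) = (u - x) + τ • v by abel, norm_add_sq_real, inner_smul_right,
      real_inner_comm]
  have e2 : ‖w - (x - τ • v)‖ ^ 2 = ‖x - w‖ ^ 2 + 2 * (τ * inner ℝ v (w - x)) + ‖τ • v‖ ^ 2 := by
    rw [show w - (x - τ • v) = (w - x) + τ • v by abel, norm_add_sq_real, inner_smul_right,
      real_inner_comm, norm_sub_rev w x]
  have e3 : inner ℝ v (u - w) = inner ℝ v (u - x) - inner ℝ v (w - x) := by
    rw [← inner_sub_right]; congr 1; abel
  rw [e1, e2, norm_sub_rev w u] at h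
  have h2 : τ * (f u + inner ℝ v (u - w)
      + τ⁻¹ / 2 * (‖u - x‖ ^ 2 + ‖u - w‖ ^ 2 - ‖x - w‖ ^ 2)) ≤ τ * f w := by
    rw [e3]
    have : τ * τ⁻¹ = 1 := mul_inv_cancel₀ hτ.ne'
    calc _ = τ * f u + τ * inner ℝ v (u - x) - τ * inner ℝ v (w - x)
        + (τ * τ⁻¹) / 2 * (‖u - x‖ ^ 2 + ‖u - w‖ ^ 2 - ‖x - w‖ ^ 2) := by ring
      _ ≤ _ := by rw [this]; linarith
  exact le_of_mul_le_mul_left h2 hτ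

/-- The relations between the step sizes `τ`, `σ`, the momentum `θ` and the constants of the
problem under which the Lyapunov function of SAPD contracts. Here `M` is a Lipschitz constant of
the gradients of the subproblem, and `a`, `b` are the moduli of strong convexity and concavity. -/
structure StepParams (a b M τ σ θ β : ℝ) : Prop where
  τ_pos : 0 < τ
  σ_pos : 0 < σ
  θ_pos : 0 < θ
  β_pos : 0 < β
  β_le : β ≤ 1 / 2
  contract_x : τ⁻¹ - a ≤ θ * τ⁻¹
  contract_y : σ⁻¹ ≤ θ * (σ⁻¹ + b)
  step_x : 2 * (σ * θ * M ^ 2 / β) ≤ τ⁻¹ - M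
  step_y : σ ^ 2 * θ * M ^ 2 ≤ (1 - β) ^ 2 / 16

namespace StepParams

variable {a b M τ σ θ β : ℝ}

/-- Bounds the part of the momentum cross term that comes from the last step in `x`. -/
theorem young_x (hs : StepParams a b M τ σ θ β) (u v : ℝ) :
    θ * M * u * v ≤ β * σ⁻¹ / 4 * v ^ 2 + θ * (σ * θ * M ^ 2 / β) * u ^ 2 := by
  have hσ := hs.σ_pos
  have hβ := hs.β_pos
  have key : β * σ⁻¹ / 4 * v ^ 2 + θ * (σ * θ * M ^ 2 / β) * u ^ 2 - θ * M * u * v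
      = β * σ⁻¹ / 4 * (v - 2 * σ / β * (θ * M * u)) ^ 2 := by
    field_simp
    ring
  have : 0 ≤ β * σ⁻¹ / 4 * (v - 2 * σ / β * (θ * M * u)) ^ 2 := by positivity
  linarith

/-- Bounds the part of the momentum cross term that comes from the last step in `y`. -/
theorem young_y (hs : StepParams a b M τ σ θ β) (u v : ℝ) :
    θ * M * u * v ≤ (1 - β) * σ⁻¹ / 8 * v ^ 2 + θ * ((1 - β) * σ⁻¹ / 8) * u ^ 2 := by
  have hσ := hs.σ_pos
  have hβ : 0 < 1 - β := by linarith [hs.β_le]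
  have h1 : 2 * ((1 - β) / 4) * (σ * (θ * M * u * v))
      ≤ ((1 - β) / 4) ^ 2 * v ^ 2 + θ * (σ ^ 2 * θ * M ^ 2) * u ^ 2 := by
    nlinarith [sq_nonneg ((1 - β) / 4 * v - σ * θ * M * u)]
  have h2 : θ * (σ ^ 2 * θ * M ^ 2) * u ^ 2 ≤ θ * ((1 - β) ^ 2 / 16) * u ^ 2 := by
    have := hs.step_y
    have := hs.θ_pos
    gcongr
  have h3 : θ * M * u * v * ((1 - β) * σ) ≤
      ((1 - β) * σ⁻¹ / 8 * v ^ 2 + θ * ((1 - β) * σ⁻¹ / 8) * u ^ 2) * ((1 - β) * σ) := by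
    have : ((1 - β) * σ⁻¹ / 8 * v ^ 2 + θ * ((1 - β) * σ⁻¹ / 8) * u ^ 2) * ((1 - β) * σ)
      = (1 - β) ^ 2 / 8 * v ^ 2 + θ * (1 - β) ^ 2 / 8 * u ^ 2 := by field_simp
    rw [this]
    linarith
  exact le_of_mul_le_mul_right h3 (by positivity)

/-- With `young_x`, shows that the squared lengths of the last step dominate the inner product in
the Lyapunov function. -/
theorem young_end (hs : StepParams a b M τ σ θ β) (u v : ℝ) :
    θ * M * u * v ≤ (1 - β) ^ 2 * σ⁻¹ / 12 * v ^ 2 + θ * (3 / 16 * σ⁻¹) * u ^ 2 := by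
  have hσ := hs.σ_pos
  have hθ := hs.θ_pos
  have key : 4 / 3 * σ⁻¹ * (σ ^ 2 * θ * M ^ 2) * v ^ 2 + θ * (3 / 16 * σ⁻¹) * u ^ 2 - θ * M * u * v
      = θ * (3 / 16 * σ⁻¹) * (u - 8 / 3 * σ * M * v) ^ 2 := by
    field_simp
    ring
  have h1 : 0 ≤ θ * (3 / 16 * σ⁻¹) * (u - 8 / 3 * σ * M * v) ^ 2 := by positivity
  have h2 : 4 / 3 * σ⁻¹ * (σ ^ 2 * θ * M ^ 2) * v ^ 2
      ≤ 4 / 3 * σ⁻¹ * ((1 - β) ^ 2 / 16) * v ^ 2 := by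
    have := hs.step_y
    gcongr
  linarith

end StepParams

namespace Problem

variable {n m : ℕ} {pr : Problem n m} {L b M τ σ θ β : ℝ}

/-- The smooth part of the objective of a subproblem. -/
def subh (pr : Problem n m) (L b : ℝ) (z : Vec n × Vec m) (x : Vec n) (y : Vec m) : ℝ :=
  pr.h x y + L * ‖x - z.1‖ ^ 2 - b / 2 * ‖y - z.2‖ ^ 2

/-- The `x`-gradient of `subh`. -/
def subGradX (pr : Problem n m) (L : ℝ) (z : Vec n × Vec m) (x : Vec n) (y : Vec m) : Vec n :=
  pr.gradX x y + (2 * L) • (x - z.1)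

/-- The `y`-gradient of `subh`. -/
def subGradY (pr : Problem n m) (b : ℝ) (z : Vec n × Vec m) (x : Vec n) (y : Vec m) : Vec m :=
  pr.gradY x y - b • (y - z.2)

theorem Admissible.subh_le (hpr : pr.Admissible L) (hM : 3 * L ≤ M) (z : Vec n × Vec m)
    {x x' : Vec n} {y : Vec m} (hx : x ∈ pr.P) (hx' : x' ∈ pr.P) (hy : y ∈ pr.Q) :
    pr.subh L b z x' y ≤ pr.subh L b z x y + inner ℝ (pr.subGradX L z x y) (x' - x)
      + M / 2 * ‖x' - x‖ ^ 2 := by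
  have h1 := abs_le.1 (hpr.abs_sub_inner_gradX_le hx hx' hy)
  have h2 := norm_sub_sq_eq x' x z.1
  have h3 := mul_le_mul_of_nonneg_right hM (sq_nonneg ‖x' - x‖)
  simp only [subh, subGradX]
  rw [inner_add_left, real_inner_smul_left, h2]
  linarith

theorem Admissible.le_subh (hpr : pr.Admissible L) (z : Vec n × Vec m)
    {x x' : Vec n} {y : Vec m} (hx : x ∈ pr.P) (hx' : x' ∈ pr.P) (hy : y ∈ pr.Q) :
    pr.subh L b z x y + inner ℝ (pr.subGradX L z x y) (x' - x) + L / 2 * ‖x' - x‖ ^ 2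
      ≤ pr.subh L b z x' y := by
  have h1 := abs_le.1 (hpr.abs_sub_inner_gradX_le hx hx' hy)
  have h2 := norm_sub_sq_eq x' x z.1
  simp only [subh, subGradX]
  rw [inner_add_left, real_inner_smul_left, h2]
  linarith

theorem Admissible.subh_le_right (hpr : pr.Admissible L) (z : Vec n × Vec m)
    {x : Vec n} {y y' : Vec m} (hx : x ∈ pr.P) (hy : y ∈ pr.Q) (hy' : y' ∈ pr.Q) :
    pr.subh L b z x y' ≤ pr.subh L b z x y + inner ℝ (pr.subGradY b z x y) (y' - y)
      - b / 2 * ‖y' - y‖ ^ 2 := by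
  have h1 := hpr.le_add_inner_gradY hx hy hy'
  have h2 := norm_sub_sq_eq y' y z.2
  simp only [subh, subGradY]
  rw [inner_sub_left, real_inner_smul_left, h2]
  linarith

theorem Admissible.norm_subGradY_sub_le (hpr : pr.Admissible L) (hb : 0 ≤ b)
    (hM : L + b ≤ M) (z : Vec n × Vec m) {x x' : Vec n} {y y' : Vec m}
    (hx : x ∈ pr.P) (hx' : x' ∈ pr.P) (hy : y ∈ pr.Q) (hy' : y' ∈ pr.Q) :
    ‖pr.subGradY b z x y - pr.subGradY b z x' y'‖ ≤ M * (‖x - x'‖ + ‖y - y'‖) := by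
  have h1 := hpr.lipschitz_gradY_left hx hx' hy
  have h2 := hpr.lipschitz_gradY_right hx' hy hy'
  have e : pr.subGradY b z x y - pr.subGradY b z x' y' = (pr.gradY x y - pr.gradY x' y)
      + (pr.gradY x' y - pr.gradY x' y') - b • (y - y') := by
    simp only [subGradY, smul_sub]; abel
  rw [e]
  refine (norm_sub_le _ _).trans ((add_le_add_left (norm_add_le _ _) _).trans ?_)
  rw [norm_smul, Real.norm_of_nonneg hb]
  nlinarith [norm_nonneg (x - x'), norm_nonneg (y - y')]

/-- The Lyapunov function of SAPD at the current point `(x, y)` with previous point `(x₁, y₁)`: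
the weighted squared distances to the saddle point, the inner product left by the momentum, and
multiples of the squared lengths of the last step that dominate this inner product. -/
def lyapunov (pr : Problem n m) (L b M τ σ θ β : ℝ) (z : Vec n × Vec m) (x x₁ : Vec n)
    (y y₁ : Vec m) : ℝ :=
  θ * τ⁻¹ / 2 * ‖x - (pr.saddle L b z).1‖ ^ 2 + σ⁻¹ / 2 * ‖y - (pr.saddle L b z).2‖ ^ 2
    + θ * inner ℝ (pr.subGradY b z x y - pr.subGradY b z x₁ y₁) (y - (pr.saddle L b z).2)
    + θ * (σ * θ * M ^ 2 / β) * ‖x - x₁‖ ^ 2 + θ * (3 / 16 * σ⁻¹) * ‖y - y₁‖ ^ 2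

/-- The Lyapunov function controls the distance to the saddle point. -/
theorem Admissible.le_lyapunov (hpr : pr.Admissible L) (hs : StepParams L b M τ σ θ β)
    (hb : 0 ≤ b) (hM : L + b ≤ M) (z : Vec n × Vec m) {x x₁ : Vec n} {y y₁ : Vec m}
    (hx : x ∈ pr.P) (hx₁ : x₁ ∈ pr.P) (hy : y ∈ pr.Q) (hy₁ : y₁ ∈ pr.Q) :
    θ * τ⁻¹ / 2 * ‖x - (pr.saddle L b z).1‖ ^ 2 + 11 / 32 * σ⁻¹ * ‖y - (pr.saddle L b z).2‖ ^ 2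
      ≤ pr.lyapunov L b M τ σ θ β z x x₁ y y₁ := by
  have h1 := hpr.norm_subGradY_sub_le hb hM z hx hx₁ hy hy₁
  have h2 := neg_le_of_abs_le (abs_real_inner_le_norm
    (pr.subGradY b z x y - pr.subGradY b z x₁ y₁) (y - (pr.saddle L b z).2))
  have h3 := hs.young_x ‖x - x₁‖ ‖y - (pr.saddle L b z).2‖
  have h4 := hs.young_end ‖y - y₁‖ ‖y - (pr.saddle L b z).2‖
  simp only [lyapunov]
  set r := ‖y - (pr.saddle L b z).2‖
  have hr : 0 ≤ r := norm_nonneg _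
  have h5 := mul_le_mul_of_nonneg_right h1 hr
  have h6 := mul_le_mul_of_nonneg_left (h2.trans' (neg_le_neg h5)) hs.θ_pos.le
  have hσ : 0 < σ⁻¹ := inv_pos.2 hs.σ_pos
  have h7 : 0 ≤ (1 / 2 - β / 4 - (1 - β) ^ 2 / 12 - 11 / 32) * (σ⁻¹ * r ^ 2) := by
    have := hs.β_le
    have := hs.β_pos
    exact mul_nonneg (by nlinarith) (by positivity)
  linarith

/-- One step of SAPD with a perturbed gradient: `ξ` is the error of the `x`-gradient and `w` that of
the extrapolated `y`-gradient. -/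
theorem Admissible.lyapunov_step (hpr : pr.Admissible L) (hs : StepParams L b M τ σ θ β)
    (hL : 0 < L) (hb : 0 < b) (hM : 3 * L ≤ M) (hM' : L + b ≤ M) (z : Vec n × Vec m)
    {x x₁ x' ξ : Vec n} {y y₁ y' w : Vec m}
    (hx : x ∈ pr.P) (hx₁ : x₁ ∈ pr.P) (hy : y ∈ pr.Q) (hy₁ : y₁ ∈ pr.Q)
    (hy' : y' = prox pr.Q pr.q σ (y + σ • (pr.subGradY b z x y
      + θ • (pr.subGradY b z x y - pr.subGradY b z x₁ y₁) + w)))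
    (hx' : x' = prox pr.P pr.p τ (x - τ • (pr.subGradX L z x y' + ξ))) :
    pr.lyapunov L b M τ σ θ β z x' x y' y ≤ θ * (pr.lyapunov L b M τ σ θ β z x x₁ y y₁
      - inner ℝ ξ (x' - (pr.saddle L b z).1) + inner ℝ w (y' - (pr.saddle L b z).2)
      - 1 / 8 * σ⁻¹ * ‖y' - y‖ ^ 2) := by
  have hy'm : y' ∈ pr.Q := hy' ▸ hpr.q_closed.prox_mem hs.σ_pos _
  have hx'm : x' ∈ pr.P := hx' ▸ hpr.p_closed.prox_mem hs.τ_pos _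
  have hsx := hpr.saddle_mem_left hL hb z
  have hsy := hpr.saddle_mem_right hL hb z
  have I1 := hpr.p_closed.prox_inner_le hs.τ_pos x (pr.subGradX L z x y' + ξ) hsx
  rw [← hx'] at I1
  have I2 := hpr.q_closed.prox_inner_le hs.σ_pos y (-(pr.subGradY b z x y
      + θ • (pr.subGradY b z x y - pr.subGradY b z x₁ y₁) + w)) hsy
  rw [smul_neg, sub_neg_eq_add, ← hy'] at I2
  have H1 := hpr.subh_le (b := b) hM z hx hx'm hy'm
  have H2 := hpr.le_subh (b := b) z hx hsx hy'm
  have H3 := hpr.subh_le_right (b := b) z hx'm hy'm hsy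
  -- The saddle point property makes the primal-dual gap at the new point nonnegative.
  have gap := (hpr.saddle_spec hL hb z).2.2 x' hx'm y' hy'm
  have hq := hpr.norm_subGradY_sub_le hb.le hM' z hx hx₁ hy hy₁
  simp only [lyapunov]
  set xs := (pr.saddle L b z).1
  set ys := (pr.saddle L b z).2
  have gap' : pr.subh L b z xs y' + pr.p xs - pr.q y'
      ≤ pr.subh L b z x' ys + pr.p x' - pr.q ys := by
    simp only [subH, H] at gap
    simp only [subh]
    linarith
  set g := pr.subGradX L z x y'
  set F := pr.subGradY b z x y
  set F₁ := pr.subGradY b z x₁ y₁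
  set F' := pr.subGradY b z x' y'
  have e1 : inner ℝ (g + ξ) (x' - xs) = inner ℝ g (x' - x) - inner ℝ g (xs - x)
      + inner ℝ ξ (x' - xs) := by
    rw [inner_add_left, ← inner_sub_right]; congr 2; abel
  have e2 : inner ℝ (-(F + θ • (F - F₁) + w)) (y' - ys) = inner ℝ F' (ys - y')
      + inner ℝ (F' - F) (y' - ys) - θ * inner ℝ (F - F₁) (y - ys)
      - θ * inner ℝ (F - F₁) (y' - y) - inner ℝ w (y' - ys) := by
    simp only [inner_neg_left, inner_add_left, real_inner_smul_left, inner_sub_left,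
      inner_sub_right]
    ring
  rw [e1] at I1
  rw [e2] at I2
  rw [norm_sub_rev xs x] at H2
  rw [norm_sub_rev ys y'] at H3
  have c1 := (real_inner_le_norm (F - F₁) (y' - y)).trans
    (mul_le_mul_of_nonneg_right hq (norm_nonneg _))
  have c2 := mul_le_mul_of_nonneg_left c1 hs.θ_pos.le
  have y1 := hs.young_x ‖x - x₁‖ ‖y' - y‖
  have y2 := hs.young_y ‖y - y₁‖ ‖y' - y‖
  have hσ : 0 < σ⁻¹ := inv_pos.2 hs.σ_pos
  have d1 := mul_le_mul_of_nonneg_right hs.contract_x (sq_nonneg ‖x - xs‖)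
  have d2 := mul_le_mul_of_nonneg_right hs.contract_y (sq_nonneg ‖y' - ys‖)
  have d3 := mul_le_mul_of_nonneg_right hs.step_x (sq_nonneg ‖x' - x‖)
  -- What the multiples of the squared steps in the Lyapunov function and in the claim leave.
  have d4 : 0 ≤ (1 / 2 - β / 4 - (1 - β) / 8 - 3 / 16 - 1 / 8) * (σ⁻¹ * ‖y' - y‖ ^ 2) :=
    mul_nonneg (by linarith [hs.β_le]) (by positivity)
  have d5 : 0 ≤ (3 / 16 - (1 - β) / 8) * (θ * (σ⁻¹ * ‖y - y₁‖ ^ 2)) :=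
    mul_nonneg (by linarith [hs.β_pos]) (mul_nonneg hs.θ_pos.le (by positivity))
  have main : τ⁻¹ / 2 * ‖x' - xs‖ ^ 2 + (σ⁻¹ + b) / 2 * ‖y' - ys‖ ^ 2
      + inner ℝ (F' - F) (y' - ys) + (σ * θ * M ^ 2 / β) * ‖x' - x‖ ^ 2
      + (3 / 16 * σ⁻¹) * ‖y' - y‖ ^ 2
      ≤ θ * τ⁻¹ / 2 * ‖x - xs‖ ^ 2 + σ⁻¹ / 2 * ‖y - ys‖ ^ 2 + θ * inner ℝ (F - F₁) (y - ys)
        + θ * (σ * θ * M ^ 2 / β) * ‖x - x₁‖ ^ 2 + θ * (3 / 16 * σ⁻¹) * ‖y - y₁‖ ^ 2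
        - inner ℝ ξ (x' - xs) + inner ℝ w (y' - ys) - 1 / 8 * σ⁻¹ * ‖y' - y‖ ^ 2 := by
    linarith
  have := mul_le_mul_of_nonneg_left main hs.θ_pos.le
  linarith

end Problem

/-! ### Errors of the oracle at points that do not depend on the sample -/

section Fresh

variable {Ω W S : Type*} [MeasurableSpace W] [MeasurableSpace S] {k : ℕ} {δ : ℝ}

theorem map_prodMk_of_indepFun [MeasurableSpace Ω] {Pb : Measure Ω} [IsProbabilityMeasure Pb]
    {μ : Measure W} {U : Ω → S} {w : Ω → W} (hU : Measurable U) (hw : Measurable w)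
    (hlaw : Pb.map w = μ) (hind : Indep (MeasurableSpace.comap U inferInstance)
      (MeasurableSpace.comap w inferInstance) Pb) :
    Pb.map (fun ω => (U ω, w ω)) = (Pb.map U).prod μ := by
  rw [(indepFun_iff_map_prod_eq_prod_map_map hU.aemeasurable hw.aemeasurable).1
    ((IndepFun_iff_Indep _ _ _).2 hind), hlaw]

theorem integrable_normSq_of_indepFun [MeasurableSpace Ω] {Pb : Measure Ω}
    [IsProbabilityMeasure Pb] {μ : Measure W} [IsProbabilityMeasure μ] {U : Ω → S} {w : Ω → W}
    (hU : Measurable U) (hw : Measurable w) (hlaw : Pb.map w = μ)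
    (hind : Indep (MeasurableSpace.comap U inferInstance)
      (MeasurableSpace.comap w inferInstance) Pb)
    {ψ : S → W → Vec k} (hψ : Measurable (Function.uncurry ψ))
    (hsq : ∀ s, Integrable (fun w => ‖ψ s w‖ ^ 2) μ) (hle : ∀ s, ∫ w, ‖ψ s w‖ ^ 2 ∂μ ≤ δ ^ 2) :
    Integrable (fun ω => ‖ψ (U ω) (w ω)‖ ^ 2) Pb ∧
      ∫ ω, ‖ψ (U ω) (w ω)‖ ^ 2 ∂Pb ≤ δ ^ 2 := by
  have hmap := map_prodMk_of_indepFun hU hw hlaw hind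
  have : IsProbabilityMeasure (Pb.map U) := Measure.isProbabilityMeasure_map hU.aemeasurable
  have hm : Measurable (fun p : S × W => ‖ψ p.1 p.2‖ ^ 2) := hψ.norm.pow_const 2
  have hI : Integrable (fun p : S × W => ‖ψ p.1 p.2‖ ^ 2) ((Pb.map U).prod μ) := by
    refine (integrable_prod_iff hm.aestronglyMeasurable).2 ⟨ae_of_all _ hsq, ?_⟩
    refine Integrable.of_bound (hm.aestronglyMeasurable.norm.integral_prod_right') (δ ^ 2)
      (ae_of_all _ fun s => ?_)
    have h0 : 0 ≤ ∫ w, ‖ψ s w‖ ^ 2 ∂μ := integral_nonneg fun _ => sq_nonneg _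
    simpa [abs_of_nonneg h0] using hle s
  have hpair : Measurable fun ω => (U ω, w ω) := hU.prodMk hw
  constructor
  · rw [← hmap] at hI
    exact hI.comp_measurable hpair
  · have h1 : ∫ ω, ‖ψ (U ω) (w ω)‖ ^ 2 ∂Pb
        = ∫ p, ‖ψ p.1 p.2‖ ^ 2 ∂((Pb.map U).prod μ) := by
      rw [← hmap, integral_map hpair.aemeasurable hm.aestronglyMeasurable]
    rw [h1, integral_prod _ hI]
    calc _ ≤ ∫ _, δ ^ 2 ∂(Pb.map U) :=
          integral_mono hI.integral_prod_left (integrable_const _) hle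
      _ = δ ^ 2 := by simp

theorem integrable_of_integrable_normSq {μ : Measure W} [IsFiniteMeasure μ] {f : W → Vec k}
    (hf : Measurable f) (h : Integrable (fun w => ‖f w‖ ^ 2) μ) : Integrable f μ := by
  refine (h.add (integrable_const (1 : ℝ))).mono hf.aestronglyMeasurable (ae_of_all _ fun w => ?_)
  simp only [Pi.add_apply]
  rw [Real.norm_of_nonneg (by positivity)]
  nlinarith [sq_nonneg (‖f w‖ - 1)]

/-- An error `ψ (U, w)` with mean zero for each value of `U` is orthogonal to every function of `U`
if `w` is independent of `U`. -/
theorem integral_inner_of_indepFun [MeasurableSpace Ω] {Pb : Measure Ω}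
    [IsProbabilityMeasure Pb] {μ : Measure W} [IsProbabilityMeasure μ] {U : Ω → S} {w : Ω → W}
    (hU : Measurable U) (hw : Measurable w) (hlaw : Pb.map w = μ)
    (hind : Indep (MeasurableSpace.comap U inferInstance)
      (MeasurableSpace.comap w inferInstance) Pb)
    {ψ : S → W → Vec k} (hψ : Measurable (Function.uncurry ψ))
    (hsq : ∀ s, Integrable (fun w => ‖ψ s w‖ ^ 2) μ) (hle : ∀ s, ∫ w, ‖ψ s w‖ ^ 2 ∂μ ≤ δ ^ 2)
    (hmean : ∀ s, ∫ w, ψ s w ∂μ = 0)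
    {φ : S → Vec k} (hφ : Measurable φ) {R : ℝ} (hR : ∀ s, ‖φ s‖ ≤ R) :
    Integrable (fun ω => inner ℝ (ψ (U ω) (w ω)) (φ (U ω))) Pb ∧
      ∫ ω, inner ℝ (ψ (U ω) (w ω)) (φ (U ω)) ∂Pb = 0 := by
  have hmap := map_prodMk_of_indepFun hU hw hlaw hind
  have : IsProbabilityMeasure (Pb.map U) := Measure.isProbabilityMeasure_map hU.aemeasurable
  have hpair : Measurable fun ω => (U ω, w ω) := hU.prodMk hw
  have hm : Measurable (fun p : S × W => inner ℝ (ψ p.1 p.2) (φ p.1)) :=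
    Measurable.inner hψ (hφ.comp measurable_fst)
  have hI : Integrable (fun ω => inner ℝ (ψ (U ω) (w ω)) (φ (U ω))) Pb := by
    have h1 := (integrable_normSq_of_indepFun hU hw hlaw hind hψ hsq hle).1
    refine ((h1.add (integrable_const (1 : ℝ))).const_mul R).mono
      (hm.comp hpair).aestronglyMeasurable (ae_of_all _ fun ω => ?_)
    have hR0 : 0 ≤ R := (norm_nonneg _).trans (hR (U ω))
    simp only [Pi.add_apply]
    rw [Real.norm_of_nonneg (r := R * _) (by positivity)]
    refine (abs_real_inner_le_norm _ _).trans ?_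
    calc _ ≤ ‖ψ (U ω) (w ω)‖ * R := by gcongr; exact hR _
      _ ≤ _ := by nlinarith [sq_nonneg (‖ψ (U ω) (w ω)‖ - 1)]
  refine ⟨hI, ?_⟩
  have hI' : Integrable (fun p : S × W => inner ℝ (ψ p.1 p.2) (φ p.1)) ((Pb.map U).prod μ) := by
    rw [← hmap, integrable_map_measure hm.aestronglyMeasurable hpair.aemeasurable]
    exact hI
  have h1 : ∫ ω, inner ℝ (ψ (U ω) (w ω)) (φ (U ω)) ∂Pb
      = ∫ p, inner ℝ (ψ p.1 p.2) (φ p.1) ∂((Pb.map U).prod μ) := by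
    rw [← hmap, integral_map hpair.aemeasurable hm.aestronglyMeasurable]
  rw [h1, integral_prod _ hI']
  refine integral_eq_zero_of_ae (ae_of_all _ fun s => ?_)
  have h2 := integral_inner (𝕜 := ℝ) (integrable_of_integrable_normSq
    (hψ.comp measurable_prodMk_left) (hsq s)) (φ s)
  simp only [Function.comp_def, Function.uncurry, hmean s, inner_zero_right] at h2
  simpa only [real_inner_comm (φ s), Pi.zero_apply] using h2

/-- The sample `w` has law `μ` and is independent of the events in `m`. -/
structure IsFreshSample (m : MeasurableSpace Ω) [m₀ : MeasurableSpace Ω] (Pb : Measure Ω)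
    (μ : Measure W) (w : Ω → W) : Prop where
  le : m ≤ m₀
  measurable : Measurable w
  law : Pb.map w = μ
  indep : Indep m (MeasurableSpace.comap w inferInstance) Pb

variable {m : MeasurableSpace Ω} [m₀ : MeasurableSpace Ω] {Pb : Measure Ω}
  [IsProbabilityMeasure Pb] {μ : Measure W} [IsProbabilityMeasure μ] {w : Ω → W}

theorem IsFreshSample.integrable_normSq (hw : IsFreshSample m Pb μ w) {ψ : Ω → W → Vec k}
    (hψ : Measurable[m.prod inferInstance] (Function.uncurry ψ))
    (hsq : ∀ s, Integrable (fun w => ‖ψ s w‖ ^ 2) μ) (hle : ∀ s, ∫ w, ‖ψ s w‖ ^ 2 ∂μ ≤ δ ^ 2) :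
    Integrable (fun ω => ‖ψ ω (w ω)‖ ^ 2) Pb ∧ ∫ ω, ‖ψ ω (w ω)‖ ^ 2 ∂Pb ≤ δ ^ 2 := by
  have hind : Indep (MeasurableSpace.comap id m) (MeasurableSpace.comap w inferInstance) Pb := by
    rw [MeasurableSpace.comap_id]; exact hw.indep
  -- The identity from `m₀` to `m` is the random variable that carries the events in `m`.
  exact @integrable_normSq_of_indepFun Ω W Ω _ m k δ m₀ Pb _ μ _ id w
    (measurable_id'' hw.le) hw.measurable hw.law hind ψ hψ hsq hle

theorem IsFreshSample.integral_inner (hw : IsFreshSample m Pb μ w) {ψ : Ω → W → Vec k}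
    (hψ : Measurable[m.prod inferInstance] (Function.uncurry ψ))
    (hsq : ∀ s, Integrable (fun w => ‖ψ s w‖ ^ 2) μ) (hle : ∀ s, ∫ w, ‖ψ s w‖ ^ 2 ∂μ ≤ δ ^ 2)
    (hmean : ∀ s, ∫ w, ψ s w ∂μ = 0)
    {φ : Ω → Vec k} (hφ : Measurable[m] φ) {R : ℝ} (hR : ∀ s, ‖φ s‖ ≤ R) :
    Integrable (fun ω => inner ℝ (ψ ω (w ω)) (φ ω)) Pb ∧
      ∫ ω, inner ℝ (ψ ω (w ω)) (φ ω) ∂Pb = 0 := by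
  have hind : Indep (MeasurableSpace.comap id m) (MeasurableSpace.comap w inferInstance) Pb := by
    rw [MeasurableSpace.comap_id]; exact hw.indep
  exact @integral_inner_of_indepFun Ω W Ω _ m k δ m₀ Pb _ μ _ id w
    (measurable_id'' hw.le) hw.measurable hw.law hind ψ hψ hsq hle hmean φ hφ R hR

end Fresh

section OracleErrors

variable {n m : ℕ} {pr : Problem n m} {L δ : ℝ} {W Ω : Type*} [MeasurableSpace W] {G : Oracle n m W}
  {μ : Measure W}

theorem Problem.Admissible.measurable_gradX_comp [MeasurableSpace Ω] (hpr : pr.Admissible L)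
    {X : Ω → Vec n} {Y : Ω → Vec m} (hX : Measurable X) (hY : Measurable Y)
    (hXm : ∀ ω, X ω ∈ pr.P) (hYm : ∀ ω, Y ω ∈ pr.Q) :
    Measurable fun ω => pr.gradX (X ω) (Y ω) := by
  have hc : Continuous fun s : pr.P × pr.Q => pr.gradX s.1 s.2 := by
    refine continuous_iff_continuousAt.2 fun s => tendsto_iff_norm_sub_tendsto_zero.2 ?_
    have h1 : Continuous fun s' : pr.P × pr.Q =>
        L * jointDist (s'.1 : Vec n) (s'.2 : Vec m) s.1 s.2 := by
      unfold jointDist; fun_prop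
    have h2 := h1.tendsto s
    simp only [jointDist, sub_self, norm_zero, ne_eq, OfNat.ofNat_ne_zero, not_false_eq_true,
      zero_pow, add_zero, Real.sqrt_zero, mul_zero] at h2
    refine squeeze_zero (fun _ => norm_nonneg _) (fun s' => ?_) h2
    exact (Problem.norm_le_jointDist_left _ _ _ _).trans
      (hpr.smooth _ s'.1.2 _ s'.2.2 _ s.1.2 _ s.2.2)
  exact hc.measurable.comp ((hX.subtype_mk (h := hXm)).prodMk (hY.subtype_mk (h := hYm)))

theorem Problem.Admissible.measurable_gradY_comp [MeasurableSpace Ω] (hpr : pr.Admissible L)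
    {X : Ω → Vec n} {Y : Ω → Vec m} (hX : Measurable X) (hY : Measurable Y)
    (hXm : ∀ ω, X ω ∈ pr.P) (hYm : ∀ ω, Y ω ∈ pr.Q) :
    Measurable fun ω => pr.gradY (X ω) (Y ω) := by
  have hc : Continuous fun s : pr.P × pr.Q => pr.gradY s.1 s.2 := by
    refine continuous_iff_continuousAt.2 fun s => tendsto_iff_norm_sub_tendsto_zero.2 ?_
    have h1 : Continuous fun s' : pr.P × pr.Q =>
        L * jointDist (s'.1 : Vec n) (s'.2 : Vec m) s.1 s.2 := by
      unfold jointDist; fun_prop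
    have h2 := h1.tendsto s
    simp only [jointDist, sub_self, norm_zero, ne_eq, OfNat.ofNat_ne_zero, not_false_eq_true,
      zero_pow, add_zero, Real.sqrt_zero, mul_zero] at h2
    refine squeeze_zero (fun _ => norm_nonneg _) (fun s' => ?_) h2
    exact (Problem.norm_le_jointDist_right _ _ _ _).trans
      (hpr.smooth _ s'.1.2 _ s'.2.2 _ s.1.2 _ s.2.2)
  exact hc.measurable.comp ((hX.subtype_mk (h := hXm)).prodMk (hY.subtype_mk (h := hYm)))

variable {x : Vec n} {y : Vec m}

theorem Oracle.Admissible.measurable_gx_right (hG : G.Admissible pr μ δ) (x : Vec n) (y : Vec m) :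
    Measurable (G.gx x y) :=
  hG.measurable_gx.comp (measurable_const.prodMk (measurable_const.prodMk measurable_id))

theorem Oracle.Admissible.measurable_gy_right (hG : G.Admissible pr μ δ) (x : Vec n) (y : Vec m) :
    Measurable (G.gy x y) :=
  hG.measurable_gy.comp (measurable_const.prodMk (measurable_const.prodMk measurable_id))

theorem Oracle.Admissible.measurable_error_x [MeasurableSpace Ω] (hG : G.Admissible pr μ δ)
    (hpr : pr.Admissible L) {X : Ω → Vec n} {Y : Ω → Vec m} (hX : Measurable X) (hY : Measurable Y)
    (hXm : ∀ ω, X ω ∈ pr.P) (hYm : ∀ ω, Y ω ∈ pr.Q) :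
    Measurable (Function.uncurry fun ω w => G.gx (X ω) (Y ω) w - pr.gradX (X ω) (Y ω)) :=
  (hG.measurable_gx.comp ((hX.comp measurable_fst).prodMk
    ((hY.comp measurable_fst).prodMk measurable_snd))).sub
    ((hpr.measurable_gradX_comp hX hY hXm hYm).comp measurable_fst)

theorem Oracle.Admissible.measurable_error_y [MeasurableSpace Ω] (hG : G.Admissible pr μ δ)
    (hpr : pr.Admissible L) {X : Ω → Vec n} {Y : Ω → Vec m} (hX : Measurable X) (hY : Measurable Y)
    (hXm : ∀ ω, X ω ∈ pr.P) (hYm : ∀ ω, Y ω ∈ pr.Q) :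
    Measurable (Function.uncurry fun ω w => G.gy (X ω) (Y ω) w - pr.gradY (X ω) (Y ω)) :=
  (hG.measurable_gy.comp ((hX.comp measurable_fst).prodMk
    ((hY.comp measurable_fst).prodMk measurable_snd))).sub
    ((hpr.measurable_gradY_comp hX hY hXm hYm).comp measurable_fst)

theorem Oracle.Admissible.integrable_normSq_x (hG : G.Admissible pr μ δ) (hx : x ∈ pr.P)
    (hy : y ∈ pr.Q) : Integrable (fun w => ‖G.gx x y w - pr.gradX x y‖ ^ 2) μ := by
  refine (hG.integrable_sq x hx y hy).mono
    (((hG.measurable_gx_right x y).sub_const _).norm.pow_const 2).aestronglyMeasurable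
    (ae_of_all _ fun w => ?_)
  rw [Real.norm_of_nonneg (by positivity), Real.norm_of_nonneg (by positivity)]
  exact le_add_of_nonneg_right (sq_nonneg _)

theorem Oracle.Admissible.integrable_normSq_y (hG : G.Admissible pr μ δ) (hx : x ∈ pr.P)
    (hy : y ∈ pr.Q) : Integrable (fun w => ‖G.gy x y w - pr.gradY x y‖ ^ 2) μ := by
  refine (hG.integrable_sq x hx y hy).mono
    (((hG.measurable_gy_right x y).sub_const _).norm.pow_const 2).aestronglyMeasurable
    (ae_of_all _ fun w => ?_)
  rw [Real.norm_of_nonneg (by positivity), Real.norm_of_nonneg (by positivity)]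
  exact le_add_of_nonneg_left (sq_nonneg _)

theorem Oracle.Admissible.integral_normSq_x_le (hG : G.Admissible pr μ δ) (hx : x ∈ pr.P)
    (hy : y ∈ pr.Q) : ∫ w, ‖G.gx x y w - pr.gradX x y‖ ^ 2 ∂μ ≤ δ ^ 2 :=
  (integral_mono (hG.integrable_normSq_x hx hy) (hG.integrable_sq x hx y hy)
    fun _ => le_add_of_nonneg_right (sq_nonneg _)).trans (hG.variance_le x hx y hy)

theorem Oracle.Admissible.integral_normSq_y_le (hG : G.Admissible pr μ δ) (hx : x ∈ pr.P)
    (hy : y ∈ pr.Q) : ∫ w, ‖G.gy x y w - pr.gradY x y‖ ^ 2 ∂μ ≤ δ ^ 2 :=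
  (integral_mono (hG.integrable_normSq_y hx hy) (hG.integrable_sq x hx y hy)
    fun _ => le_add_of_nonneg_left (sq_nonneg _)).trans (hG.variance_le x hx y hy)

variable [IsProbabilityMeasure μ]

theorem Oracle.Admissible.integral_error_x (hG : G.Admissible pr μ δ) (hx : x ∈ pr.P)
    (hy : y ∈ pr.Q) : ∫ w, (G.gx x y w - pr.gradX x y) ∂μ = 0 := by
  have h1 := integrable_of_integrable_normSq ((hG.measurable_gx_right x y).sub_const _)
    (hG.integrable_normSq_x hx hy)
  have h2 : Integrable (fun w => G.gx x y w) μ := by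
    exact (h1.add (integrable_const (pr.gradX x y))).congr
      (ae_of_all _ fun w => sub_add_cancel (G.gx x y w) _)
  rw [integral_sub h2 (integrable_const _), hG.unbiased_x x hx y hy]
  simp

theorem Oracle.Admissible.integral_error_y (hG : G.Admissible pr μ δ) (hx : x ∈ pr.P)
    (hy : y ∈ pr.Q) : ∫ w, (G.gy x y w - pr.gradY x y) ∂μ = 0 := by
  have h1 := integrable_of_integrable_normSq ((hG.measurable_gy_right x y).sub_const _)
    (hG.integrable_normSq_y hx hy)
  have h2 : Integrable (fun w => G.gy x y w) μ := by
    exact (h1.add (integrable_const (pr.gradY x y))).congr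
      (ae_of_all _ fun w => sub_add_cancel (G.gy x y w) _)
  rw [integral_sub h2 (integrable_const _), hG.unbiased_y x hx y hy]
  simp

variable {𝓜 : MeasurableSpace Ω} [m₀ : MeasurableSpace Ω] {Pb : Measure Ω}
  [IsProbabilityMeasure Pb] {w : Ω → W} {X : Ω → Vec n} {Y : Ω → Vec m}

/-- At a point that does not depend on the sample the error of the `x`-gradient has variance at
most `δ²` and is orthogonal to everything that does not depend on the sample. -/
theorem IsFreshSample.error_x (hw : IsFreshSample 𝓜 Pb μ w) (hpr : pr.Admissible L)
    (hG : G.Admissible pr μ δ) (hX : Measurable[𝓜] X) (hY : Measurable[𝓜] Y)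
    (hXm : ∀ ω, X ω ∈ pr.P) (hYm : ∀ ω, Y ω ∈ pr.Q) {φ : Ω → Vec n} (hφ : Measurable[𝓜] φ)
    {R : ℝ} (hR : ∀ ω, ‖φ ω‖ ≤ R) :
    (Integrable (fun ω => ‖G.gx (X ω) (Y ω) (w ω) - pr.gradX (X ω) (Y ω)‖ ^ 2) Pb ∧
      ∫ ω, ‖G.gx (X ω) (Y ω) (w ω) - pr.gradX (X ω) (Y ω)‖ ^ 2 ∂Pb ≤ δ ^ 2) ∧
    Integrable (fun ω => inner ℝ (G.gx (X ω) (Y ω) (w ω) - pr.gradX (X ω) (Y ω)) (φ ω)) Pb ∧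
      ∫ ω, inner ℝ (G.gx (X ω) (Y ω) (w ω) - pr.gradX (X ω) (Y ω)) (φ ω) ∂Pb = 0 := by
  have hψ := @Oracle.Admissible.measurable_error_x n m pr L δ W Ω _ G μ 𝓜 hG hpr X Y hX hY hXm hYm
  have h1 := hw.integrable_normSq hψ (fun s => hG.integrable_normSq_x (hXm s) (hYm s))
    (fun s => hG.integral_normSq_x_le (hXm s) (hYm s))
  have h2 := hw.integral_inner hψ (fun s => hG.integrable_normSq_x (hXm s) (hYm s))
    (fun s => hG.integral_normSq_x_le (hXm s) (hYm s))
    (fun s => hG.integral_error_x (hXm s) (hYm s)) hφ hR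
  exact ⟨h1, h2⟩

/-- The counterpart of `IsFreshSample.error_x` for the `y`-gradient. -/
theorem IsFreshSample.error_y (hw : IsFreshSample 𝓜 Pb μ w) (hpr : pr.Admissible L)
    (hG : G.Admissible pr μ δ) (hX : Measurable[𝓜] X) (hY : Measurable[𝓜] Y)
    (hXm : ∀ ω, X ω ∈ pr.P) (hYm : ∀ ω, Y ω ∈ pr.Q) {φ : Ω → Vec m} (hφ : Measurable[𝓜] φ)
    {R : ℝ} (hR : ∀ ω, ‖φ ω‖ ≤ R) :
    (Integrable (fun ω => ‖G.gy (X ω) (Y ω) (w ω) - pr.gradY (X ω) (Y ω)‖ ^ 2) Pb ∧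
      ∫ ω, ‖G.gy (X ω) (Y ω) (w ω) - pr.gradY (X ω) (Y ω)‖ ^ 2 ∂Pb ≤ δ ^ 2) ∧
    Integrable (fun ω => inner ℝ (G.gy (X ω) (Y ω) (w ω) - pr.gradY (X ω) (Y ω)) (φ ω)) Pb ∧
      ∫ ω, inner ℝ (G.gy (X ω) (Y ω) (w ω) - pr.gradY (X ω) (Y ω)) (φ ω) ∂Pb = 0 := by
  have hψ := @Oracle.Admissible.measurable_error_y n m pr L δ W Ω _ G μ 𝓜 hG hpr X Y hX hY hXm hYm
  have h1 := hw.integrable_normSq hψ (fun s => hG.integrable_normSq_y (hXm s) (hYm s))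
    (fun s => hG.integral_normSq_y_le (hXm s) (hYm s))
  have h2 := hw.integral_inner hψ (fun s => hG.integrable_normSq_y (hXm s) (hYm s))
    (fun s => hG.integral_normSq_y_le (hXm s) (hYm s))
    (fun s => hG.integral_error_y (hXm s) (hYm s)) hφ hR
  exact ⟨h1, h2⟩

end OracleErrors

/-! ### The iterates of SAPD -/

section Path

variable {n m : ℕ} {W : Type*}

/-- The state after `t` iterations of SAPD, started at `s`, on the subproblem with centres `z`. -/
def sapdPath (pr : Problem n m) (G : Oracle n m W) (L ε τ σ θ : ℝ) (z s : Vec n × Vec m)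
    (wx wy : ℕ → W) (t : ℕ) : SAPDState n m :=
  sapdRun pr (subproblemOracle pr G L ε z.1 z.2) τ σ θ wx wy ⟨s.1, s.2, none, 0, 0⟩ t

variable (pr : Problem n m) (G : Oracle n m W) (L ε τ σ θ : ℝ) (z s : Vec n × Vec m)
  (wx wy : ℕ → W) (t : ℕ)

theorem sapdPath_calls : (sapdPath pr G L ε τ σ θ z s wx wy t).xCalls = t ∧
    (sapdPath pr G L ε τ σ θ z s wx wy t).yCalls = t := by
  induction t with
  | zero => exact ⟨rfl, rfl⟩
  | succ t ih =>
    simp only [sapdPath] at ih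
    simp [sapdPath, sapdRun, sapdStep, ih]

/-- The error of the `y`-gradient in iteration `t`. -/
def errY : Vec m :=
  G.gy (sapdPath pr G L ε τ σ θ z s wx wy t).x (sapdPath pr G L ε τ σ θ z s wx wy t).y (wy t)
    - pr.gradY (sapdPath pr G L ε τ σ θ z s wx wy t).x (sapdPath pr G L ε τ σ θ z s wx wy t).y

/-- The error of the `x`-gradient in iteration `t`, in which `y` is updated first. -/
def errX : Vec n :=
  G.gx (sapdPath pr G L ε τ σ θ z s wx wy t).x
      (sapdPath pr G L ε τ σ θ z s wx wy (t + 1)).y (wx t)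
    - pr.gradX (sapdPath pr G L ε τ σ θ z s wx wy t).x
      (sapdPath pr G L ε τ σ θ z s wx wy (t + 1)).y

/-- The exact `y`-gradient of the subproblem in iteration `t`. -/
def exactY : Vec m :=
  pr.subGradY (ε / (2 * pr.Dq)) z (sapdPath pr G L ε τ σ θ z s wx wy t).x
    (sapdPath pr G L ε τ σ θ z s wx wy t).y

/-- The contribution of the current sample to the error of the extrapolated gradient has this
coefficient: there is no extrapolation in the first iteration. -/
def errCoeff (θ : ℝ) : ℕ → ℝ
  | 0 => 1
  | _ + 1 => 1 + θ

/-- The contribution of the previous sample to the error of the extrapolated gradient. -/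
def errPrev : ℕ → Vec m
  | 0 => 0
  | t + 1 => θ • errY pr G L ε τ σ θ z s wx wy t

/-- The update of `y` with the extrapolated exact gradient, perturbed by `w`. The natural
subtraction makes the extrapolation vanish in the first iteration. -/
def stepY (w : Vec m) : Vec m :=
  prox pr.Q pr.q σ ((sapdPath pr G L ε τ σ θ z s wx wy t).y + σ • (exactY pr G L ε τ σ θ z s wx wy t
    + θ • (exactY pr G L ε τ σ θ z s wx wy t - exactY pr G L ε τ σ θ z s wx wy (t - 1)) + w))

/-- The update of `x` with the exact gradient, perturbed by `w`. -/
def stepX (w : Vec n) : Vec n :=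
  prox pr.P pr.p τ ((sapdPath pr G L ε τ σ θ z s wx wy t).x
    - τ • (pr.subGradX L z (sapdPath pr G L ε τ σ θ z s wx wy t).x
      (sapdPath pr G L ε τ σ θ z s wx wy (t + 1)).y + w))

theorem sapdPath_succ_y : (sapdPath pr G L ε τ σ θ z s wx wy (t + 1)).y
    = stepY pr G L ε τ σ θ z s wx wy t (errCoeff θ t • errY pr G L ε τ σ θ z s wx wy t
      - errPrev pr G L ε τ σ θ z s wx wy t) := by
  have e : ∀ t, exactY pr G L ε τ σ θ z s wx wy t + errY pr G L ε τ σ θ z s wx wy t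
      = (subproblemOracle pr G L ε z.1 z.2).gy (sapdPath pr G L ε τ σ θ z s wx wy t).x
        (sapdPath pr G L ε τ σ θ z s wx wy t).y (wy t) := fun t => by
    simp only [exactY, errY, Problem.subGradY, subproblemOracle]; abel
  cases t with
  | zero =>
    have h : (sapdPath pr G L ε τ σ θ z s wx wy (0 + 1)).y = prox pr.Q pr.q σ
        ((sapdPath pr G L ε τ σ θ z s wx wy 0).y + σ • ((subproblemOracle pr G L ε z.1 z.2).gy
          (sapdPath pr G L ε τ σ θ z s wx wy 0).x (sapdPath pr G L ε τ σ θ z s wx wy 0).y (wy 0)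
          + θ • 0)) := rfl
    rw [h, ← e]
    simp [stepY, errCoeff, errPrev]
  | succ t =>
    have h : (sapdPath pr G L ε τ σ θ z s wx wy (t + 1 + 1)).y = prox pr.Q pr.q σ
        ((sapdPath pr G L ε τ σ θ z s wx wy (t + 1)).y + σ • ((subproblemOracle pr G L ε z.1 z.2).gy
          (sapdPath pr G L ε τ σ θ z s wx wy (t + 1)).x
          (sapdPath pr G L ε τ σ θ z s wx wy (t + 1)).y (wy (t + 1))
          + θ • ((subproblemOracle pr G L ε z.1 z.2).gy
            (sapdPath pr G L ε τ σ θ z s wx wy (t + 1)).x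
            (sapdPath pr G L ε τ σ θ z s wx wy (t + 1)).y (wy (t + 1))
            - (subproblemOracle pr G L ε z.1 z.2).gy (sapdPath pr G L ε τ σ θ z s wx wy t).x
            (sapdPath pr G L ε τ σ θ z s wx wy t).y (wy t)))) := rfl
    rw [h, ← e, ← e]
    simp only [stepY, errCoeff, errPrev, Nat.add_sub_cancel]
    congr 3
    module

theorem sapdPath_succ_x : (sapdPath pr G L ε τ σ θ z s wx wy (t + 1)).x
    = stepX pr G L ε τ σ θ z s wx wy t (errX pr G L ε τ σ θ z s wx wy t) := by
  have e : pr.subGradX L z (sapdPath pr G L ε τ σ θ z s wx wy t).x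
      (sapdPath pr G L ε τ σ θ z s wx wy (t + 1)).y + errX pr G L ε τ σ θ z s wx wy t
      = (subproblemOracle pr G L ε z.1 z.2).gx (sapdPath pr G L ε τ σ θ z s wx wy t).x
        (sapdPath pr G L ε τ σ θ z s wx wy (t + 1)).y (wx t) := by
    simp only [errX, Problem.subGradX, subproblemOracle]; abel
  rw [stepX, e]
  rfl

end Path

section PathBounds

variable {n m : ℕ} {W : Type*} {pr : Problem n m} {G : Oracle n m W} {L ε M τ σ θ β : ℝ}
  {z s : Vec n × Vec m} {wx wy : ℕ → W}

theorem sapdPath_mem (hpr : pr.Admissible L) (hτ : 0 < τ) (hσ : 0 < σ) (hs : s.1 ∈ pr.P)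
    (hs' : s.2 ∈ pr.Q) (t : ℕ) : (sapdPath pr G L ε τ σ θ z s wx wy t).x ∈ pr.P ∧
      (sapdPath pr G L ε τ σ θ z s wx wy t).y ∈ pr.Q := by
  cases t with
  | zero => exact ⟨hs, hs'⟩
  | succ t =>
    rw [sapdPath_succ_x, sapdPath_succ_y]
    exact ⟨hpr.p_closed.prox_mem hτ _, hpr.q_closed.prox_mem hσ _⟩

/-- The Lyapunov function along the iterates. -/
def pathLyapunov (pr : Problem n m) (G : Oracle n m W) (L ε M τ σ θ β : ℝ) (z s : Vec n × Vec m)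
    (wx wy : ℕ → W) (t : ℕ) : ℝ :=
  pr.lyapunov L (ε / (2 * pr.Dq)) M τ σ θ β z (sapdPath pr G L ε τ σ θ z s wx wy t).x
    (sapdPath pr G L ε τ σ θ z s wx wy (t - 1)).x (sapdPath pr G L ε τ σ θ z s wx wy t).y
    (sapdPath pr G L ε τ σ θ z s wx wy (t - 1)).y

/-- The inner product of the error of the `x`-gradient with a vector that does not depend on the
current sample: the update is replaced by the one with the exact gradient. -/
def crossX (pr : Problem n m) (G : Oracle n m W) (L ε τ σ θ : ℝ) (z s : Vec n × Vec m)
    (wx wy : ℕ → W) (t : ℕ) : ℝ :=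
  inner ℝ (errX pr G L ε τ σ θ z s wx wy t)
    (stepX pr G L ε τ σ θ z s wx wy t 0 - (pr.saddle L (ε / (2 * pr.Dq)) z).1)

/-- The counterpart of `crossX` for the `y`-gradient. -/
def crossY (pr : Problem n m) (G : Oracle n m W) (L ε τ σ θ : ℝ) (z s : Vec n × Vec m)
    (wx wy : ℕ → W) (t : ℕ) : ℝ :=
  inner ℝ (errY pr G L ε τ σ θ z s wx wy t)
    (stepY pr G L ε τ σ θ z s wx wy t (-errPrev pr G L ε τ σ θ z s wx wy t)
      - (pr.saddle L (ε / (2 * pr.Dq)) z).2)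

/-- The effect of the oracle errors on the Lyapunov function in iteration `t`. -/
def pathNoise (pr : Problem n m) (G : Oracle n m W) (L ε τ σ θ : ℝ) (z s : Vec n × Vec m)
    (wx wy : ℕ → W) : ℕ → ℝ
  | 0 => τ * ‖errX pr G L ε τ σ θ z s wx wy 0‖ ^ 2 - crossX pr G L ε τ σ θ z s wx wy 0
      + 4 * σ * ‖errY pr G L ε τ σ θ z s wx wy 0‖ ^ 2 + crossY pr G L ε τ σ θ z s wx wy 0
  | t + 1 => τ * ‖errX pr G L ε τ σ θ z s wx wy (t + 1)‖ ^ 2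
      - crossX pr G L ε τ σ θ z s wx wy (t + 1)
      + 4 * σ * ‖errY pr G L ε τ σ θ z s wx wy (t + 1)‖ ^ 2
      + (1 + θ) * crossY pr G L ε τ σ θ z s wx wy (t + 1)
      + 4 * σ * ‖errY pr G L ε τ σ θ z s wx wy t‖ ^ 2 - θ * crossY pr G L ε τ σ θ z s wx wy t

theorem norm_stepX_sub_le (hpr : pr.Admissible L) (hτ : 0 < τ) (t : ℕ) (w w' : Vec n) :
    ‖stepX pr G L ε τ σ θ z s wx wy t w - stepX pr G L ε τ σ θ z s wx wy t w'‖ ≤ τ * ‖w - w'‖ := by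
  refine (hpr.p_closed.norm_prox_sub_prox_le hτ _ _).trans (le_of_eq ?_)
  rw [← Real.norm_of_nonneg hτ.le, ← norm_smul, Real.norm_of_nonneg hτ.le, ← norm_neg]
  congr 1
  module

theorem norm_stepY_sub_le (hpr : pr.Admissible L) (hσ : 0 < σ) (t : ℕ) (w w' : Vec m) :
    ‖stepY pr G L ε τ σ θ z s wx wy t w - stepY pr G L ε τ σ θ z s wx wy t w'‖ ≤ σ * ‖w - w'‖ := by
  refine (hpr.q_closed.norm_prox_sub_prox_le hσ _ _).trans (le_of_eq ?_)
  rw [← Real.norm_of_nonneg hσ.le, ← norm_smul, Real.norm_of_nonneg hσ.le]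
  congr 1
  module

/-- The new `x` correlates with the error by at most `τ` times the squared error. -/
theorem neg_inner_errX_le (hpr : pr.Admissible L) (hτ : 0 < τ) (t : ℕ) :
    -inner ℝ (errX pr G L ε τ σ θ z s wx wy t) ((sapdPath pr G L ε τ σ θ z s wx wy (t + 1)).x
        - (pr.saddle L (ε / (2 * pr.Dq)) z).1)
      ≤ τ * ‖errX pr G L ε τ σ θ z s wx wy t‖ ^ 2 - crossX pr G L ε τ σ θ z s wx wy t := by
  have h1 := norm_stepX_sub_le (G := G) (ε := ε) (σ := σ) (θ := θ) (z := z) (s := s) (wx := wx)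
    (wy := wy) hpr hτ t (errX pr G L ε τ σ θ z s wx wy t) 0
  rw [← sapdPath_succ_x, sub_zero] at h1
  set ξ := errX pr G L ε τ σ θ z s wx wy t
  set x' := (sapdPath pr G L ε τ σ θ z s wx wy (t + 1)).x
  have h2 := neg_le_of_abs_le (abs_real_inner_le_norm ξ (x' - stepX pr G L ε τ σ θ z s wx wy t 0))
  have h3 := mul_le_mul_of_nonneg_left h1 (norm_nonneg ξ)
  have e : inner ℝ ξ (x' - (pr.saddle L (ε / (2 * pr.Dq)) z).1)
      = inner ℝ ξ (x' - stepX pr G L ε τ σ θ z s wx wy t 0)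
        + crossX pr G L ε τ σ θ z s wx wy t := by
    simp only [crossX]
    rw [← inner_add_right]; congr 1; abel
  rw [e]
  nlinarith

theorem errCoeff_mem (hθ : 0 < θ) (hθ' : θ ≤ 1) (t : ℕ) : 0 ≤ errCoeff θ t ∧ errCoeff θ t ≤ 2 := by
  cases t <;> simp only [errCoeff] <;> constructor <;> linarith

/-- The new `y` correlates with the error by at most a multiple of `σ` times the squared error. -/
theorem abs_inner_errY_sub_le (hpr : pr.Admissible L) (hσ : 0 < σ) (hθ : 0 < θ) (hθ' : θ ≤ 1)
    (t : ℕ) :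
    |inner ℝ (errY pr G L ε τ σ θ z s wx wy t) ((sapdPath pr G L ε τ σ θ z s wx wy (t + 1)).y
        - (pr.saddle L (ε / (2 * pr.Dq)) z).2) - crossY pr G L ε τ σ θ z s wx wy t|
      ≤ σ * errCoeff θ t * ‖errY pr G L ε τ σ θ z s wx wy t‖ ^ 2 := by
  have h1 := norm_stepY_sub_le (G := G) (ε := ε) (τ := τ) (θ := θ) (z := z) (s := s) (wx := wx)
    (wy := wy) hpr hσ t (errCoeff θ t • errY pr G L ε τ σ θ z s wx wy t
      - errPrev pr G L ε τ σ θ z s wx wy t) (-errPrev pr G L ε τ σ θ z s wx wy t)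
  rw [← sapdPath_succ_y, sub_neg_eq_add, sub_add_cancel, norm_smul,
    Real.norm_of_nonneg (errCoeff_mem hθ hθ' t).1] at h1
  set ν := errY pr G L ε τ σ θ z s wx wy t
  simp only [crossY]
  rw [← inner_sub_right, sub_sub_sub_cancel_right]
  refine (abs_real_inner_le_norm _ _).trans ?_
  have h3 := mul_le_mul_of_nonneg_left h1 (norm_nonneg ν)
  nlinarith

/-- The errors enter the Lyapunov function through inner products with the new iterates. The error
of the previous `y`-gradient, which the extrapolation brings in, is paired with the previous `y`,
which its sample has produced, at the price of the squared step in `y`. -/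
theorem inner_errors_le_pathNoise (hpr : pr.Admissible L) (hτ : 0 < τ) (hσ : 0 < σ)
    (hθ : 0 < θ) (hθ' : θ ≤ 1) (t : ℕ) :
    -inner ℝ (errX pr G L ε τ σ θ z s wx wy t) ((sapdPath pr G L ε τ σ θ z s wx wy (t + 1)).x
        - (pr.saddle L (ε / (2 * pr.Dq)) z).1) +
    inner ℝ (errCoeff θ t • errY pr G L ε τ σ θ z s wx wy t - errPrev pr G L ε τ σ θ z s wx wy t)
      ((sapdPath pr G L ε τ σ θ z s wx wy (t + 1)).y - (pr.saddle L (ε / (2 * pr.Dq)) z).2)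
      - 1 / 8 * σ⁻¹ * ‖(sapdPath pr G L ε τ σ θ z s wx wy (t + 1)).y
        - (sapdPath pr G L ε τ σ θ z s wx wy t).y‖ ^ 2
      ≤ pathNoise pr G L ε τ σ θ z s wx wy t := by
  have hX := neg_inner_errX_le (G := G) (ε := ε) (σ := σ) (θ := θ) (z := z) (s := s) (wx := wx)
    (wy := wy) hpr hτ t
  have hY : ∀ t, _ := fun t => abs_le.1 (abs_inner_errY_sub_le (G := G) (ε := ε) (τ := τ) (z := z)
    (s := s) (wx := wx) (wy := wy) hpr hσ hθ hθ' t)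
  cases t with
  | zero =>
    have h1 := (hY 0).2
    simp only [errCoeff, errPrev, pathNoise, one_smul, sub_zero, mul_one] at h1 hX ⊢
    have h2 : 0 ≤ σ * ‖errY pr G L ε τ σ θ z s wx wy 0‖ ^ 2 := by positivity
    have h3 : 0 ≤ 1 / 8 * σ⁻¹ * ‖(sapdPath pr G L ε τ σ θ z s wx wy (0 + 1)).y
        - (sapdPath pr G L ε τ σ θ z s wx wy 0).y‖ ^ 2 := by positivity
    linarith
  | succ t =>
    have h1 := (hY (t + 1)).2
    have h2 := (hY t).1
    have hc := errCoeff_mem hθ hθ' t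
    simp only [errCoeff, errPrev, pathNoise] at h1 hX ⊢
    set ν := errY pr G L ε τ σ θ z s wx wy (t + 1)
    set ν₁ := errY pr G L ε τ σ θ z s wx wy t
    set y := (sapdPath pr G L ε τ σ θ z s wx wy (t + 1)).y
    set y' := (sapdPath pr G L ε τ σ θ z s wx wy (t + 1 + 1)).y
    set ys := (pr.saddle L (ε / (2 * pr.Dq)) z).2
    have e : inner ℝ ((1 + θ) • ν - θ • ν₁) (y' - ys) = (1 + θ) * inner ℝ ν (y' - ys)
        - θ * inner ℝ ν₁ (y' - y) - θ * inner ℝ ν₁ (y - ys) := by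
      rw [inner_sub_left, real_inner_smul_left, real_inner_smul_left,
        show y' - ys = (y' - y) + (y - ys) by abel, inner_add_right ν₁]
      ring
    have h3 := neg_le_of_abs_le (abs_real_inner_le_norm ν₁ (y' - y))
    have h4 : θ * (‖ν₁‖ * ‖y' - y‖) ≤ 2 * θ ^ 2 * (σ * ‖ν₁‖ ^ 2) + 1 / 8 * σ⁻¹ * ‖y' - y‖ ^ 2 := by
      have key : 2 * θ ^ 2 * (σ * ‖ν₁‖ ^ 2) + 1 / 8 * σ⁻¹ * ‖y' - y‖ ^ 2 - θ * (‖ν₁‖ * ‖y' - y‖)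
          = 1 / 8 * σ⁻¹ * (‖y' - y‖ - 4 * σ * θ * ‖ν₁‖) ^ 2 := by
        field_simp
        ring
      have : 0 ≤ 1 / 8 * σ⁻¹ * (‖y' - y‖ - 4 * σ * θ * ‖ν₁‖) ^ 2 := by positivity
      linarith
    have n0 : 0 ≤ σ * ‖ν‖ ^ 2 := by positivity
    have n1 : 0 ≤ σ * ‖ν₁‖ ^ 2 := by positivity
    have k1 := mul_le_mul_of_nonneg_left h1 (by linarith : 0 ≤ 1 + θ)
    have k2 := mul_le_mul_of_nonneg_left h2 hθ.le
    have k3 := mul_le_mul_of_nonneg_left h3 hθ.le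
    have k4 : (1 + θ) * (σ * (1 + θ) * ‖ν‖ ^ 2) ≤ 4 * (σ * ‖ν‖ ^ 2) := by
      nlinarith [mul_nonneg (by nlinarith : 0 ≤ 4 - (1 + θ) ^ 2) n0]
    have k5 : θ * (σ * errCoeff θ t * ‖ν₁‖ ^ 2) ≤ 2 * (σ * ‖ν₁‖ ^ 2) := by
      nlinarith [mul_nonneg (by nlinarith [hc.1, hc.2] : 0 ≤ 2 - θ * errCoeff θ t) n1]
    have k6 : 2 * θ ^ 2 * (σ * ‖ν₁‖ ^ 2) ≤ 2 * (σ * ‖ν₁‖ ^ 2) := by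
      nlinarith [mul_nonneg (by nlinarith : 0 ≤ 1 - θ ^ 2) n1]
    rw [e]
    linarith

theorem pathLyapunov_succ_le (hpr : pr.Admissible L)
    (hp : StepParams L (ε / (2 * pr.Dq)) M τ σ θ β) (hL : 0 < L) (hb : 0 < ε / (2 * pr.Dq))
    (hM : 3 * L ≤ M) (hM' : L + ε / (2 * pr.Dq) ≤ M) (hθ' : θ ≤ 1) (hs : s.1 ∈ pr.P)
    (hs' : s.2 ∈ pr.Q) (t : ℕ) :
    pathLyapunov pr G L ε M τ σ θ β z s wx wy (t + 1)
      ≤ θ * (pathLyapunov pr G L ε M τ σ θ β z s wx wy t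
        + pathNoise pr G L ε τ σ θ z s wx wy t) := by
  have hm := sapdPath_mem (G := G) (ε := ε) (θ := θ) (z := z) (wx := wx) (wy := wy) hpr hp.τ_pos
    hp.σ_pos hs hs'
  have h1 := hpr.lyapunov_step hp hL hb hM hM' z (hm t).1 (hm (t - 1)).1 (hm t).2 (hm (t - 1)).2
    (sapdPath_succ_y pr G L ε τ σ θ z s wx wy t) (sapdPath_succ_x pr G L ε τ σ θ z s wx wy t)
  refine h1.trans (mul_le_mul_of_nonneg_left ?_ hp.θ_pos.le)
  have h2 := inner_errors_le_pathNoise (G := G) (ε := ε) (τ := τ) (z := z) (s := s) (wx := wx)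
    (wy := wy) hpr hp.τ_pos hp.σ_pos hp.θ_pos hθ' t
  simp only [pathLyapunov]
  linarith

theorem pathLyapunov_le (hpr : pr.Admissible L)
    (hp : StepParams L (ε / (2 * pr.Dq)) M τ σ θ β) (hL : 0 < L) (hb : 0 < ε / (2 * pr.Dq))
    (hM : 3 * L ≤ M) (hM' : L + ε / (2 * pr.Dq) ≤ M) (hθ' : θ ≤ 1) (hs : s.1 ∈ pr.P)
    (hs' : s.2 ∈ pr.Q) (t : ℕ) :
    pathLyapunov pr G L ε M τ σ θ β z s wx wy t
      ≤ θ ^ t * pathLyapunov pr G L ε M τ σ θ β z s wx wy 0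
        + ∑ j ∈ Finset.range t, θ ^ (t - j) * pathNoise pr G L ε τ σ θ z s wx wy j := by
  induction t with
  | zero => simp
  | succ t ih =>
    refine (pathLyapunov_succ_le hpr hp hL hb hM hM' hθ' hs hs' t).trans ?_
    have h1 := mul_le_mul_of_nonneg_left ih hp.θ_pos.le
    have h2 : ∑ j ∈ Finset.range t, θ ^ (t + 1 - j) * pathNoise pr G L ε τ σ θ z s wx wy j
        = θ * ∑ j ∈ Finset.range t, θ ^ (t - j) * pathNoise pr G L ε τ σ θ z s wx wy j := by
      rw [Finset.mul_sum]
      refine Finset.sum_congr rfl fun j hj => ?_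
      rw [Nat.succ_sub (Finset.mem_range.1 hj).le, pow_succ]; ring
    rw [Finset.sum_range_succ, h2, Nat.add_sub_cancel_left, pow_one, pow_succ]
    linarith

end PathBounds

/-! ### SAPD in expectation -/

section Measurability

variable {n m : ℕ} {W Ω : Type*} [MeasurableSpace W] [MeasurableSpace Ω] {pr : Problem n m}
  {G : Oracle n m W} {μ : Measure W} {L δ ε τ σ θ : ℝ} {z s : Ω → Vec n × Vec m}
  {ux uy : ℕ → Ω → W} {t : ℕ}

/-- The first half concerns what is determined by the samples of the iterations before `t`, the
second what is determined by these and the `y`-sample of iteration `t`. -/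
theorem measurable_sapdPath (hpr : pr.Admissible L) (hG : G.Admissible pr μ δ) (hτ : 0 < τ)
    (hσ : 0 < σ) (hz : Measurable z) (hs : Measurable s)
    (hmem : ∀ ω, (s ω).1 ∈ pr.P ∧ (s ω).2 ∈ pr.Q) :
    ((∀ j < t, Measurable (ux j)) → (∀ j < t, Measurable (uy j)) →
      Measurable (fun ω => (sapdPath pr G L ε τ σ θ (z ω) (s ω) (ux · ω) (uy · ω) t).x) ∧
      Measurable (fun ω => (sapdPath pr G L ε τ σ θ (z ω) (s ω) (ux · ω) (uy · ω) t).y) ∧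
      Measurable (fun ω => exactY pr G L ε τ σ θ (z ω) (s ω) (ux · ω) (uy · ω) t) ∧
      Measurable (fun ω => errPrev pr G L ε τ σ θ (z ω) (s ω) (ux · ω) (uy · ω) t) ∧
      (∀ w : Ω → Vec m, Measurable w →
        Measurable (fun ω => stepY pr G L ε τ σ θ (z ω) (s ω) (ux · ω) (uy · ω) t (w ω)))) ∧
    ((∀ j < t, Measurable (ux j)) → (∀ j ≤ t, Measurable (uy j)) →
      Measurable (fun ω => errY pr G L ε τ σ θ (z ω) (s ω) (ux · ω) (uy · ω) t) ∧
      Measurable (fun ω => (sapdPath pr G L ε τ σ θ (z ω) (s ω) (ux · ω) (uy · ω) (t + 1)).y) ∧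
      (∀ w : Ω → Vec n, Measurable w →
        Measurable (fun ω => stepX pr G L ε τ σ θ (z ω) (s ω) (ux · ω) (uy · ω) t (w ω)))) := by
  have hm := fun ω => sapdPath_mem (G := G) (ε := ε) (θ := θ) (z := z ω) (wx := (ux · ω))
    (wy := (uy · ω)) hpr hτ hσ (hmem ω).1 (hmem ω).2
  induction t using Nat.strong_induction_on with
  | _ t ih =>
    have hA : (∀ j < t, Measurable (ux j)) → (∀ j < t, Measurable (uy j)) →
        Measurable (fun ω => (sapdPath pr G L ε τ σ θ (z ω) (s ω) (ux · ω) (uy · ω) t).x) ∧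
        Measurable (fun ω => (sapdPath pr G L ε τ σ θ (z ω) (s ω) (ux · ω) (uy · ω) t).y) ∧
        Measurable (fun ω => errPrev pr G L ε τ σ θ (z ω) (s ω) (ux · ω) (uy · ω) t) := by
      intro hx hy
      cases t with
      | zero => exact ⟨hs.fst, hs.snd, measurable_const⟩
      | succ k =>
        have hx' : ∀ j < k, Measurable (ux j) := fun j hj => hx j (by omega)
        obtain ⟨hXk, -⟩ := (ih k k.lt_succ_self).1 hx' fun j hj => hy j (by omega)
        obtain ⟨he, hYk, hst⟩ := (ih k k.lt_succ_self).2 hx' fun j hj => hy j (by omega)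
        refine ⟨?_, hYk, he.const_smul θ⟩
        simp only [sapdPath_succ_x]
        refine hst _ (Measurable.sub ?_ (hpr.measurable_gradX_comp hXk hYk
          (fun ω => (hm ω k).1) (fun ω => (hm ω (k + 1)).2)))
        exact hG.measurable_gx.comp (hXk.prodMk (hYk.prodMk (hx k k.lt_succ_self)))
    have hE : (∀ j < t, Measurable (ux j)) → (∀ j < t, Measurable (uy j)) →
        Measurable (fun ω => exactY pr G L ε τ σ θ (z ω) (s ω) (ux · ω) (uy · ω) t) := by
      intro hx hy
      obtain ⟨hX, hY, -⟩ := hA hx hy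
      exact (hpr.measurable_gradY_comp hX hY (fun ω => (hm ω t).1) (fun ω => (hm ω t).2)).sub
        ((hY.sub hz.snd).const_smul (ε / (2 * pr.Dq)))
    have hS : (∀ j < t, Measurable (ux j)) → (∀ j < t, Measurable (uy j)) →
        ∀ w : Ω → Vec m, Measurable w →
        Measurable (fun ω => stepY pr G L ε τ σ θ (z ω) (s ω) (ux · ω) (uy · ω) t (w ω)) := by
      intro hx hy w hw
      have hprev : Measurable
          (fun ω => exactY pr G L ε τ σ θ (z ω) (s ω) (ux · ω) (uy · ω) (t - 1)) := by
        cases t with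
        | zero => exact hE hx hy
        | succ k => exact ((ih k k.lt_succ_self).1 (fun j hj => hx j (by omega))
            fun j hj => hy j (by omega)).2.2.1
      have hEt := hE hx hy
      exact (hpr.q_closed.continuous_prox hσ).measurable.comp ((hA hx hy).2.1.add
        (((hEt.add ((hEt.sub hprev).const_smul θ)).add hw).const_smul σ))
    refine ⟨fun hx hy => ⟨(hA hx hy).1, (hA hx hy).2.1, hE hx hy, (hA hx hy).2.2, hS hx hy⟩,
      fun hx hy => ?_⟩
    have hy' : ∀ j < t, Measurable (uy j) := fun j hj => hy j hj.le
    obtain ⟨hX, hY, hp⟩ := hA hx hy'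
    have herr : Measurable (fun ω => errY pr G L ε τ σ θ (z ω) (s ω) (ux · ω) (uy · ω) t) :=
      Measurable.sub (hG.measurable_gy.comp (hX.prodMk (hY.prodMk (hy t le_rfl))))
        (hpr.measurable_gradY_comp hX hY (fun ω => (hm ω t).1) (fun ω => (hm ω t).2))
    have hY1 : Measurable
        (fun ω => (sapdPath pr G L ε τ σ θ (z ω) (s ω) (ux · ω) (uy · ω) (t + 1)).y) := by
      have hw : Measurable fun ω =>
          errCoeff θ t • errY pr G L ε τ σ θ (z ω) (s ω) (ux · ω) (uy · ω) t
            - errPrev pr G L ε τ σ θ (z ω) (s ω) (ux · ω) (uy · ω) t :=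
        (herr.const_smul (errCoeff θ t)).sub hp
      have h1 := hS hx hy' _ hw
      simp only [← sapdPath_succ_y] at h1
      exact h1
    clear ih hA hE hS hp
    refine ⟨herr, hY1, fun w hw => ?_⟩
    have hg := hpr.measurable_gradX_comp hX hY1 (fun ω => (hm ω t).1) (fun ω => (hm ω (t + 1)).2)
    have hd : Measurable fun ω => (2 * L) •
        ((sapdPath pr G L ε τ σ θ (z ω) (s ω) (ux · ω) (uy · ω) t).x - (z ω).1) :=
      (hX.sub hz.fst).const_smul (2 * L)
    exact (hpr.p_closed.continuous_prox hτ).measurable.comp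
      (hX.sub (((hg.add hd).add hw).const_smul τ))

end Measurability

section Expectation

variable {n m : ℕ} {W Ω : Type*} [MeasurableSpace W] [MeasurableSpace Ω] {pr : Problem n m}
  {G : Oracle n m W} {μ : Measure W} [IsProbabilityMeasure μ] {Pb : Measure Ω}
  [IsProbabilityMeasure Pb] {L δ ε τ σ θ : ℝ} {z s : Ω → Vec n × Vec m}
  {ux uy : ℕ → Ω → W} {𝓜x 𝓜y : ℕ → MeasurableSpace Ω}

/-- The samples of SAPD are fresh: each is independent of a σ-algebra, `𝓜x t` for the `x`-sample and
`𝓜y t` for the `y`-sample, with respect to which the centres, the starting point and the samples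
used before are measurable. -/
structure IsFreshSequence (Pb : Measure Ω) (μ : Measure W) (𝓜x 𝓜y : ℕ → MeasurableSpace Ω)
    (z s : Ω → Vec n × Vec m) (ux uy : ℕ → Ω → W) : Prop where
  fresh_y : ∀ t, IsFreshSample (𝓜y t) Pb μ (uy t)
  center_y : ∀ t, Measurable[𝓜y t] z
  start_y : ∀ t, Measurable[𝓜y t] s
  x_lt_y : ∀ t, ∀ j < t, Measurable[𝓜y t] (ux j)
  y_lt_y : ∀ t, ∀ j < t, Measurable[𝓜y t] (uy j)
  fresh_x : ∀ t, IsFreshSample (𝓜x t) Pb μ (ux t)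
  center_x : ∀ t, Measurable[𝓜x t] z
  start_x : ∀ t, Measurable[𝓜x t] s
  x_lt_x : ∀ t, ∀ j < t, Measurable[𝓜x t] (ux j)
  y_le_x : ∀ t, ∀ j ≤ t, Measurable[𝓜x t] (uy j)

theorem errY_crossY_expectation (hF : IsFreshSequence Pb μ 𝓜x 𝓜y z s ux uy) (hpr : pr.Admissible L)
    (hG : G.Admissible pr μ δ) (hL : 0 < L) (hb : 0 < ε / (2 * pr.Dq)) (hτ : 0 < τ) (hσ : 0 < σ)
    (hmem : ∀ ω, (s ω).1 ∈ pr.P ∧ (s ω).2 ∈ pr.Q) (t : ℕ) :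
    (Integrable (fun ω => ‖errY pr G L ε τ σ θ (z ω) (s ω) (ux · ω) (uy · ω) t‖ ^ 2) Pb ∧
      ∫ ω, ‖errY pr G L ε τ σ θ (z ω) (s ω) (ux · ω) (uy · ω) t‖ ^ 2 ∂Pb ≤ δ ^ 2) ∧
    Integrable (fun ω => crossY pr G L ε τ σ θ (z ω) (s ω) (ux · ω) (uy · ω) t) Pb ∧
      ∫ ω, crossY pr G L ε τ σ θ (z ω) (s ω) (ux · ω) (uy · ω) t ∂Pb = 0 := by
  have hz := hF.center_y t
  obtain ⟨hX, hY, -, hprev, hstep⟩ := (@measurable_sapdPath n m W Ω _ (𝓜y t) pr G μ L δ ε τ σ θ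
    z s ux uy t hpr hG hτ hσ hz (hF.start_y t) hmem).1 (hF.x_lt_y t) (hF.y_lt_y t)
  have hsad := (hpr.continuous_saddle hL hb).measurable.snd.comp hz
  have hm := fun ω => sapdPath_mem (G := G) (ε := ε) (θ := θ) (z := z ω) (wx := (ux · ω))
    (wy := (uy · ω)) hpr hτ hσ (hmem ω).1 (hmem ω).2 t
  have := (hF.fresh_y t).error_y hpr hG hX hY (fun ω => (hm ω).1) (fun ω => (hm ω).2)
    (φ := fun ω => stepY pr G L ε τ σ θ (z ω) (s ω) (ux · ω) (uy · ω) t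
      (-errPrev pr G L ε τ σ θ (z ω) (s ω) (ux · ω) (uy · ω) t)
      - (pr.saddle L (ε / (2 * pr.Dq)) (z ω)).2)
    (Measurable.sub (hstep _ (Measurable.neg hprev)) hsad) (R := pr.Dq)
    (fun ω => hpr.norm_sub_le_Dq (hpr.q_closed.prox_mem hσ _) (hpr.saddle_mem_right hL hb _))
  exact this

theorem errX_crossX_expectation (hF : IsFreshSequence Pb μ 𝓜x 𝓜y z s ux uy) (hpr : pr.Admissible L)
    (hG : G.Admissible pr μ δ) (hL : 0 < L) (hb : 0 < ε / (2 * pr.Dq)) (hτ : 0 < τ) (hσ : 0 < σ)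
    (hmem : ∀ ω, (s ω).1 ∈ pr.P ∧ (s ω).2 ∈ pr.Q) (t : ℕ) :
    (Integrable (fun ω => ‖errX pr G L ε τ σ θ (z ω) (s ω) (ux · ω) (uy · ω) t‖ ^ 2) Pb ∧
      ∫ ω, ‖errX pr G L ε τ σ θ (z ω) (s ω) (ux · ω) (uy · ω) t‖ ^ 2 ∂Pb ≤ δ ^ 2) ∧
    Integrable (fun ω => crossX pr G L ε τ σ θ (z ω) (s ω) (ux · ω) (uy · ω) t) Pb ∧
      ∫ ω, crossX pr G L ε τ σ θ (z ω) (s ω) (ux · ω) (uy · ω) t ∂Pb = 0 := by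
  have hz := hF.center_x t
  have haux := @measurable_sapdPath n m W Ω _ (𝓜x t) pr G μ L δ ε τ σ θ z s
    ux uy t hpr hG hτ hσ hz (hF.start_x t) hmem
  obtain ⟨hX, -⟩ := haux.1 (hF.x_lt_x t) fun j hj => hF.y_le_x t j hj.le
  obtain ⟨-, hY, hstep⟩ := haux.2 (hF.x_lt_x t) (hF.y_le_x t)
  have hsad := (hpr.continuous_saddle hL hb).measurable.fst.comp hz
  have hm := fun ω => sapdPath_mem (G := G) (ε := ε) (θ := θ) (z := z ω) (wx := (ux · ω))
    (wy := (uy · ω)) hpr hτ hσ (hmem ω).1 (hmem ω).2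
  have := (hF.fresh_x t).error_x hpr hG hX hY (fun ω => (hm ω t).1) (fun ω => (hm ω (t + 1)).2)
    (φ := fun ω => stepX pr G L ε τ σ θ (z ω) (s ω) (ux · ω) (uy · ω) t 0
      - (pr.saddle L (ε / (2 * pr.Dq)) (z ω)).1)
    (Measurable.sub (hstep _ measurable_const) hsad) (R := pr.Dp)
    (fun ω => hpr.norm_sub_le_Dp (hpr.p_closed.prox_mem hτ _) (hpr.saddle_mem_left hL hb _))
  exact this

/-- The inner products `crossX` and `crossY` are centred, so that only the squared errors remain. -/
theorem pathNoise_expectation (hF : IsFreshSequence Pb μ 𝓜x 𝓜y z s ux uy) (hpr : pr.Admissible L)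
    (hG : G.Admissible pr μ δ) (hL : 0 < L) (hb : 0 < ε / (2 * pr.Dq)) (hτ : 0 < τ) (hσ : 0 < σ)
    (hmem : ∀ ω, (s ω).1 ∈ pr.P ∧ (s ω).2 ∈ pr.Q) (t : ℕ) :
    Integrable (fun ω => pathNoise pr G L ε τ σ θ (z ω) (s ω) (ux · ω) (uy · ω) t) Pb ∧
      ∫ ω, pathNoise pr G L ε τ σ θ (z ω) (s ω) (ux · ω) (uy · ω) t ∂Pb
        ≤ (τ + 8 * σ) * δ ^ 2 := by
  obtain ⟨⟨ix, lx⟩, jx, kx⟩ := errX_crossX_expectation (θ := θ) hF hpr hG hL hb hτ hσ hmem t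
  obtain ⟨⟨iy, ly⟩, jy, ky⟩ := errY_crossY_expectation (θ := θ) hF hpr hG hL hb hτ hσ hmem t
  have hxτ := mul_le_mul_of_nonneg_left lx hτ.le
  have hyσ := mul_le_mul_of_nonneg_left ly hσ.le
  cases t with
  | zero =>
    simp only [pathNoise]
    have i1 := (ix.const_mul τ).sub jx
    have i2 := i1.add (iy.const_mul (4 * σ))
    have E := integral_add' i2 jy
    rw [integral_add' i1 (iy.const_mul (4 * σ)), integral_sub' (ix.const_mul τ) jx,
      integral_const_mul, integral_const_mul, kx, ky] at E
    refine ⟨i2.add jy, le_of_eq_of_le E ?_⟩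
    nlinarith [mul_nonneg hσ.le (sq_nonneg δ)]
  | succ t =>
    obtain ⟨⟨iy', ly'⟩, jy', ky'⟩ := errY_crossY_expectation (θ := θ) hF hpr hG hL hb hτ hσ hmem t
    have hyσ' := mul_le_mul_of_nonneg_left ly' hσ.le
    simp only [pathNoise]
    have i1 := (ix.const_mul τ).sub jx
    have i2 := i1.add (iy.const_mul (4 * σ))
    have i3 := i2.add (jy.const_mul (1 + θ))
    have i4 := i3.add (iy'.const_mul (4 * σ))
    have E := integral_sub' i4 (jy'.const_mul θ)
    rw [integral_add' i3 (iy'.const_mul (4 * σ)),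
      integral_add' i2 (jy.const_mul (1 + θ)), integral_add' i1 (iy.const_mul (4 * σ)),
      integral_sub' (ix.const_mul τ) jx] at E
    simp only [integral_const_mul, kx, ky, ky'] at E
    refine ⟨i4.sub (jy'.const_mul θ), le_of_eq_of_le E ?_⟩
    linarith

end Expectation

/-! ### The parameters of SAPD -/

section Parameters

variable {M a b δ e : ℝ}

theorem sapdBeta_pos (ha : 0 < a) (hb : 0 < b) : 0 < sapdBeta a b :=
  lt_min (by norm_num) (lt_min (div_pos hb ha) (div_pos ha hb))

theorem sapdBeta_le : sapdBeta a b ≤ 1 / 2 := min_le_left _ _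

theorem sapdPsi_nonneg : 0 ≤ sapdPsi a b :=
  le_min (Real.sqrt_nonneg _) (by linarith [sapdBeta_le (a := a) (b := b)])

theorem sapdPsi_le (ha : 0 < a) (hb : 0 < b) : sapdPsi a b ≤ 1 / 4 :=
  (min_le_right _ _).trans (by linarith [sapdBeta_pos ha hb])

/-- `θ₁` and `θ₂` are one minus the positive root of a quadratic. -/
theorem root_spec {c u : ℝ} (hc : 0 < c) (hu : 0 < u) :
    0 < c * (√(1 + u) - 1) ∧
    (c * (√(1 + u) - 1)) ^ 2 + 2 * c * (c * (√(1 + u) - 1)) = c ^ 2 * u ∧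
    (c * (√(1 + u) - 1))⁻¹ = (√(1 + u) + 1) / (c * u) := by
  have h1 : 1 < √(1 + u) := Real.lt_sqrt_of_sq_lt (by linarith)
  have h2 : √(1 + u) ^ 2 = 1 + u := Real.sq_sqrt (by linarith)
  have h3 : 0 < c * (√(1 + u) - 1) := mul_pos hc (by linarith)
  refine ⟨h3, by linear_combination c ^ 2 * h2, ?_⟩
  rw [inv_eq_iff_eq_inv, inv_div, eq_div_iff (by positivity)]
  linear_combination c * h2

/-- `1 - θ₁` solves with equality the quadratic inequality in `1 - θ` that amounts to
`StepParams.step_x`. -/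
theorem sapdTheta₁_spec (ha : 0 < a) (hb : 0 < b) (hM : 0 < M) :
    0 < 1 - sapdTheta₁ M a b ∧
    2 * M ^ 2 / (sapdBeta a b * b) * (1 - sapdTheta₁ M a b) ^ 2
      + (M + a) * (1 - sapdTheta₁ M a b) = a := by
  have hβ := sapdBeta_pos ha hb
  have h := root_spec (c := sapdBeta a b * (M + a) * b / (4 * M ^ 2))
    (u := 8 * a * M ^ 2 / (sapdBeta a b * b * (M + a) ^ 2)) (by positivity) (by positivity)
  rw [sapdTheta₁, sub_sub_cancel]
  refine ⟨h.1, ?_⟩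
  have h2 := h.2.1
  set s := sapdBeta a b * (M + a) * b / (4 * M ^ 2) *
    (√(1 + 8 * a * M ^ 2 / (sapdBeta a b * b * (M + a) ^ 2)) - 1)
  have e1 : 2 * M ^ 2 / (sapdBeta a b * b) * s ^ 2 + (M + a) * s
      = 2 * M ^ 2 / (sapdBeta a b * b)
        * (s ^ 2 + 2 * (sapdBeta a b * (M + a) * b / (4 * M ^ 2)) * s) := by
    field_simp
    ring
  rw [e1, h2]
  field_simp
  ring

/-- `θ₂` satisfies `StepParams.step_y` with equality. -/
theorem sapdTheta₂_spec (hb : 0 < b) (hM : 0 < M) :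
    0 < 1 - sapdTheta₂ M a b ∧
    (1 - sapdTheta₂ M a b) ^ 2 = (1 - sapdBeta a b) ^ 2 / 16 * (b ^ 2 / M ^ 2)
      * sapdTheta₂ M a b := by
  have hβ : 0 < 1 - sapdBeta a b := by linarith [sapdBeta_le (a := a) (b := b)]
  have h := root_spec (c := (1 - sapdBeta a b) ^ 2 / 32 * (b ^ 2 / M ^ 2))
    (u := 64 * M ^ 2 / ((1 - sapdBeta a b) ^ 2 * b ^ 2)) (by positivity) (by positivity)
  have h2 := h.2.1
  have e : ((1 - sapdBeta a b) ^ 2 / 32 * (b ^ 2 / M ^ 2)) ^ 2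
      * (64 * M ^ 2 / ((1 - sapdBeta a b) ^ 2 * b ^ 2))
      = (1 - sapdBeta a b) ^ 2 / 16 * (b ^ 2 / M ^ 2) := by
    field_simp
    ring
  rw [e] at h2
  have h3 : 1 - sapdTheta₂ M a b = (1 - sapdBeta a b) ^ 2 / 32 * (b ^ 2 / M ^ 2) *
    (√(1 + 64 * M ^ 2 / ((1 - sapdBeta a b) ^ 2 * b ^ 2)) - 1) := by
    rw [sapdTheta₂, sub_sub_cancel]
  rw [← h3] at h h2
  exact ⟨h.1, by linear_combination h2⟩

theorem one_sub_sapdTheta₃ : 1 - sapdTheta₃ a b δ e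
    = min 1 (1 / (12 * sapdXiX a b) * (a / δ ^ 2) * e ^ 2) := by
  rw [sapdTheta₃, ← min_sub_sub_left, sub_zero, sub_sub_cancel]

theorem one_sub_sapdTheta₄ : 1 - sapdTheta₄ a b δ e
    = min 1 (1 / (12 * sapdXiY a b) * (b / δ ^ 2) * e ^ 2) := by
  rw [sapdTheta₄, ← min_sub_sub_left, sub_zero, sub_sub_cancel]

theorem one_le_sapdXiX : 1 ≤ sapdXiX a b := le_add_of_nonneg_right sapdPsi_nonneg

theorem le_sapdXiY (ha : 0 < a) (hb : 0 < b) : 27 / 2 ≤ sapdXiY a b := by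
  have h1 := sapdBeta_pos ha hb
  have h2 : 0 ≤ b / a * sapdPsi a b := mul_nonneg (by positivity) sapdPsi_nonneg
  rw [sapdXiY]; linarith

theorem one_sub_sapdTheta_pos (ha : 0 < a) (hb : 0 < b) (hM : 0 < M) (hδ : 0 < δ) (he : 0 < e) :
    0 < 1 - sapdTheta M a b δ e := by
  have h1 := (sapdTheta₁_spec ha hb hM).1
  have h2 := (sapdTheta₂_spec (a := a) hb hM).1
  have h3 : 0 < 1 - sapdTheta₃ a b δ e := by
    have := one_le_sapdXiX (a := a) (b := b)
    rw [one_sub_sapdTheta₃]; positivity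
  have h4 : 0 < 1 - sapdTheta₄ a b δ e := by
    have := le_sapdXiY ha hb
    rw [one_sub_sapdTheta₄]; positivity
  rw [sub_pos, sapdTheta, max_lt_iff, max_lt_iff, max_lt_iff]
  exact ⟨⟨by linarith, by linarith⟩, by linarith, by linarith⟩

theorem sapdTheta₁_le : sapdTheta₁ M a b ≤ sapdTheta M a b δ e :=
  (le_max_left _ _).trans (le_max_left _ _)

theorem sapdTheta₂_le : sapdTheta₂ M a b ≤ sapdTheta M a b δ e :=
  (le_max_right _ _).trans (le_max_left _ _)

theorem sapdTheta₃_le : sapdTheta₃ a b δ e ≤ sapdTheta M a b δ e :=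
  (le_max_left _ _).trans (le_max_right _ _)

theorem sapdTheta₄_le : sapdTheta₄ a b δ e ≤ sapdTheta M a b δ e :=
  (le_max_right _ _).trans (le_max_right _ _)

/-- If `M ≥ 3 a` then `θ` is bounded away from zero, so that the step sizes are at most a constant
times `1 - θ`. -/
theorem three_quarters_le_sapdTheta (ha : 0 < a) (hb : 0 < b) (hM : 3 * a ≤ M) :
    3 / 4 ≤ sapdTheta M a b δ e := by
  have hM0 : 0 < M := by linarith
  obtain ⟨h1, h2⟩ := sapdTheta₁_spec ha hb hM0
  have h3 : 0 ≤ 2 * M ^ 2 / (sapdBeta a b * b) * (1 - sapdTheta₁ M a b) ^ 2 := by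
    have := sapdBeta_pos ha hb
    positivity
  have h4 : 1 - sapdTheta₁ M a b ≤ 1 / 4 := by nlinarith
  linarith [sapdTheta₁_le (M := M) (a := a) (b := b) (δ := δ) (e := e)]

theorem one_sub_sapdTheta_mul_le_x (ha : 0 < a) (hδ : 0 < δ) :
    (1 - sapdTheta M a b δ e) * δ ^ 2 / a ≤ e ^ 2 / 12 := by
  have h1 : 1 - sapdTheta M a b δ e ≤ 1 / (12 * sapdXiX a b) * (a / δ ^ 2) * e ^ 2 := by
    have h := sapdTheta₃_le (M := M) (a := a) (b := b) (δ := δ) (e := e)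
    have h' := one_sub_sapdTheta₃ (a := a) (b := b) (δ := δ) (e := e)
    linarith [min_le_right 1 (1 / (12 * sapdXiX a b) * (a / δ ^ 2) * e ^ 2)]
  have hΞ := one_le_sapdXiX (a := a) (b := b)
  rw [div_le_iff₀ ha]
  calc _ ≤ 1 / (12 * sapdXiX a b) * (a / δ ^ 2) * e ^ 2 * δ ^ 2 := by gcongr
    _ = 1 / (12 * sapdXiX a b) * (a * e ^ 2) := by field_simp
    _ ≤ 1 / (12 * 1) * (a * e ^ 2) := by gcongr
    _ = _ := by ring

theorem one_sub_sapdTheta_mul_le_y (ha : 0 < a) (hb : 0 < b) (hδ : 0 < δ) :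
    (1 - sapdTheta M a b δ e) * δ ^ 2 / b ≤ e ^ 2 / 162 := by
  have h1 : 1 - sapdTheta M a b δ e ≤ 1 / (12 * sapdXiY a b) * (b / δ ^ 2) * e ^ 2 := by
    have h := sapdTheta₄_le (M := M) (a := a) (b := b) (δ := δ) (e := e)
    have h' := one_sub_sapdTheta₄ (a := a) (b := b) (δ := δ) (e := e)
    linarith [min_le_right 1 (1 / (12 * sapdXiY a b) * (b / δ ^ 2) * e ^ 2)]
  have hΞ := le_sapdXiY ha hb
  rw [div_le_iff₀ hb]
  calc _ ≤ 1 / (12 * sapdXiY a b) * (b / δ ^ 2) * e ^ 2 * δ ^ 2 := by gcongr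
    _ = 1 / (12 * sapdXiY a b) * (b * e ^ 2) := by field_simp
    _ ≤ 1 / (12 * (27 / 2)) * (b * e ^ 2) := by gcongr
    _ = _ := by ring

theorem stepParams (ha : 0 < a) (hb : 0 < b) (hM : 3 * a ≤ M) (hδ : 0 < δ) (he : 0 < e) :
    StepParams a b M (sapdTau M a b δ e) (sapdSigma M a b δ e) (sapdTheta M a b δ e)
      (sapdBeta a b) := by
  have hM0 : 0 < M := by linarith
  have hβ := sapdBeta_pos ha hb
  have hs := one_sub_sapdTheta_pos ha hb hM0 hδ he
  have hθ := three_quarters_le_sapdTheta (δ := δ) (e := e) ha hb hM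
  obtain ⟨p1, q1⟩ := sapdTheta₁_spec ha hb hM0
  obtain ⟨p2, q2⟩ := sapdTheta₂_spec (a := a) hb hM0
  have l1 := sapdTheta₁_le (M := M) (a := a) (b := b) (δ := δ) (e := e)
  have l2 := sapdTheta₂_le (M := M) (a := a) (b := b) (δ := δ) (e := e)
  simp only [sapdTau, sapdSigma]
  set θ := sapdTheta M a b δ e
  have hθ0 : 0 < θ := by linarith
  have hτ : ((1 - θ) / (a * θ))⁻¹ = a * θ / (1 - θ) := inv_div _ _
  have hσ : ((1 - θ) / (b * θ))⁻¹ = b * θ / (1 - θ) := inv_div _ _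
  refine ⟨by positivity, by positivity, hθ0, hβ, sapdBeta_le, ?_, ?_, ?_, ?_⟩
  · rw [hτ]
    have : θ * (a * θ / (1 - θ)) - (a * θ / (1 - θ) - a) = a * (1 - θ) := by
      field_simp
      ring
    nlinarith
  · rw [hσ]
    apply le_of_eq
    field_simp
    ring
  · rw [hτ]
    have h1 : 2 * M ^ 2 / (sapdBeta a b * b) * (1 - θ) ^ 2 + (M + a) * (1 - θ) ≤ a := by
      calc _ ≤ 2 * M ^ 2 / (sapdBeta a b * b) * (1 - sapdTheta₁ M a b) ^ 2
            + (M + a) * (1 - sapdTheta₁ M a b) := by gcongr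
        _ = a := q1
    have h2 : 2 * ((1 - θ) / (b * θ) * θ * M ^ 2 / sapdBeta a b) * (1 - θ)
        ≤ (a * θ / (1 - θ) - M) * (1 - θ) := by
      have e1 : 2 * ((1 - θ) / (b * θ) * θ * M ^ 2 / sapdBeta a b) * (1 - θ)
          = 2 * M ^ 2 / (sapdBeta a b * b) * (1 - θ) ^ 2 := by
        field_simp
      have e2 : (a * θ / (1 - θ) - M) * (1 - θ) = a - (M + a) * (1 - θ) := by
        field_simp
        ring
      rw [e1, e2]; linarith
    exact le_of_mul_le_mul_right h2 hs
  · have h1 : (1 - θ) ^ 2 ≤ (1 - sapdBeta a b) ^ 2 / 16 * (b ^ 2 / M ^ 2) * θ := by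
      calc (1 - θ) ^ 2 ≤ (1 - sapdTheta₂ M a b) ^ 2 := by gcongr
        _ = _ := q2
        _ ≤ _ := by gcongr
    calc ((1 - θ) / (b * θ)) ^ 2 * θ * M ^ 2 = (1 - θ) ^ 2 * (M ^ 2 / (b ^ 2 * θ)) := by
          field_simp
      _ ≤ (1 - sapdBeta a b) ^ 2 / 16 * (b ^ 2 / M ^ 2) * θ * (M ^ 2 / (b ^ 2 * θ)) := by gcongr
      _ = _ := by field_simp

/-- The number of iterations is large enough to reduce the initial distance to the accuracy. -/
theorem sapdTheta_pow_le (ha : 0 < a) (hb : 0 < b) (hM : 3 * a ≤ M) (hδ : 0 < δ) (he : 0 < e)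
    {dp dq : ℝ} (hdq : 0 < dq) :
    sapdTheta M a b δ e ^ sapdT M a b δ e dp dq * (a * dp ^ 2 + b * dq ^ 2) ≤ e ^ 2 / 6 := by
  have hM0 : 0 < M := by linarith
  have hs := one_sub_sapdTheta_pos ha hb hM0 hδ he
  have hθ := three_quarters_le_sapdTheta (δ := δ) (e := e) ha hb hM
  have hT := Nat.le_ceil (1 + Real.log ((6 * a * dp ^ 2 + 6 * b * dq ^ 2) / e ^ 2) *
    max (max (1 - sapdTheta₁ M a b)⁻¹ (1 - sapdTheta₂ M a b)⁻¹)
      (max (1 - sapdTheta₃ a b δ e)⁻¹ (1 - sapdTheta₄ a b δ e)⁻¹))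
  have hR : (1 - sapdTheta M a b δ e)⁻¹ ≤
    max (max (1 - sapdTheta₁ M a b)⁻¹ (1 - sapdTheta₂ M a b)⁻¹)
      (max (1 - sapdTheta₃ a b δ e)⁻¹ (1 - sapdTheta₄ a b δ e)⁻¹) := by
    rcases max_choice (max (sapdTheta₁ M a b) (sapdTheta₂ M a b))
      (max (sapdTheta₃ a b δ e) (sapdTheta₄ a b δ e)) with h | h
    · rcases max_choice (sapdTheta₁ M a b) (sapdTheta₂ M a b) with h' | h' <;>
        rw [show sapdTheta M a b δ e = _ from h.trans h']
      · exact le_max_of_le_left (le_max_left _ _)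
      · exact le_max_of_le_left (le_max_right _ _)
    · rcases max_choice (sapdTheta₃ a b δ e) (sapdTheta₄ a b δ e) with h' | h' <;>
        rw [show sapdTheta M a b δ e = _ from h.trans h']
      · exact le_max_of_le_right (le_max_left _ _)
      · exact le_max_of_le_right (le_max_right _ _)
  change _ ≤ (sapdT M a b δ e dp dq : ℝ) at hT
  set T := sapdT M a b δ e dp dq
  set θ := sapdTheta M a b δ e
  set R := max (max (1 - sapdTheta₁ M a b)⁻¹ (1 - sapdTheta₂ M a b)⁻¹)
      (max (1 - sapdTheta₃ a b δ e)⁻¹ (1 - sapdTheta₄ a b δ e)⁻¹)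
  have hA : 0 < (6 * a * dp ^ 2 + 6 * b * dq ^ 2) / e ^ 2 := by positivity
  have key : θ ^ T * ((6 * a * dp ^ 2 + 6 * b * dq ^ 2) / e ^ 2) ≤ 1 := by
    rcases le_total 0 (Real.log ((6 * a * dp ^ 2 + 6 * b * dq ^ 2) / e ^ 2)) with hl | hl
    · have h1 : Real.log ((6 * a * dp ^ 2 + 6 * b * dq ^ 2) / e ^ 2) ≤ T * (1 - θ) := by
        have h2 := mul_le_mul_of_nonneg_left hR hl
        have h3 := mul_le_mul_of_nonneg_right (h2.trans (by linarith : _ ≤ (T : ℝ))) hs.le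
        rwa [mul_assoc, inv_mul_cancel₀ hs.ne', mul_one] at h3
      have h2 : θ ^ T ≤ Real.exp (-(T * (1 - θ))) := by
        have h3 : θ ≤ Real.exp (-(1 - θ)) := by
          have := Real.add_one_le_exp (-(1 - θ))
          linarith
        calc θ ^ T ≤ Real.exp (-(1 - θ)) ^ T := by gcongr
          _ = _ := by rw [← Real.exp_nat_mul]; ring_nf
      calc _ ≤ Real.exp (-(T * (1 - θ))) * Real.exp (T * (1 - θ)) := by
            gcongr
            rw [← Real.log_le_iff_le_exp hA]; exact h1
        _ = 1 := by rw [← Real.exp_add]; simp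
    · have h1 : (6 * a * dp ^ 2 + 6 * b * dq ^ 2) / e ^ 2 ≤ 1 := by
        rwa [Real.log_nonpos_iff hA.le] at hl
      have h2 : θ ^ T ≤ 1 := pow_le_one₀ (by linarith) (by linarith)
      exact mul_le_one₀ h2 hA.le h1
  rw [← mul_div_assoc, div_le_iff₀ (by positivity)] at key
  linarith

end Parameters

/-! ### The number of oracle calls -/

section Complexity

variable {L b δ e : ℝ}

theorem inv_one_sub_sapdTheta₁_le (hL : 0 < L) (hb : 0 < b) {M : ℝ} (hM : 3 * L ≤ M) :
    (1 - sapdTheta₁ M L b)⁻¹ ≤ M * (2 / √(L * b) + 3 / L + 6 / b) := by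
  have hM0 : 0 < M := by linarith
  have hβ := sapdBeta_pos hL hb
  set β := sapdBeta L b with hβdef
  have h := (root_spec (c := β * (M + L) * b / (4 * M ^ 2))
    (u := 8 * L * M ^ 2 / (β * b * (M + L) ^ 2)) (by positivity) (by positivity)).2.2
  rw [sapdTheta₁, sub_sub_cancel, ← hβdef, h]
  set u := 8 * L * M ^ 2 / (β * b * (M + L) ^ 2) with hu
  have hu0 : 0 < u := by positivity
  have hsq : √(1 + u) ≤ 1 + √u := by
    rw [Real.sqrt_le_left (by positivity)]
    nlinarith [Real.sq_sqrt hu0.le, Real.sqrt_nonneg u]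
  have hsu : √u = 4 * L * M / ((M + L) * √(2 * L * (β * b))) := by
    rw [hu, show 8 * L * M ^ 2 / (β * b * (M + L) ^ 2)
      = (4 * L * M / (M + L)) ^ 2 / (2 * L * (β * b)) by field_simp; ring,
      Real.sqrt_div (by positivity), Real.sqrt_sq (by positivity)]
    field_simp
  have hcu : β * (M + L) * b / (4 * M ^ 2) * u = 2 * L / (M + L) := by
    rw [hu]; field_simp; ring
  rw [hcu]
  have h1 : (√(1 + u) + 1) / (2 * L / (M + L)) ≤ (M + L) / L + 2 * M / √(2 * L * (β * b)) := by
    calc _ ≤ (1 + √u + 1) / (2 * L / (M + L)) := by gcongr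
      _ = _ := by rw [hsu]; field_simp; ring
  -- Up to constants, `1 / √(β L b)` is the largest of `1 / √(L b)`, `1 / L` and `1 / b`.
  have h2 : 2 / √(2 * L * (β * b)) ≤ 2 / √(L * b) + 3 / 2 / L + 3 / 2 / b := by
    have p1 : 0 < 2 / √(L * b) := by positivity
    have p2 : 0 < 3 / 2 / L := by positivity
    have p3 : 0 < 3 / 2 / b := by positivity
    have aux : ∀ c : ℝ, 0 < c → (16 / 9) * c ^ 2 ≤ 2 * L * (β * b) →
        2 / √(2 * L * (β * b)) ≤ 3 / 2 / c := by
      intro c hc h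
      have : 4 / 3 * c ≤ √(2 * L * (β * b)) := Real.le_sqrt_of_sq_le (by linarith)
      calc _ ≤ 2 / (4 / 3 * c) := by gcongr
        _ = _ := by field_simp; norm_num
    rcases min_choice (1 / 2) (min (b / L) (L / b)) with h | h
    · have : 2 * L * (β * b) = L * b := by
        rw [hβdef, sapdBeta, h]; ring
      rw [this]; linarith
    · rcases min_choice (b / L) (L / b) with h' | h'
      · have : 2 * L * (β * b) = 2 * b ^ 2 := by
          rw [hβdef, sapdBeta, h, h']; field_simp
        linarith [aux b hb (by rw [this]; nlinarith)]
      · have : 2 * L * (β * b) = 2 * L ^ 2 := by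
          rw [hβdef, sapdBeta, h, h']; field_simp
        linarith [aux L hL (by rw [this]; nlinarith)]
  have h3 : (M + L) / L ≤ M * (3 / 2 / L) := by
    rw [div_le_iff₀ hL]; field_simp; linarith
  have h4 := mul_le_mul_of_nonneg_left h2 hM0.le
  have h5 : 0 ≤ M * (9 / 2 / b) := by positivity
  have e1 : M * (2 / √(2 * L * (β * b))) = 2 * M / √(2 * L * (β * b)) := by ring
  have e2 : M * (2 / √(L * b) + 3 / L + 6 / b)
    = M * (2 / √(L * b) + 3 / 2 / L + 3 / 2 / b) + M * (3 / 2 / L) + M * (9 / 2 / b) := by ring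
  rw [e2]
  linarith

theorem inv_one_sub_sapdTheta₂_le (hb : 0 < b) {M : ℝ} (hM : b ≤ M) :
    (1 - sapdTheta₂ M L b)⁻¹ ≤ M * (12 / b) := by
  have hM0 : 0 < M := by linarith
  have hβ : 1 / 2 ≤ 1 - sapdBeta L b := by linarith [sapdBeta_le (a := L) (b := b)]
  set κ := 1 - sapdBeta L b
  have hκ : 0 < κ := by linarith
  have h := (root_spec (c := κ ^ 2 / 32 * (b ^ 2 / M ^ 2))
    (u := 64 * M ^ 2 / (κ ^ 2 * b ^ 2)) (by positivity) (by positivity)).2.2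
  rw [sapdTheta₂, sub_sub_cancel, h]
  set u := 64 * M ^ 2 / (κ ^ 2 * b ^ 2) with hu
  have hsq : √(1 + u) ≤ 1 + 8 * M / (κ * b) := by
    rw [Real.sqrt_le_left (by positivity)]
    have : u = (8 * M / (κ * b)) ^ 2 := by rw [hu]; field_simp; norm_num
    have h0 : 0 < 8 * M / (κ * b) := by positivity
    nlinarith
  have hcu : κ ^ 2 / 32 * (b ^ 2 / M ^ 2) * u = 2 := by
    rw [hu]; field_simp; norm_num
  rw [hcu]
  have h2 : 8 * M / (κ * b) ≤ 8 * M / (1 / 2 * b) := by gcongr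
  have h3 : 1 ≤ M / b := (one_le_div hb).2 hM
  have e1 : 8 * M / (1 / 2 * b) = 16 * (M / b) := by field_simp; norm_num
  have e2 : M * (12 / b) = 12 * (M / b) := by ring
  rw [e2]
  linarith

theorem inv_one_sub_sapdTheta₃_le (hL : 0 < L) (hb : 0 < b) (hδ : 0 < δ) (he : 0 < e) :
    (1 - sapdTheta₃ L b δ e)⁻¹ ≤ 1 + δ ^ 2 / e ^ 2 * (15 / L) := by
  have h1 := one_le_sapdXiX (a := L) (b := b)
  have h2 : sapdXiX L b ≤ 5 / 4 := by
    rw [sapdXiX]; linarith [sapdPsi_le hL hb]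
  have hp : 0 < δ ^ 2 / e ^ 2 * (15 / L) := by positivity
  rw [one_sub_sapdTheta₃]
  rcases min_choice 1 (1 / (12 * sapdXiX L b) * (L / δ ^ 2) * e ^ 2) with h | h <;> rw [h]
  · linarith [inv_one (G := ℝ)]
  · have : (1 / (12 * sapdXiX L b) * (L / δ ^ 2) * e ^ 2)⁻¹
        = δ ^ 2 / e ^ 2 * (12 * sapdXiX L b / L) := by field_simp
    rw [this]
    have : δ ^ 2 / e ^ 2 * (12 * sapdXiX L b / L) ≤ δ ^ 2 / e ^ 2 * (15 / L) := by
      gcongr; linarith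
    linarith

theorem inv_one_sub_sapdTheta₄_le (hL : 0 < L) (hb : 0 < b) (hδ : 0 < δ) (he : 0 < e) :
    (1 - sapdTheta₄ L b δ e)⁻¹ ≤ 1 + δ ^ 2 / e ^ 2 * (3 / L + 180 / b) := by
  have h1 := le_sapdXiY hL hb
  have h2 : sapdXiY L b ≤ 57 / 4 + b / L * (1 / 4) := by
    have h3 : b / L * sapdPsi L b ≤ b / L * (1 / 4) := by
      gcongr; exact sapdPsi_le hL hb
    rw [sapdXiY]; linarith [sapdBeta_le (a := L) (b := b)]
  have hp : 0 < δ ^ 2 / e ^ 2 * (3 / L + 180 / b) := by positivity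
  rw [one_sub_sapdTheta₄]
  rcases min_choice 1 (1 / (12 * sapdXiY L b) * (b / δ ^ 2) * e ^ 2) with h | h <;> rw [h]
  · linarith [inv_one (G := ℝ)]
  · have e1 : (1 / (12 * sapdXiY L b) * (b / δ ^ 2) * e ^ 2)⁻¹
        = δ ^ 2 / e ^ 2 * (12 * sapdXiY L b / b) := by field_simp
    rw [e1]
    have : δ ^ 2 / e ^ 2 * (12 * sapdXiY L b / b) ≤ δ ^ 2 / e ^ 2 * (3 / L + 180 / b) := by
      gcongr
      calc 12 * sapdXiY L b / b ≤ 12 * (57 / 4 + b / L * (1 / 4)) / b := by gcongr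
        _ = 3 / L + 171 / b := by field_simp; ring
        _ ≤ _ := by gcongr; norm_num
    linarith

theorem sapdT_le_innerBound {n m : ℕ} {pr : Problem n m} {ε : ℝ} (hL : 0 < L) (hε : 0 < ε)
    (hδ : 0 < δ) (he : 0 < e) (hDq : 0 < pr.Dq) :
    sapdT (L + max (2 * L) (ε / (2 * pr.Dq))) L (ε / (2 * pr.Dq)) δ e pr.Dp pr.Dq
      ≤ innerBound pr L δ ε e := by
  have hb : 0 < ε / (2 * pr.Dq) := by positivity
  set b := ε / (2 * pr.Dq) with hbdef
  set M := L + max (2 * L) b with hMdef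
  have hM : 3 * L ≤ M := by linarith [le_max_left (2 * L) b]
  have hM' : b ≤ M := by linarith [le_max_right (2 * L) b]
  have hM0 : 0 < M := by linarith
  have e1 : 2 * √(2 * pr.Dq) / √(L * ε) = 2 / √(L * b) := by
    rw [hbdef, ← mul_div_assoc, Real.sqrt_div (by positivity), div_div_eq_mul_div]
  have e2 : 24 * pr.Dq / ε = 12 / b := by rw [hbdef]; field_simp; norm_num
  have e3 : 360 * pr.Dq / ε = 180 / b := by rw [hbdef]; field_simp; norm_num
  have e4 : 6 * L * pr.Dp ^ 2 + 3 * ε * pr.Dq = 6 * L * pr.Dp ^ 2 + 6 * b * pr.Dq ^ 2 := by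
    rw [hbdef]; field_simp; ring
  rw [sapdT, innerBound, e1, e2, e3, e4, ← hMdef]
  have p1 : 0 < M * (2 / √(L * b)) := by positivity
  have p2 : 1 ≤ M * (3 / L) := by
    rw [← mul_div_assoc, one_le_div hL]; linarith
  have p3 : 0 < M * (12 / b) := by positivity
  have p4 : 0 < δ ^ 2 / e ^ 2 * (21 / L) := by positivity
  have p5 : 0 < δ ^ 2 / e ^ 2 * (180 / b) := by positivity
  have hR : max (max (1 - sapdTheta₁ M L b)⁻¹ (1 - sapdTheta₂ M L b)⁻¹)
      (max (1 - sapdTheta₃ L b δ e)⁻¹ (1 - sapdTheta₄ L b δ e)⁻¹)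
      ≤ M * (2 / √(L * b) + 3 / L + 12 / b) + δ ^ 2 / e ^ 2 * (21 / L + 180 / b) := by
    have i1 := inv_one_sub_sapdTheta₁_le hL hb hM
    have i2 := inv_one_sub_sapdTheta₂_le (L := L) hb hM'
    have i3 := inv_one_sub_sapdTheta₃_le hL hb hδ he
    have i4 := inv_one_sub_sapdTheta₄_le hL hb hδ he
    have q1 : δ ^ 2 / e ^ 2 * (15 / L) ≤ δ ^ 2 / e ^ 2 * (21 / L) := by gcongr; norm_num
    have q2 : δ ^ 2 / e ^ 2 * (3 / L) ≤ δ ^ 2 / e ^ 2 * (21 / L) := by gcongr; norm_num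
    have q3 : M * (6 / b) ≤ M * (12 / b) := by gcongr; norm_num
    simp only [mul_add] at *
    exact max_le (max_le (by linarith) (by linarith)) (max_le (by linarith) (by linarith))
  have hR0 : 0 < max (max (1 - sapdTheta₁ M L b)⁻¹ (1 - sapdTheta₂ M L b)⁻¹)
      (max (1 - sapdTheta₃ L b δ e)⁻¹ (1 - sapdTheta₄ L b δ e)⁻¹) :=
    lt_max_of_lt_left (lt_max_of_lt_left (inv_pos.2 (sapdTheta₁_spec hL hb hM0).1))
  rcases le_total 0 (Real.log ((6 * L * pr.Dp ^ 2 + 6 * b * pr.Dq ^ 2) / e ^ 2)) with hl | hl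
  · refine le_max_of_le_right ?_
    gcongr
  · refine le_max_of_le_left (Nat.ceil_le.2 ?_)
    have := mul_nonpos_of_nonpos_of_nonneg hl hR0.le
    push_cast
    linarith

end Complexity

/-! ### The accuracy of SAPD -/

theorem one_sub_mul_sum_pow {θ : ℝ} (T : ℕ) :
    (1 - θ) * ∑ j ∈ Finset.range T, θ ^ (T - j) = θ * (1 - θ ^ T) := by
  induction T with
  | zero => simp
  | succ T ih =>
    have h : ∑ j ∈ Finset.range T, θ ^ (T + 1 - j) = θ * ∑ j ∈ Finset.range T, θ ^ (T - j) := by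
      rw [Finset.mul_sum]
      refine Finset.sum_congr rfl fun j hj => ?_
      rw [Nat.succ_sub (Finset.mem_range.1 hj).le, pow_succ]; ring
    rw [Finset.sum_range_succ, h, Nat.add_sub_cancel_left, pow_one, pow_succ]
    linear_combination θ * ih

section Accuracy

variable {n m : ℕ} {W Ω : Type*} [MeasurableSpace W] [MeasurableSpace Ω] {pr : Problem n m}
  {G : Oracle n m W} {μ : Measure W} [IsProbabilityMeasure μ] {Pb : Measure Ω}
  [IsProbabilityMeasure Pb] {L M δ ε e : ℝ} {z s : Ω → Vec n × Vec m}
  {ux uy : ℕ → Ω → W} {𝓜x 𝓜y : ℕ → MeasurableSpace Ω}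

/-- The weighted squared distance of `(x, y)` to the saddle point of a subproblem. -/
def saddleDist (pr : Problem n m) (L b : ℝ) (z : Vec n × Vec m) (x : Vec n) (y : Vec m) : ℝ :=
  L * ‖x - (pr.saddle L b z).1‖ ^ 2 + b * ‖y - (pr.saddle L b z).2‖ ^ 2

theorem saddleDist_nonneg {b : ℝ} (hL : 0 ≤ L) (hb : 0 ≤ b) (z : Vec n × Vec m) (x : Vec n)
    (y : Vec m) : 0 ≤ saddleDist pr L b z x y := by
  unfold saddleDist; positivity

theorem saddleDist_le {b : ℝ} (hpr : pr.Admissible L) (hL : 0 < L) (hb : 0 < b) (z : Vec n × Vec m)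
    {x : Vec n} {y : Vec m} (hx : x ∈ pr.P) (hy : y ∈ pr.Q) :
    saddleDist pr L b z x y ≤ L * pr.Dp ^ 2 + b * pr.Dq ^ 2 := by
  unfold saddleDist
  gcongr
  · exact hpr.norm_sub_le_Dp hx (hpr.saddle_mem_left hL hb z)
  · exact hpr.norm_sub_le_Dq hy (hpr.saddle_mem_right hL hb z)

theorem measurable_saddleDist {b : ℝ} (hpr : pr.Admissible L) (hL : 0 < L) (hb : 0 < b)
    (hz : Measurable z) {X : Ω → Vec n} {Y : Ω → Vec m} (hX : Measurable X) (hY : Measurable Y) :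
    Measurable (fun ω => saddleDist pr L b (z ω) (X ω) (Y ω)) := by
  have hs := (hpr.continuous_saddle hL hb).measurable.comp hz
  exact (((hX.sub hs.fst).norm.pow_const 2).const_mul L).add
    (((hY.sub hs.snd).norm.pow_const 2).const_mul b)

theorem integrable_saddleDist {b : ℝ} (hpr : pr.Admissible L) (hL : 0 < L) (hb : 0 < b)
    (hz : Measurable z) {X : Ω → Vec n} {Y : Ω → Vec m} (hX : Measurable X) (hY : Measurable Y)
    (hXm : ∀ ω, X ω ∈ pr.P) (hYm : ∀ ω, Y ω ∈ pr.Q) :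
    Integrable (fun ω => saddleDist pr L b (z ω) (X ω) (Y ω)) Pb := by
  refine Integrable.of_bound (measurable_saddleDist hpr hL hb hz hX hY).aestronglyMeasurable
    (L * pr.Dp ^ 2 + b * pr.Dq ^ 2) (ae_of_all _ fun ω => ?_)
  rw [Real.norm_of_nonneg (saddleDist_nonneg hL.le hb.le _ _ _)]
  exact saddleDist_le hpr hL hb _ (hXm ω) (hYm ω)

/-- One call of SAPD approximates the saddle point of its subproblem with mean weighted squared
error at most `e²`: the initial distance and the noise contribute at most `11 / 16 * e²`
together. -/
theorem sapdPath_accuracy (hF : IsFreshSequence Pb μ 𝓜x 𝓜y z s ux uy) (hpr : pr.Admissible L)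
    (hG : G.Admissible pr μ δ) (hL : 0 < L) (hδ : 0 < δ) (he : 0 < e) (hDq : 0 < pr.Dq)
    {b : ℝ} (hb : b = ε / (2 * pr.Dq)) (hb0 : 0 < b) (hM : 3 * L ≤ M) (hM' : L + b ≤ M)
    (hmem : ∀ ω, (s ω).1 ∈ pr.P ∧ (s ω).2 ∈ pr.Q) :
    ∫ ω, saddleDist pr L b (z ω)
      (sapdPath pr G L ε (sapdTau M L b δ e) (sapdSigma M L b δ e) (sapdTheta M L b δ e) (z ω)
        (s ω) (ux · ω) (uy · ω) (sapdT M L b δ e pr.Dp pr.Dq)).x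
      (sapdPath pr G L ε (sapdTau M L b δ e) (sapdSigma M L b δ e) (sapdTheta M L b δ e) (z ω)
        (s ω) (ux · ω) (uy · ω) (sapdT M L b δ e pr.Dp pr.Dq)).y ∂Pb ≤ e ^ 2 := by
  have hM0 : 0 < M := by linarith
  have hp := stepParams (b := b) hL hb0 hM hδ he
  have hs := one_sub_sapdTheta_pos (b := b) hL hb0 hM0 hδ he
  have hθ := three_quarters_le_sapdTheta (δ := δ) (e := e) hL hb0 hM
  have hpow := sapdTheta_pow_le hL hb0 hM hδ he hDq (dp := pr.Dp)
  have hnx := one_sub_sapdTheta_mul_le_x (M := M) (b := b) (e := e) hL hδ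
  have hny := one_sub_sapdTheta_mul_le_y (M := M) (e := e) hL hb0 hδ
  have hτ : sapdTau M L b δ e
    = (1 - sapdTheta M L b δ e) / (L * sapdTheta M L b δ e) := rfl
  have hσ : sapdSigma M L b δ e
    = (1 - sapdTheta M L b δ e) / (b * sapdTheta M L b δ e) := rfl
  have hτi : (sapdTau M L b δ e)⁻¹ = L * sapdTheta M L b δ e / (1 - sapdTheta M L b δ e) := by
    rw [hτ, inv_div]
  have hσi : (sapdSigma M L b δ e)⁻¹ = b * sapdTheta M L b δ e / (1 - sapdTheta M L b δ e) := by
    rw [hσ, inv_div]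
  set θ := sapdTheta M L b δ e
  set τ := sapdTau M L b δ e
  set σ := sapdSigma M L b δ e
  set T := sapdT M L b δ e pr.Dp pr.Dq
  have hθ0 : 0 < θ := hp.θ_pos
  have hm := fun ω => sapdPath_mem (G := G) (ε := ε) (θ := θ) (z := z ω) (wx := (ux · ω))
    (wy := (uy · ω)) hpr hp.τ_pos hp.σ_pos (hmem ω).1 (hmem ω).2
  subst hb
  have hnoise := pathNoise_expectation (θ := θ) hF hpr hG hL hb0 hp.τ_pos hp.σ_pos hmem
  have hsum : Integrable (fun ω => ∑ j ∈ Finset.range T,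
      θ ^ (T - j) * pathNoise pr G L ε τ σ θ (z ω) (s ω) (ux · ω) (uy · ω) j) Pb :=
    integrable_finsetSum _ fun j _ => (hnoise j).1.const_mul _
  set b := ε / (2 * pr.Dq)
  -- The contraction of the Lyapunov function, multiplied by `2 (1 - θ) / θ` to turn the weights
  -- `θ / (2 τ)` and `1 / (2 σ)` into multiples of `L` and `b`.
  have hpath : ∀ ω, 11 / 16 * saddleDist pr L b (z ω)
      (sapdPath pr G L ε τ σ θ (z ω) (s ω) (ux · ω) (uy · ω) T).x
      (sapdPath pr G L ε τ σ θ (z ω) (s ω) (ux · ω) (uy · ω) T).y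
      ≤ e ^ 2 / 6 + 2 * (1 - θ) / θ * ∑ j ∈ Finset.range T,
        θ ^ (T - j) * pathNoise pr G L ε τ σ θ (z ω) (s ω) (ux · ω) (uy · ω) j := by
    intro ω
    have h1 := hpr.le_lyapunov hp hb0.le hM' (z ω) (hm ω T).1 (hm ω (T - 1)).1 (hm ω T).2
      (hm ω (T - 1)).2
    have h2 := pathLyapunov_le (G := G) (z := z ω) (wx := (ux · ω)) (wy := (uy · ω)) hpr hp hL hb0
      hM hM' (by linarith) (hmem ω).1 (hmem ω).2 T
    have h3 : 2 * (1 - θ) / θ *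
        pathLyapunov pr G L ε M τ σ θ (sapdBeta L b) (z ω) (s ω) (ux · ω) (uy · ω) 0
        ≤ L * pr.Dp ^ 2 + b * pr.Dq ^ 2 := by
      have e0 : pathLyapunov pr G L ε M τ σ θ (sapdBeta L b) (z ω) (s ω) (ux · ω) (uy · ω) 0
          = θ * τ⁻¹ / 2 * ‖(s ω).1 - (pr.saddle L b (z ω)).1‖ ^ 2
            + σ⁻¹ / 2 * ‖(s ω).2 - (pr.saddle L b (z ω)).2‖ ^ 2 := by
        simp [pathLyapunov, Problem.lyapunov, sapdPath, sapdRun, b]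
      rw [e0, hτi, hσi]
      have e1 : 2 * (1 - θ) / θ * (θ * (L * θ / (1 - θ)) / 2 *
          ‖(s ω).1 - (pr.saddle L b (z ω)).1‖ ^ 2 + b * θ / (1 - θ) / 2 *
          ‖(s ω).2 - (pr.saddle L b (z ω)).2‖ ^ 2)
          = θ * (L * ‖(s ω).1 - (pr.saddle L b (z ω)).1‖ ^ 2)
            + b * ‖(s ω).2 - (pr.saddle L b (z ω)).2‖ ^ 2 := by
        field_simp
      rw [e1]
      refine le_trans ?_ (saddleDist_le hpr hL hb0 (z ω) (hmem ω).1 (hmem ω).2)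
      have : 0 ≤ L * ‖(s ω).1 - (pr.saddle L b (z ω)).1‖ ^ 2 := by positivity
      simp only [saddleDist]
      nlinarith
    have h4 : 11 / 16 * saddleDist pr L b (z ω)
        (sapdPath pr G L ε τ σ θ (z ω) (s ω) (ux · ω) (uy · ω) T).x
        (sapdPath pr G L ε τ σ θ (z ω) (s ω) (ux · ω) (uy · ω) T).y
        ≤ 2 * (1 - θ) / θ *
          pathLyapunov pr G L ε M τ σ θ (sapdBeta L b) (z ω) (s ω) (ux · ω) (uy · ω) T := by
      refine le_trans ?_ (mul_le_mul_of_nonneg_left h1 (by positivity))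
      rw [hτi, hσi]
      set X := ‖(sapdPath pr G L ε τ σ θ (z ω) (s ω) (ux · ω) (uy · ω) T).x
        - (pr.saddle L b (z ω)).1‖ ^ 2 with hX
      set Y := ‖(sapdPath pr G L ε τ σ θ (z ω) (s ω) (ux · ω) (uy · ω) T).y
        - (pr.saddle L b (z ω)).2‖ ^ 2 with hY
      have e1 : 2 * (1 - θ) / θ * (θ * (L * θ / (1 - θ)) / 2 * X
          + 11 / 32 * (b * θ / (1 - θ)) * Y) = θ * (L * X) + 11 / 16 * (b * Y) := by
        field_simp
        ring
      rw [e1]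
      have : 0 ≤ L * X := by positivity
      simp only [saddleDist]
      rw [← hX, ← hY]
      nlinarith
    have h5 := mul_le_mul_of_nonneg_left h2 (by positivity : 0 ≤ 2 * (1 - θ) / θ)
    have h6 := mul_le_mul_of_nonneg_left h3 (by positivity : 0 ≤ θ ^ T)
    linarith
  have hX : Measurable fun ω => (sapdPath pr G L ε τ σ θ (z ω) (s ω) (ux · ω) (uy · ω) T).x :=
    Measurable.mono (@measurable_sapdPath n m W Ω _ (𝓜y T) pr G μ L δ ε τ σ θ
      z s ux uy T hpr hG hp.τ_pos hp.σ_pos (hF.center_y T) (hF.start_y T) hmem |>.1 (hF.x_lt_y T)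
      (hF.y_lt_y T)).1 (hF.fresh_y T).le le_rfl
  have hY : Measurable fun ω => (sapdPath pr G L ε τ σ θ (z ω) (s ω) (ux · ω) (uy · ω) T).y :=
    Measurable.mono (@measurable_sapdPath n m W Ω _ (𝓜y T) pr G μ L δ ε τ σ θ
      z s ux uy T hpr hG hp.τ_pos hp.σ_pos (hF.center_y T) (hF.start_y T) hmem |>.1 (hF.x_lt_y T)
      (hF.y_lt_y T)).2.1 (hF.fresh_y T).le le_rfl
  have hz : Measurable z := (hF.center_y 0).mono (hF.fresh_y 0).le le_rfl
  have hint := integrable_saddleDist (Pb := Pb) hpr hL hb0 hz hX hY (fun ω => (hm ω T).1)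
    (fun ω => (hm ω T).2)
  have hmono := integral_mono (hint.const_mul (11 / 16))
    ((integrable_const (e ^ 2 / 6)).add (hsum.const_mul (2 * (1 - θ) / θ))) hpath
  rw [integral_const_mul] at hmono
  have hrhs := integral_add' (μ := Pb) (integrable_const (e ^ 2 / 6))
    (hsum.const_mul (2 * (1 - θ) / θ))
  rw [integral_const_mul, integral_finsetSum _ fun j _ => (hnoise j).1.const_mul _] at hrhs
  have hN : ∑ j ∈ Finset.range T, ∫ ω, θ ^ (T - j) *
      pathNoise pr G L ε τ σ θ (z ω) (s ω) (ux · ω) (uy · ω) j ∂Pb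
      ≤ (∑ j ∈ Finset.range T, θ ^ (T - j)) * ((τ + 8 * σ) * δ ^ 2) := by
    rw [Finset.sum_mul]
    refine Finset.sum_le_sum fun j _ => ?_
    rw [integral_const_mul]
    exact mul_le_mul_of_nonneg_left (hnoise j).2 (by positivity)
  have hgeom : 2 * (1 - θ) / θ * (∑ j ∈ Finset.range T, θ ^ (T - j)) ≤ 2 := by
    have h1 := one_sub_mul_sum_pow (θ := θ) T
    have h2 : 0 ≤ θ ^ T := by positivity
    calc _ = 2 / θ * ((1 - θ) * ∑ j ∈ Finset.range T, θ ^ (T - j)) := by ring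
      _ = 2 * (1 - θ ^ T) := by rw [h1]; field_simp
      _ ≤ 2 := by linarith
  have hvar : (τ + 8 * σ) * δ ^ 2 ≤ 4 / 3 * (e ^ 2 / 12 + 8 * (e ^ 2 / 162)) := by
    have hinv : θ⁻¹ ≤ 4 / 3 := by
      rw [inv_le_comm₀ hθ0 (by norm_num)]; linarith
    have e1 : (τ + 8 * σ) * δ ^ 2
        = θ⁻¹ * ((1 - θ) * δ ^ 2 / L + 8 * ((1 - θ) * δ ^ 2 / b)) := by
      rw [hτ, hσ]; field_simp
    rw [e1]
    gcongr
  have hσ0 := hp.σ_pos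
  have hτ0 := hp.τ_pos
  have h7 := mul_le_mul_of_nonneg_left hN (by positivity : 0 ≤ 2 * (1 - θ) / θ)
  have h8 := mul_le_mul_of_nonneg_right hgeom (by positivity : 0 ≤ (τ + 8 * σ) * δ ^ 2)
  have hconst : ∫ _ : Ω, e ^ 2 / 6 ∂Pb = e ^ 2 / 6 := by simp
  rw [hconst] at hrhs
  have h9 := hmono.trans_eq hrhs
  nlinarith [sq_nonneg e]

end Accuracy

/-! ### Independence of the samples -/

section Independence

/-- If `X` is independent of `(A, B)` and `A` of `B`, then the three are mutually independent. -/
theorem indepFun_prodMk_of_indepFun {Ω α β γ : Type*} [MeasurableSpace Ω] [MeasurableSpace α]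
    [MeasurableSpace β] [MeasurableSpace γ] {Pb : Measure Ω} [IsProbabilityMeasure Pb]
    {X : Ω → α} {A : Ω → β} {B : Ω → γ} (hX : Measurable X) (hA : Measurable A) (hB : Measurable B)
    (h : IndepFun X (fun ω => (A ω, B ω)) Pb) (hAB : IndepFun A B Pb) :
    IndepFun (fun ω => (X ω, A ω)) B Pb := by
  have := Measure.isProbabilityMeasure_map (μ := Pb) hX.aemeasurable
  have := Measure.isProbabilityMeasure_map (μ := Pb) hA.aemeasurable
  have := Measure.isProbabilityMeasure_map (μ := Pb) hB.aemeasurable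
  have hXA : IndepFun X A Pb := h.comp (φ := id) (ψ := Prod.fst) measurable_id measurable_fst
  rw [indepFun_iff_map_prod_eq_prod_map_map (by fun_prop) (by fun_prop)] at h hAB hXA ⊢
  have e : (fun ω => ((X ω, A ω), B ω))
      = MeasurableEquiv.prodAssoc.symm ∘ fun ω => (X ω, (A ω, B ω)) := rfl
  rw [e, ← Measure.map_map (MeasurableEquiv.measurable _) (by fun_prop), h, hAB, hXA,
    ← Measure.prodAssoc_prod, Measure.map_map (MeasurableEquiv.measurable _)
      (MeasurableEquiv.measurable _)]
  simp

/-- If `k'` is uniform on `{0, …, K - 1}` and independent of the family `g`, then the mean of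
`g k'` is the average of the means of `g 0, …, g (K - 1)`. -/
theorem integral_uniform_index {Ω : Type*} {𝓖 : MeasurableSpace Ω} [m₀ : MeasurableSpace Ω]
    {Pb : Measure Ω} [IsProbabilityMeasure Pb] {K : ℕ} (hK : 0 < K) {k' : Ω → ℕ}
    (hk : Measurable k') (hlaw : ∀ j < K, Pb (k' ⁻¹' {j}) = (K : ℝ≥0∞)⁻¹) (h𝓖 : 𝓖 ≤ m₀)
    (hind : Indep (MeasurableSpace.comap k' inferInstance) 𝓖 Pb) {g : ℕ → Ω → ℝ}
    (hg : ∀ j, Measurable[𝓖] (g j)) (hint : ∀ j < K, Integrable (g j) Pb) :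
    Integrable (fun ω => g (k' ω) ω) Pb ∧
      ∫ ω, g (k' ω) ω ∂Pb = (K : ℝ)⁻¹ * ∑ j ∈ Finset.range K, ∫ ω, g j ω ∂Pb := by
  have hA : ∀ j, MeasurableSet (k' ⁻¹' {j}) := fun j => hk (measurableSet_singleton j)
  have hlt : ∀ᵐ ω ∂Pb, k' ω < K := by
    have hU : Pb (⋃ j ∈ Finset.range K, k' ⁻¹' {j}) = 1 := by
      rw [measure_biUnion_finset (fun i _ j _ hij => Disjoint.preimage _ (by simpa using hij))
        fun j _ => hA j, Finset.sum_congr rfl fun j hj => hlaw j (Finset.mem_range.1 hj)]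
      simp only [Finset.sum_const, Finset.card_range, nsmul_eq_mul]
      exact ENNReal.mul_inv_cancel (by exact_mod_cast hK.ne') (ENNReal.natCast_ne_top K)
    have hU' := (prob_compl_eq_zero_iff
      (Finset.measurableSet_biUnion (Finset.range K) fun j _ => hA j)).2 hU
    filter_upwards [measure_eq_zero_iff_ae_notMem.1 hU'] with ω hω
    simpa using hω
  have heq : (fun ω => g (k' ω) ω)
      =ᵐ[Pb] fun ω => ∑ j ∈ Finset.range K, (k' ⁻¹' {j}).indicator (g j) ω := by
    filter_upwards [hlt] with ω hω
    rw [Finset.sum_eq_single_of_mem (k' ω) (Finset.mem_range.2 hω)]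
    · simp
    · intro j _ hj
      exact Set.indicator_of_notMem (by simpa using hj.symm) _
  have hi : ∀ j ∈ Finset.range K, Integrable ((k' ⁻¹' {j}).indicator (g j)) Pb := fun j hj =>
    (hint j (Finset.mem_range.1 hj)).indicator (hA j)
  refine ⟨(integrable_finsetSum _ hi).congr heq.symm, ?_⟩
  rw [integral_congr_ae heq, integral_finsetSum _ hi, Finset.mul_sum]
  refine Finset.sum_congr rfl fun j hj => ?_
  rw [integral_indicator (hA j)]
  have h := Indep.setIntegral_eq_mul (P := Pb) (X := g j) (f := id) (A := k' ⁻¹' {j})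
    hk.comap_le (indep_of_indep_of_le_right hind (hg j).comap_le)
    ((hg j).mono h𝓖 le_rfl).aemeasurable ⟨{j}, measurableSet_singleton j, rfl⟩
    aestronglyMeasurable_id
  simp only [id] at h
  rw [h, measureReal_def, hlaw j (Finset.mem_range.1 hj)]
  simp

variable {n m : ℕ} {W Ω : Type*} [MeasurableSpace W] {x₀ : Ω → Vec n} {y₀ : Ω → Vec m}
  {wx wy : ℕ → ℕ → Ω → W}

/-- The `σ`-algebra of the initial point and of all samples but the one of index `i`. -/
abbrev otherSamples (x₀ : Ω → Vec n) (y₀ : Ω → Vec m) (wx wy : ℕ → ℕ → Ω → W)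
    (i : (ℕ × ℕ) ⊕ (ℕ × ℕ)) : MeasurableSpace Ω :=
  MeasurableSpace.comap (fun ω => ((x₀ ω, y₀ ω), fun j : {j // j ≠ i} => allSamples wx wy j ω))
    inferInstance

theorem measurable_otherSamples_init (i : (ℕ × ℕ) ⊕ (ℕ × ℕ)) :
    Measurable[otherSamples x₀ y₀ wx wy i] (fun ω => (x₀ ω, y₀ ω)) :=
  measurable_fst.comp (comap_measurable _)

theorem measurable_otherSamples_sample {i j : (ℕ × ℕ) ⊕ (ℕ × ℕ)} (h : j ≠ i) :
    Measurable[otherSamples x₀ y₀ wx wy i] (allSamples wx wy j) :=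
  (measurable_pi_apply (X := fun _ => W) (⟨j, h⟩ : {j // j ≠ i})).comp (measurable_snd.comp
    (comap_measurable fun ω => ((x₀ ω, y₀ ω), fun j : {j // j ≠ i} => allSamples wx wy j ω)))

/-- The `σ`-algebra of the initial point and of all samples. -/
abbrev inputSamples (x₀ : Ω → Vec n) (y₀ : Ω → Vec m) (wx wy : ℕ → ℕ → Ω → W) : MeasurableSpace Ω :=
  MeasurableSpace.comap (fun ω => ((x₀ ω, y₀ ω), fun j => allSamples wx wy j ω)) inferInstance

theorem measurable_inputSamples_init :
    Measurable[inputSamples x₀ y₀ wx wy] (fun ω => (x₀ ω, y₀ ω)) :=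
  measurable_fst.comp (comap_measurable _)

theorem measurable_inputSamples_sample (j : (ℕ × ℕ) ⊕ (ℕ × ℕ)) :
    Measurable[inputSamples x₀ y₀ wx wy] (allSamples wx wy j) :=
  (measurable_pi_apply (X := fun _ => W) j).comp (measurable_snd.comp
    (comap_measurable fun ω => ((x₀ ω, y₀ ω), fun j => allSamples wx wy j ω)))

variable [m₀ : MeasurableSpace Ω] {Pb : Measure Ω} {pr : Problem n m} {μ : Measure W} {K : ℕ}
  {k' : Ω → ℕ}

theorem IsRandomInput.isFreshSample [IsProbabilityMeasure Pb]
    (hin : IsRandomInput Pb pr μ K x₀ y₀ wx wy k') (i : (ℕ × ℕ) ⊕ (ℕ × ℕ)) :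
    IsFreshSample (otherSamples x₀ y₀ wx wy i) Pb μ (allSamples wx wy i) := by
  have hA : Measurable fun ω => fun j : {j // j ≠ i} => allSamples wx wy j ω :=
    measurable_pi_lambda _ fun j => hin.measurable_sample j
  have hX : Measurable fun ω => (x₀ ω, y₀ ω) := hin.measurable_x₀.prodMk hin.measurable_y₀
  refine ⟨(hX.prodMk hA).comap_le, hin.measurable_sample i, hin.law_sample i, ?_⟩
  have hAB : IndepFun (fun ω => fun j : {j // j ≠ i} => allSamples wx wy j ω)
      (allSamples wx wy i) Pb := by
    have h1 := indep_iSup_of_disjoint (fun j => (hin.measurable_sample j).comap_le)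
      ((iIndepFun_iff_iIndep _ _ _).1 hin.indep_samples)
      (S := {j | j ≠ i}) (T := {i}) (by simp)
    refine indep_of_indep_of_le_left (indep_of_indep_of_le_right h1 (by simp)) ?_
    rw [MeasurableSpace.pi, MeasurableSpace.comap_iSup]
    refine iSup_le fun j => ?_
    rw [MeasurableSpace.comap_comp]
    exact le_iSup₂_of_le j.1 j.2 le_rfl
  exact indepFun_prodMk_of_indepFun hX hA (hin.measurable_sample i)
    (hin.indep_init.comp (φ := id)
      (ψ := fun p : ((ℕ × ℕ) ⊕ (ℕ × ℕ) → W) × ℕ => ((fun j : {j // j ≠ i} => p.1 j), p.1 i))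
      measurable_id (by fun_prop)) hAB

theorem IsRandomInput.inputSamples_le (hin : IsRandomInput Pb pr μ K x₀ y₀ wx wy k') :
    inputSamples x₀ y₀ wx wy ≤ m₀ :=
  ((hin.measurable_x₀.prodMk hin.measurable_y₀).prodMk
    (measurable_pi_lambda _ hin.measurable_sample)).comap_le

theorem IsRandomInput.indep_index [IsProbabilityMeasure Pb]
    (hin : IsRandomInput Pb pr μ K x₀ y₀ wx wy k') :
    Indep (MeasurableSpace.comap k' inferInstance) (inputSamples x₀ y₀ wx wy) Pb :=
  (indepFun_prodMk_of_indepFun (hin.measurable_x₀.prodMk hin.measurable_y₀)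
    (measurable_pi_lambda _ hin.measurable_sample) hin.measurable_index hin.indep_init
    hin.indep_samples_index).symm

end Independence

/-! ### The iterates of the proximal point method -/

section Outer

variable {n m : ℕ} {W : Type*} {pr : Problem n m} {G : Oracle n m W} {L δ ε e : ℝ}

theorem outerRun_succ (x₀ : Vec n) (y₀ : Vec m) (wx wy : ℕ → ℕ → W) (k : ℕ) :
    let M := L + max (2 * L) (ε / (2 * pr.Dq))
    let b := ε / (2 * pr.Dq)
    let s := outerRun pr G L δ ε e x₀ y₀ wx wy k
    let r := sapdPath pr G L ε (sapdTau M L b δ e) (sapdSigma M L b δ e) (sapdTheta M L b δ e)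
      (s.x, y₀) (s.x, s.y) (wx k) (wy k) (sapdT M L b δ e pr.Dp pr.Dq)
    outerRun pr G L δ ε e x₀ y₀ wx wy (k + 1)
      = ⟨r.x, r.y, s.xCalls + r.xCalls, s.yCalls + r.yCalls⟩ := rfl

theorem three_mul_le_subproblem_smoothness {b : ℝ} : 3 * L ≤ L + max (2 * L) b := by
  have := le_max_left (2 * L) b
  linarith

theorem outerRun_mem (hpr : pr.Admissible L) (hL : 0 < L) (hb : 0 < ε / (2 * pr.Dq)) (hδ : 0 < δ)
    (he : 0 < e) {x₀ : Vec n} {y₀ : Vec m} (wx wy : ℕ → ℕ → W) (hx : x₀ ∈ pr.P) (hy : y₀ ∈ pr.Q)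
    (k : ℕ) : (outerRun pr G L δ ε e x₀ y₀ wx wy k).x ∈ pr.P ∧
      (outerRun pr G L δ ε e x₀ y₀ wx wy k).y ∈ pr.Q := by
  induction k with
  | zero => exact ⟨hx, hy⟩
  | succ k ih =>
    have hp := stepParams hL hb
      (three_mul_le_subproblem_smoothness (L := L) (b := ε / (2 * pr.Dq))) hδ he
    rw [outerRun_succ]
    exact sapdPath_mem (G := G) (ε := ε) hpr hp.τ_pos hp.σ_pos ih.1 ih.2 _

theorem outerRun_calls (x₀ : Vec n) (y₀ : Vec m) (wx wy : ℕ → ℕ → W) (k : ℕ) :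
    let T := sapdT (L + max (2 * L) (ε / (2 * pr.Dq))) L (ε / (2 * pr.Dq)) δ e pr.Dp pr.Dq
    (outerRun pr G L δ ε e x₀ y₀ wx wy k).xCalls = k * T ∧
      (outerRun pr G L δ ε e x₀ y₀ wx wy k).yCalls = k * T := by
  intro T
  induction k with
  | zero => simp [outerRun]
  | succ k ih =>
    rw [outerRun_succ]
    simp only [sapdPath_calls, ih, add_mul, one_mul]
    exact ⟨rfl, rfl⟩

variable [MeasurableSpace W] {Ω : Type*} {μ : Measure W} {x₀ : Ω → Vec n} {y₀ : Ω → Vec m}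
  {wx wy : ℕ → ℕ → Ω → W}

theorem measurable_outerRun [MeasurableSpace Ω] (hpr : pr.Admissible L) (hG : G.Admissible pr μ δ)
    (hL : 0 < L) (hb : 0 < ε / (2 * pr.Dq)) (hδ : 0 < δ) (he : 0 < e)
    (hmem : ∀ ω, x₀ ω ∈ pr.P ∧ y₀ ω ∈ pr.Q) (h0 : Measurable fun ω => (x₀ ω, y₀ ω)) {k : ℕ}
    (hx : ∀ i < k, ∀ j, Measurable (wx i j)) (hy : ∀ i < k, ∀ j, Measurable (wy i j)) :
    Measurable (fun ω => (outerRun pr G L δ ε e (x₀ ω) (y₀ ω) (fun i j => wx i j ω)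
      (fun i j => wy i j ω) k).x) ∧
    Measurable (fun ω => (outerRun pr G L δ ε e (x₀ ω) (y₀ ω) (fun i j => wx i j ω)
      (fun i j => wy i j ω) k).y) := by
  induction k with
  | zero => exact ⟨h0.fst, h0.snd⟩
  | succ k ih =>
    obtain ⟨hX, hY⟩ := ih (fun i hi => hx i (by omega)) fun i hi => hy i (by omega)
    have hp := stepParams hL hb
      (three_mul_le_subproblem_smoothness (L := L) (b := ε / (2 * pr.Dq))) hδ he
    have h := (measurable_sapdPath (ε := ε)
      (θ := sapdTheta (L + max (2 * L) (ε / (2 * pr.Dq))) L (ε / (2 * pr.Dq)) δ e)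
      (t := sapdT (L + max (2 * L) (ε / (2 * pr.Dq))) L (ε / (2 * pr.Dq)) δ e pr.Dp pr.Dq)
      (ux := wx k) (uy := wy k) hpr hG hp.τ_pos hp.σ_pos (hX.prodMk h0.snd) (hX.prodMk hY)
      fun ω => outerRun_mem hpr hL hb hδ he _ _ (hmem ω).1 (hmem ω).2 k).1
      (fun j _ => hx k k.lt_succ_self j) fun j _ => hy k k.lt_succ_self j
    exact ⟨h.1, h.2.1⟩

/-- In main iteration `k` each sample is fresh with respect to the `σ`-algebra of the initial point
and all other samples, since only these enter the current iterate. -/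
theorem IsRandomInput.isFreshSequence [MeasurableSpace Ω] {Pb : Measure Ω}
    [IsProbabilityMeasure Pb] {K : ℕ} {k' : Ω → ℕ}
    (hin : IsRandomInput Pb pr μ K x₀ y₀ wx wy k') (hpr : pr.Admissible L)
    (hG : G.Admissible pr μ δ) (hL : 0 < L) (hb : 0 < ε / (2 * pr.Dq)) (hδ : 0 < δ) (he : 0 < e)
    (k : ℕ) :
    IsFreshSequence Pb μ (fun t => otherSamples x₀ y₀ wx wy (Sum.inl (k, t)))
      (fun t => otherSamples x₀ y₀ wx wy (Sum.inr (k, t)))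
      (fun ω => ((outerRun pr G L δ ε e (x₀ ω) (y₀ ω) (fun i j => wx i j ω)
        (fun i j => wy i j ω) k).x, y₀ ω))
      (fun ω => ((outerRun pr G L δ ε e (x₀ ω) (y₀ ω) (fun i j => wx i j ω)
        (fun i j => wy i j ω) k).x, (outerRun pr G L δ ε e (x₀ ω) (y₀ ω) (fun i j => wx i j ω)
        (fun i j => wy i j ω) k).y)) (wx k) (wy k) := by
  have hsx : ∀ i a t, (Sum.inl (a, t) : (ℕ × ℕ) ⊕ (ℕ × ℕ)) ≠ i →
      Measurable[otherSamples x₀ y₀ wx wy i] (wx a t) := fun i a t h =>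
    measurable_otherSamples_sample h
  have hsy : ∀ i a t, (Sum.inr (a, t) : (ℕ × ℕ) ⊕ (ℕ × ℕ)) ≠ i →
      Measurable[otherSamples x₀ y₀ wx wy i] (wy a t) := fun i a t h =>
    measurable_otherSamples_sample h
  have hO : ∀ i : (ℕ × ℕ) ⊕ (ℕ × ℕ), (∀ a < k, ∀ t, Sum.inl (a, t) ≠ i) →
      (∀ a < k, ∀ t, Sum.inr (a, t) ≠ i) → _ := fun i h1 h2 =>
    @measurable_outerRun n m W pr G L δ ε e _ Ω μ x₀ y₀ wx wy (otherSamples x₀ y₀ wx wy i) hpr hG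
      hL hb hδ he hin.mem (measurable_otherSamples_init i) k
      (fun a ha t => hsx i a t (h1 a ha t)) fun a ha t => hsy i a t (h2 a ha t)
  have hOx := fun t => hO (Sum.inl (k, t)) (fun a ha t => by simp [ha.ne]) (by simp)
  have hOy := fun t => hO (Sum.inr (k, t)) (by simp) (fun a ha t => by simp [ha.ne])
  exact
    { fresh_y := fun t => hin.isFreshSample (Sum.inr (k, t))
      center_y := fun t => (hOy t).1.prodMk (measurable_otherSamples_init _).snd
      start_y := fun t => (hOy t).1.prodMk (hOy t).2
      x_lt_y := fun t j _ => hsx _ k j (by simp)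
      y_lt_y := fun t j hj => hsy _ k j (by simp [hj.ne])
      fresh_x := fun t => hin.isFreshSample (Sum.inl (k, t))
      center_x := fun t => (hOx t).1.prodMk (measurable_otherSamples_init _).snd
      start_x := fun t => (hOx t).1.prodMk (hOx t).2
      x_lt_x := fun t j hj => hsx _ k j (by simp [hj.ne])
      y_le_x := fun t j _ => hsy _ k j (by simp) }

end Outer

/-! ### Inexact proximal point sequences -/

section Prox

variable {n m : ℕ} {Ω : Type*} {𝓖 : MeasurableSpace Ω} [m₀ : MeasurableSpace Ω] {Pb : Measure Ω}
  {pr : Problem n m} {L b e : ℝ} {X : ℕ → Ω → Vec n} {Y : ℕ → Ω → Vec m}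

/-- The random points `(X k, Y k)` of `dom p × dom q` are measurable with respect to `𝓖`, and
`(X (k + 1), Y (k + 1))` approximates the saddle point of the subproblem centred at `(X k, Y 0)`
with mean weighted squared error at most `e²`. -/
structure IsInexactProx (𝓖 : MeasurableSpace Ω) [m₀ : MeasurableSpace Ω] (Pb : Measure Ω)
    (pr : Problem n m) (L b e : ℝ) (X : ℕ → Ω → Vec n) (Y : ℕ → Ω → Vec m) : Prop where
  le : 𝓖 ≤ m₀
  measurable_x : ∀ k, Measurable[𝓖] (X k)
  measurable_y : ∀ k, Measurable[𝓖] (Y k)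
  mem_x : ∀ k ω, X k ω ∈ pr.P
  mem_y : ∀ k ω, Y k ω ∈ pr.Q
  accuracy : ∀ k,
    ∫ ω, saddleDist pr L b (X k ω, Y 0 ω) (X (k + 1) ω) (Y (k + 1) ω) ∂Pb ≤ e ^ 2

namespace IsInexactProx

theorem measurable_saddle (h : IsInexactProx 𝓖 Pb pr L b e X Y) (hpr : pr.Admissible L)
    (hL : 0 < L) (hb : 0 < b) (k : ℕ) :
    Measurable[𝓖] fun ω => pr.saddle L b (X k ω, Y 0 ω) :=
  (hpr.continuous_saddle hL hb).measurable.comp ((h.measurable_x k).prodMk (h.measurable_y 0))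

theorem measurable_saddleDist (h : IsInexactProx 𝓖 Pb pr L b e X Y) (hpr : pr.Admissible L)
    (hL : 0 < L) (hb : 0 < b) (k : ℕ) :
    Measurable[𝓖] fun ω => saddleDist pr L b (X k ω, Y 0 ω) (X (k + 1) ω) (Y (k + 1) ω) :=
  @CompositeMinimax.measurable_saddleDist n m Ω 𝓖 pr L _ b hpr hL hb
    ((h.measurable_x k).prodMk (h.measurable_y 0)) _ _ (h.measurable_x _) (h.measurable_y _)

theorem measurable_step (h : IsInexactProx 𝓖 Pb pr L b e X Y) (hpr : pr.Admissible L)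
    (hL : 0 < L) (hb : 0 < b) (k : ℕ) :
    Measurable[𝓖] fun ω => L * ‖(pr.saddle L b (X k ω, Y 0 ω)).1 - X k ω‖ ^ 2 := by
  have hmeas : ∀ (𝓕 : MeasurableSpace Ω) {f : Ω → Vec n × Vec m} {g : Ω → Vec n},
      Measurable[𝓕] f → Measurable[𝓕] g → Measurable[𝓕] fun ω => L * ‖(f ω).1 - g ω‖ ^ 2 :=
    fun 𝓕 _ _ hf hg => by
      let _ := 𝓕
      exact ((hf.fst.sub hg).norm.pow_const 2).const_mul L
  exact hmeas 𝓖 (h.measurable_saddle hpr hL hb k) (h.measurable_x k)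

theorem measurable_maxH_saddle (h : IsInexactProx 𝓖 Pb pr L b e X Y) (hpr : pr.Admissible L)
    (hL : 0 < L) (hb : 0 < b) (k : ℕ) :
    Measurable[𝓖] fun ω => pr.maxH (pr.saddle L b (X k ω, Y 0 ω)).1 :=
  @Problem.Admissible.measurable_maxH_comp n m pr L hpr Ω 𝓖 _
    (h.measurable_saddle hpr hL hb k).fst fun _ => hpr.saddle_mem_left hL hb _

theorem integrable_saddleDist [IsProbabilityMeasure Pb] (h : IsInexactProx 𝓖 Pb pr L b e X Y)
    (hpr : pr.Admissible L) (hL : 0 < L) (hb : 0 < b) (k : ℕ) :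
    Integrable (fun ω => saddleDist pr L b (X k ω, Y 0 ω) (X (k + 1) ω) (Y (k + 1) ω)) Pb :=
  CompositeMinimax.integrable_saddleDist hpr hL hb
    (((h.measurable_x k).prodMk (h.measurable_y 0)).mono h.le le_rfl)
    ((h.measurable_x _).mono h.le le_rfl) ((h.measurable_y _).mono h.le le_rfl) (h.mem_x _)
    (h.mem_y _)

theorem integrable_step [IsProbabilityMeasure Pb] (h : IsInexactProx 𝓖 Pb pr L b e X Y)
    (hpr : pr.Admissible L) (hL : 0 < L) (hb : 0 < b) (k : ℕ) :
    Integrable (fun ω => L * ‖(pr.saddle L b (X k ω, Y 0 ω)).1 - X k ω‖ ^ 2) Pb := by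
  refine Integrable.of_bound
    ((h.measurable_step hpr hL hb k).mono h.le le_rfl).aestronglyMeasurable (L * pr.Dp ^ 2)
    (ae_of_all _ fun ω => ?_)
  rw [Real.norm_of_nonneg (by positivity)]
  gcongr
  exact hpr.norm_sub_le_Dp (hpr.saddle_mem_left hL hb _) (h.mem_x k ω)

/-- The descent of the saddle values along the sequence, up to the errors of the approximation. -/
theorem saddleValue_add_sum_le (h : IsInexactProx 𝓖 Pb pr L b e X Y) (hpr : pr.Admissible L)
    (hL : 0 < L) (hb : 0 < b) (k : ℕ) (ω : Ω) :
    pr.saddleValue L b (X k ω, Y 0 ω)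
        + ∑ j ∈ Finset.range k, L * ‖(pr.saddle L b (X j ω, Y 0 ω)).1 - X j ω‖ ^ 2
      ≤ pr.maxH (X 0 ω) + ∑ j ∈ Finset.range k,
        saddleDist pr L b (X j ω, Y 0 ω) (X (j + 1) ω) (Y (j + 1) ω) := by
  induction k with
  | zero => simpa using hpr.saddleValue_le_maxH hL hb (h.mem_x 0 ω) (Y 0 ω)
  | succ k ih =>
    have h1 := hpr.saddleValue_step hL hb (X k ω) (X (k + 1) ω) (Y 0 ω)
    have h2 : L * ‖(pr.saddle L b (X k ω, Y 0 ω)).1 - X (k + 1) ω‖ ^ 2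
        ≤ saddleDist pr L b (X k ω, Y 0 ω) (X (k + 1) ω) (Y (k + 1) ω) := by
      rw [norm_sub_rev]
      exact le_add_of_nonneg_right (by positivity)
    rw [Finset.sum_range_succ, Finset.sum_range_succ]
    linarith

theorem sum_step_le (h : IsInexactProx 𝓖 Pb pr L b e X Y) (hpr : pr.Admissible L)
    (hL : 0 < L) (hb : 0 < b) (k : ℕ) (ω : Ω) :
    ∑ j ∈ Finset.range k, L * ‖(pr.saddle L b (X j ω, Y 0 ω)).1 - X j ω‖ ^ 2
      ≤ pr.maxH (X 0 ω) - pr.Hstar + b / 2 * pr.Dq ^ 2 + ∑ j ∈ Finset.range k,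
        saddleDist pr L b (X j ω, Y 0 ω) (X (j + 1) ω) (Y (j + 1) ω) := by
  have h1 := h.saddleValue_add_sum_le hpr hL hb k ω
  have h2 := hpr.maxH_saddle_le hL hb (X k ω) (h.mem_y 0 ω)
  have h3 := hpr.Hstar_le_maxH (hpr.saddle_mem_left hL hb (X k ω, Y 0 ω))
  have h4 : 0 ≤ L * ‖(pr.saddle L b (X k ω, Y 0 ω)).1 - X k ω‖ ^ 2 := by positivity
  linarith

theorem maxH_saddle_le (h : IsInexactProx 𝓖 Pb pr L b e X Y) (hpr : pr.Admissible L)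
    (hL : 0 < L) (hb : 0 < b) (k : ℕ) (ω : Ω) :
    pr.maxH (pr.saddle L b (X k ω, Y 0 ω)).1
      ≤ pr.maxH (X 0 ω) + b / 2 * pr.Dq ^ 2 + ∑ j ∈ Finset.range k,
        saddleDist pr L b (X j ω, Y 0 ω) (X (j + 1) ω) (Y (j + 1) ω) := by
  have h1 := h.saddleValue_add_sum_le hpr hL hb k ω
  have h2 := hpr.maxH_saddle_le hL hb (X k ω) (h.mem_y 0 ω)
  have h3 : 0 ≤ ∑ j ∈ Finset.range k, L * ‖(pr.saddle L b (X j ω, Y 0 ω)).1 - X j ω‖ ^ 2 :=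
    Finset.sum_nonneg fun j _ => by positivity
  have h4 : 0 ≤ L * ‖(pr.saddle L b (X k ω, Y 0 ω)).1 - X k ω‖ ^ 2 := by positivity
  linarith

variable [IsProbabilityMeasure Pb]

theorem integral_sum_saddleDist_le (h : IsInexactProx 𝓖 Pb pr L b e X Y) (hpr : pr.Admissible L)
    (hL : 0 < L) (hb : 0 < b) (k : ℕ) :
    ∫ ω, ∑ j ∈ Finset.range k,
      saddleDist pr L b (X j ω, Y 0 ω) (X (j + 1) ω) (Y (j + 1) ω) ∂Pb ≤ k * e ^ 2 := by
  rw [integral_finsetSum _ fun j _ => h.integrable_saddleDist hpr hL hb j]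
  simpa using Finset.sum_le_card_nsmul (Finset.range k) _ _ fun j _ => h.accuracy j

theorem sum_integral_step_le (h : IsInexactProx 𝓖 Pb pr L b e X Y) (hpr : pr.Admissible L)
    (hL : 0 < L) (hb : 0 < b) (hint : Integrable (fun ω => pr.maxH (X 0 ω)) Pb) (k : ℕ) :
    ∑ j ∈ Finset.range k, ∫ ω, L * ‖(pr.saddle L b (X j ω, Y 0 ω)).1 - X j ω‖ ^ 2 ∂Pb
      ≤ ∫ ω, pr.maxH (X 0 ω) ∂Pb - pr.Hstar + b / 2 * pr.Dq ^ 2 + k * e ^ 2 := by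
  have hS := integrable_finsetSum (Finset.range k) fun j _ => h.integrable_saddleDist hpr hL hb j
  have h1 := integral_mono
    (integrable_finsetSum (Finset.range k) fun j _ => h.integrable_step hpr hL hb j)
    (((hint.sub (integrable_const pr.Hstar)).add (integrable_const (b / 2 * pr.Dq ^ 2))).add hS)
    (h.sum_step_le hpr hL hb k)
  rw [integral_finsetSum _ fun j _ => h.integrable_step hpr hL hb j, integral_add' (by
      exact (hint.sub (integrable_const pr.Hstar)).add (integrable_const (b / 2 * pr.Dq ^ 2))) hS,
    integral_add' (hint.sub (integrable_const _)) (integrable_const _),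
    integral_sub' hint (integrable_const _)] at h1
  have h2 := h.integral_sum_saddleDist_le hpr hL hb k
  simp only [integral_const, probReal_univ, one_smul] at h1
  linarith

theorem integrable_maxH_saddle (h : IsInexactProx 𝓖 Pb pr L b e X Y) (hpr : pr.Admissible L)
    (hL : 0 < L) (hb : 0 < b) (hint : Integrable (fun ω => pr.maxH (X 0 ω)) Pb) (k : ℕ) :
    Integrable (fun ω => pr.maxH (pr.saddle L b (X k ω, Y 0 ω)).1) Pb ∧
      ∫ ω, pr.maxH (pr.saddle L b (X k ω, Y 0 ω)).1 ∂Pb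
        ≤ ∫ ω, pr.maxH (X 0 ω) ∂Pb + b / 2 * pr.Dq ^ 2 + k * e ^ 2 := by
  have hS := integrable_finsetSum (Finset.range k) fun j _ => h.integrable_saddleDist hpr hL hb j
  have hU := (hint.add (integrable_const (b / 2 * pr.Dq ^ 2))).add hS
  have hI : Integrable (fun ω => pr.maxH (pr.saddle L b (X k ω, Y 0 ω)).1) Pb :=
    integrable_of_le_of_le
      ((h.measurable_maxH_saddle hpr hL hb k).mono h.le le_rfl).aestronglyMeasurable
      (ae_of_all _ fun ω => hpr.Hstar_le_maxH (hpr.saddle_mem_left hL hb (X k ω, Y 0 ω)))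
      (ae_of_all _ (h.maxH_saddle_le hpr hL hb k)) (integrable_const pr.Hstar) hU
  refine ⟨hI, ?_⟩
  have h1 := integral_mono hI hU (h.maxH_saddle_le hpr hL hb k)
  rw [integral_add' (hint.add (integrable_const _)) hS,
    integral_add' hint (integrable_const _)] at h1
  have h2 := h.integral_sum_saddleDist_le hpr hL hb k
  simp only [integral_const, probReal_univ, one_smul] at h1
  linarith

end IsInexactProx

/-- The mean of `f` is at most its root mean square. -/
theorem integral_le_of_sq_le [IsProbabilityMeasure Pb] {f g : Ω → ℝ} {c : ℝ} (hc : 0 < c)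
    (hf : Measurable f) (h0 : ∀ ω, 0 ≤ f ω) (hg : Integrable g Pb) (hfg : ∀ ω, f ω ^ 2 ≤ g ω)
    (hgc : ∫ ω, g ω ∂Pb ≤ c ^ 2) : Integrable f Pb ∧ ∫ ω, f ω ∂Pb ≤ c := by
  have hU : Integrable (fun ω => (2 * c)⁻¹ * g ω + c / 2) Pb :=
    (hg.const_mul _).add (integrable_const _)
  have hle : ∀ ω, f ω ≤ (2 * c)⁻¹ * g ω + c / 2 := fun ω => by
    have h1 : (2 * c)⁻¹ * f ω ^ 2 ≤ (2 * c)⁻¹ * g ω := by gcongr; exact hfg ω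
    have h2 : 0 ≤ (2 * c)⁻¹ * (f ω - c) ^ 2 := by positivity
    have h3 : (2 * c)⁻¹ * (f ω - c) ^ 2 = (2 * c)⁻¹ * f ω ^ 2 - f ω + c / 2 := by field_simp; ring
    linarith
  have hI : Integrable f Pb := integrable_of_le_of_le hf.aestronglyMeasurable (ae_of_all _ h0)
    (ae_of_all _ hle) (integrable_const 0) hU
  refine ⟨hI, (integral_mono hI hU hle).trans ?_⟩
  rw [integral_add (hg.const_mul _) (integrable_const _), integral_const_mul]
  simp only [integral_const, probReal_univ, one_smul]
  have h1 : (2 * c)⁻¹ * ∫ ω, g ω ∂Pb ≤ (2 * c)⁻¹ * c ^ 2 := by gcongr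
  have h2 : (2 * c)⁻¹ * c ^ 2 = c / 2 := by field_simp
  linarith

theorem ExpectationLE.of_integral_le {f : Ω → ℝ≥0∞} {g : Ω → ℝ} {c : ℝ} (hg : Measurable g)
    (hg0 : ∀ ω, 0 ≤ g ω) (hint : Integrable g Pb) (hfg : ∀ ω, f ω ≤ ENNReal.ofReal (g ω))
    (hc : ∫ ω, g ω ∂Pb ≤ c) : ExpectationLE Pb f c := by
  refine ⟨fun ω => ENNReal.ofReal (g ω), hg.ennreal_ofReal, hfg, ?_⟩
  rw [← ofReal_integral_eq_lintegral_ofReal hint (ae_of_all _ hg0)]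
  exact ENNReal.ofReal_le_ofReal hc

theorem StationaryInExpectation.mono {ρ ρ' : ℝ} (hρ : ρ ≤ ρ') {x : Ω → Vec n} {y : Ω → Vec m}
    (h : StationaryInExpectation Pb pr ρ x y) : StationaryInExpectation Pb pr ρ' x y := by
  obtain ⟨hm, ⟨g, hg, hfg, hi⟩, ⟨g', hg', hfg', hi'⟩⟩ := h
  exact ⟨hm, ⟨g, hg, hfg, hi.trans (ENNReal.ofReal_le_ofReal hρ)⟩,
    ⟨g', hg', hfg', hi'.trans (ENNReal.ofReal_le_ofReal hρ)⟩⟩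

theorem measurable_comp_index {E : Type*} [MeasurableSpace E] {f : ℕ → Ω → E} {k' : Ω → ℕ}
    (hk : Measurable k') (hf : ∀ j, Measurable (f j)) : Measurable fun ω => f (k' ω) ω :=
  (measurable_from_prod_countable_right (f := fun p : ℕ × Ω => f p.1 p.2) hf).comp
    (hk.prodMk measurable_id)

variable [IsProbabilityMeasure Pb]

/-- The saddle point of the subproblem centred at a uniformly chosen iterate is stationary in
expectation, and is approximated by the iterate that follows. -/
theorem IsInexactProx.exists_stationary {ε : ℝ} (h : IsInexactProx 𝓖 Pb pr L b e X Y)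
    (hpr : pr.Admissible L) (hL : 0 < L) (hb : 0 < b) (he : 0 < e) (hbD : b * pr.Dq = ε / 2)
    (hint : Integrable (fun ω => pr.maxH (X 0 ω)) Pb) {K : ℕ}
    (hK : K = outerIterations pr ε e (∫ ω, pr.maxH (X 0 ω) ∂Pb)) (hε : 0 < ε) (hDq : 0 < pr.Dq)
    {k' : Ω → ℕ} (hk : Measurable k') (hlaw : ∀ j < K, Pb (k' ⁻¹' {j}) = (K : ℝ≥0∞)⁻¹)
    (hind : Indep (MeasurableSpace.comap k' inferInstance) 𝓖 Pb) :
    ∃ (x' : Ω → Vec n) (y' : Ω → Vec m), Measurable x' ∧ Measurable y' ∧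
      NearInExpectation Pb (max (e / Real.sqrt L) (e / Real.sqrt b))
        (fun ω => X (k' ω + 1) ω) (fun ω => Y (k' ω + 1) ω) x' y' ∧
      StationaryInExpectation Pb pr (max (2 * Real.sqrt (2 * L) * e) (ε / 2)) x' y' ∧
      Integrable (fun ω => pr.maxH (x' ω)) Pb ∧
      ∫ ω, pr.maxH (x' ω) ∂Pb
        ≤ 2 * (∫ ω, pr.maxH (X 0 ω) ∂Pb) - pr.Hstar + ε * pr.Dq / 2 := by
  set V := ∫ ω, pr.maxH (X 0 ω) ∂Pb
  have hbD2 : b / 2 * pr.Dq ^ 2 = ε * pr.Dq / 4 := by linear_combination pr.Dq / 2 * hbD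
  have hV : pr.Hstar ≤ V := by
    have := integral_mono (integrable_const pr.Hstar) hint
      fun ω => hpr.Hstar_le_maxH (h.mem_x 0 ω)
    simpa using this
  have hA : 0 < V - pr.Hstar + ε * pr.Dq / 4 := by
    have : 0 < ε * pr.Dq / 4 := by positivity
    linarith
  have hKpos : 0 < K := by
    rw [hK, outerIterations, Nat.ceil_pos]; positivity
  have hK0 : (0 : ℝ) < K := by exact_mod_cast hKpos
  -- The two inequalities that define the ceiling `K`.
  have hKge : V - pr.Hstar + ε * pr.Dq / 4 ≤ K * e ^ 2 := by
    have := Nat.le_ceil ((V - pr.Hstar + ε * pr.Dq / 4) * (e ^ 2)⁻¹)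
    rw [← outerIterations, ← hK, ← div_eq_mul_inv, div_le_iff₀ (by positivity)] at this
    exact this
  have hKle : ((K : ℝ) - 1) * e ^ 2 ≤ V - pr.Hstar + ε * pr.Dq / 4 := by
    have := Nat.ceil_lt_add_one
      (by positivity : 0 ≤ (V - pr.Hstar + ε * pr.Dq / 4) * (e ^ 2)⁻¹)
    rw [← outerIterations, ← hK, ← sub_lt_iff_lt_add, ← div_eq_mul_inv,
      lt_div_iff₀ (by positivity)] at this
    exact this.le
  have hmean := fun {g : ℕ → Ω → ℝ} =>
    integral_uniform_index (g := g) hKpos hk hlaw h.le hind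
  obtain ⟨hSi, hSe⟩ := hmean (h.measurable_saddleDist hpr hL hb)
    fun j _ => h.integrable_saddleDist hpr hL hb j
  obtain ⟨hDi, hDe⟩ := hmean (h.measurable_step hpr hL hb)
    fun j _ => h.integrable_step hpr hL hb j
  obtain ⟨hMi, hMe⟩ := hmean (h.measurable_maxH_saddle hpr hL hb)
    fun j _ => (h.integrable_maxH_saddle hpr hL hb hint j).1
  have hS : ∫ ω, saddleDist pr L b (X (k' ω) ω, Y 0 ω) (X (k' ω + 1) ω) (Y (k' ω + 1) ω) ∂Pb
      ≤ e ^ 2 := by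
    rw [hSe, inv_mul_le_iff₀ hK0]
    simpa using Finset.sum_le_card_nsmul (Finset.range K) _ _ fun j _ => h.accuracy j
  have hD : ∫ ω, L * ‖(pr.saddle L b (X (k' ω) ω, Y 0 ω)).1 - X (k' ω) ω‖ ^ 2 ∂Pb
      ≤ 2 * e ^ 2 := by
    rw [hDe, inv_mul_le_iff₀ hK0]
    have := h.sum_integral_step_le hpr hL hb hint K
    linarith
  have hM : ∫ ω, pr.maxH (pr.saddle L b (X (k' ω) ω, Y 0 ω)).1 ∂Pb
      ≤ 2 * V - pr.Hstar + ε * pr.Dq / 2 := by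
    rw [hMe, inv_mul_le_iff₀ hK0]
    have h1 : ∀ j ∈ Finset.range K, ∫ ω, pr.maxH (pr.saddle L b (X j ω, Y 0 ω)).1 ∂Pb
        ≤ 2 * V - pr.Hstar + ε * pr.Dq / 2 := fun j hj => by
      have h2 := (h.integrable_maxH_saddle hpr hL hb hint j).2
      have h3 : (j : ℝ) * e ^ 2 ≤ (K - 1) * e ^ 2 := by
        gcongr
        have : (j : ℝ) + 1 ≤ K := by exact_mod_cast Finset.mem_range.1 hj
        linarith
      linarith
    exact (Finset.sum_le_card_nsmul (Finset.range K) _ _ h1).trans_eq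
      (by rw [Finset.card_range, nsmul_eq_mul])
  have hsad : Measurable fun ω => pr.saddle L b (X (k' ω) ω, Y 0 ω) :=
    measurable_comp_index (f := fun j ω => pr.saddle L b (X j ω, Y 0 ω)) hk
      fun j => (h.measurable_saddle hpr hL hb j).mono h.le le_rfl
  have hX : Measurable fun ω => X (k' ω) ω :=
    measurable_comp_index hk fun j => (h.measurable_x j).mono h.le le_rfl
  have hX' : Measurable fun ω => X (k' ω + 1) ω :=
    measurable_comp_index (f := fun j => X (j + 1)) hk
      fun j => (h.measurable_x _).mono h.le le_rfl
  have hY' : Measurable fun ω => Y (k' ω + 1) ω :=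
    measurable_comp_index (f := fun j => Y (j + 1)) hk
      fun j => (h.measurable_y _).mono h.le le_rfl
  have hY0 : Measurable (Y 0) := (h.measurable_y 0).mono h.le le_rfl
  refine ⟨fun ω => (pr.saddle L b (X (k' ω) ω, Y 0 ω)).1,
    fun ω => (pr.saddle L b (X (k' ω) ω, Y 0 ω)).2, hsad.fst, hsad.snd, ?_, ⟨fun ω =>
      ⟨hpr.saddle_mem_left hL hb _, hpr.saddle_mem_right hL hb _⟩, ?_, ?_⟩, hMi, hM⟩
  -- `R` satisfies `L R² ≥ e²` and `b R² ≥ e²`, so the squared distance is at most `R² / e²` times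
  -- the weighted squared distance.
  · set R := max (e / Real.sqrt L) (e / Real.sqrt b)
    have hR : 0 < R := lt_max_of_lt_left (by positivity)
    have hRL : e ^ 2 / L ≤ R ^ 2 := by
      rw [← Real.sq_sqrt hL.le, ← div_pow]
      exact pow_le_pow_left₀ (by positivity) (le_max_left _ _) 2
    have hRb : e ^ 2 / b ≤ R ^ 2 := by
      rw [← Real.sq_sqrt hb.le, ← div_pow]
      exact pow_le_pow_left₀ (by positivity) (le_max_right _ _) 2
    rw [div_le_iff₀ hL, ← div_le_iff₀' (by positivity)] at hRL
    rw [div_le_iff₀ hb, ← div_le_iff₀' (by positivity)] at hRb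
    refine integral_le_of_sq_le hR ?_ (fun ω => Real.sqrt_nonneg _)
      (hSi.const_mul (R ^ 2 / e ^ 2)) (fun ω => ?_) ?_
    · exact (((hX'.sub hsad.fst).norm.pow_const 2).add
        ((hY'.sub hsad.snd).norm.pow_const 2)).sqrt
    · rw [jointDist, Real.sq_sqrt (by positivity), saddleDist, mul_add]
      have hRL' : 1 ≤ R ^ 2 / e ^ 2 * L := by
        rw [div_mul_eq_mul_div, one_le_div (by positivity)]
        rwa [div_le_iff₀' (by positivity)] at hRL
      have hRb' : 1 ≤ R ^ 2 / e ^ 2 * b := by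
        rw [div_mul_eq_mul_div, one_le_div (by positivity)]
        rwa [div_le_iff₀' (by positivity)] at hRb
      rw [← mul_assoc, ← mul_assoc]
      exact add_le_add (le_mul_of_one_le_left (sq_nonneg _) hRL')
        (le_mul_of_one_le_left (sq_nonneg _) hRb')
    · rw [integral_const_mul]
      calc _ ≤ R ^ 2 / e ^ 2 * e ^ 2 := by gcongr
        _ = R ^ 2 := by field_simp
  -- `(2 L ‖x* - x‖)² = 4 L (L ‖x* - x‖²)` has mean at most `8 L e²`.
  · have hf : Measurable fun ω =>
        2 * L * ‖(pr.saddle L b (X (k' ω) ω, Y 0 ω)).1 - X (k' ω) ω‖ :=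
      (hsad.fst.sub hX).norm.const_mul (2 * L)
    have h1 := integral_le_of_sq_le (c := 2 * Real.sqrt (2 * L) * e) (by positivity) hf
      (fun ω => by positivity) (hDi.const_mul (4 * L)) (fun ω => le_of_eq (by ring)) (by
        rw [integral_const_mul, mul_pow, mul_pow, Real.sq_sqrt (by positivity)]
        nlinarith)
    exact ExpectationLE.of_integral_le hf (fun ω => by positivity) h1.1
      (fun ω => hpr.distX_saddle_le hL hb _ _) (h1.2.trans (le_max_left _ _))
  · refine ExpectationLE.of_integral_le (g := fun _ => ε / 2) measurable_const
      (fun ω => by positivity) (integrable_const _) (fun ω => ?_) (by simp)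
    refine (hpr.distY_saddle_le hL hb _ _).trans (ENNReal.ofReal_le_ofReal ?_)
    rw [← hbD]
    gcongr
    exact hpr.norm_sub_le_Dq (hpr.saddle_mem_right hL hb _) (h.mem_y 0 ω)

end Prox

/-- The outer iterates form an inexact proximal point sequence. -/
theorem IsRandomInput.isInexactProx {n m : ℕ} {W Ω : Type*} [MeasurableSpace W]
    [MeasurableSpace Ω] {Pb : Measure Ω} [IsProbabilityMeasure Pb] {pr : Problem n m}
    {μ : Measure W} [IsProbabilityMeasure μ] {G : Oracle n m W} {L δ ε e : ℝ} {K : ℕ}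
    {x₀ : Ω → Vec n} {y₀ : Ω → Vec m} {wx wy : ℕ → ℕ → Ω → W} {k' : Ω → ℕ}
    (hin : IsRandomInput Pb pr μ K x₀ y₀ wx wy k') (hpr : pr.Admissible L)
    (hG : G.Admissible pr μ δ) (hL : 0 < L) (hε : 0 < ε) (hδ : 0 < δ) (he : 0 < e)
    (hDq : 0 < pr.Dq) :
    IsInexactProx (inputSamples x₀ y₀ wx wy) Pb pr L (ε / (2 * pr.Dq)) e
      (fun k ω => (outerRun pr G L δ ε e (x₀ ω) (y₀ ω) (fun i j => wx i j ω)
        (fun i j => wy i j ω) k).x)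
      (fun k ω => (outerRun pr G L δ ε e (x₀ ω) (y₀ ω) (fun i j => wx i j ω)
        (fun i j => wy i j ω) k).y) := by
  have hb : 0 < ε / (2 * pr.Dq) := by positivity
  have hmeas := fun k => @measurable_outerRun n m W pr G L δ ε e _ Ω μ x₀ y₀ wx wy
    (inputSamples x₀ y₀ wx wy) hpr hG hL hb hδ he hin.mem measurable_inputSamples_init k
    (fun i _ j => measurable_inputSamples_sample (Sum.inl (i, j)))
    fun i _ j => measurable_inputSamples_sample (Sum.inr (i, j))
  have hmem := fun k ω => outerRun_mem (G := G) hpr hL hb hδ he (fun i j => wx i j ω)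
    (fun i j => wy i j ω) (hin.mem ω).1 (hin.mem ω).2 k
  exact
    { le := hin.inputSamples_le
      measurable_x := fun k => (hmeas k).1
      measurable_y := fun k => (hmeas k).2
      mem_x := fun k ω => (hmem k ω).1
      mem_y := fun k ω => (hmem k ω).2
      accuracy := fun k => sapdPath_accuracy (hin.isFreshSequence hpr hG hL hb hδ he k) hpr hG hL
        hδ he hDq rfl hb three_mul_le_subproblem_smoothness
        (by gcongr; exact le_max_right _ _) (hmem k) }

end CompositeMinimax

end

open CompositeMinimax

theorem mainTheorem4 {n m : ℕ} (pr : Problem n m) (L δ ε e : ℝ)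
    (hL : 0 < L) (hδ : 0 < δ) (hε : 0 < ε) (he : 0 < e) (hDq : 0 < pr.Dq)
    (hpr : pr.Admissible L)
    {W : Type*} [MeasurableSpace W] (μ : Measure W) [IsProbabilityMeasure μ]
    (G : Oracle n m W) (hG : G.Admissible pr μ δ)
    {Ω : Type*} [MeasurableSpace Ω] (Pb : Measure Ω) [IsProbabilityMeasure Pb]
    (x₀ : Ω → Vec n) (y₀ : Ω → Vec m) (wx wy : ℕ → ℕ → Ω → W) (k' : Ω → ℕ) (K : ℕ)
    (hint : Integrable (fun ω => pr.maxH (x₀ ω)) Pb)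
    (hK : K = outerIterations pr ε e (∫ ω, pr.maxH (x₀ ω) ∂Pb))
    (hin : IsRandomInput Pb pr μ K x₀ y₀ wx wy k')
    (out : Ω → OuterState n m)
    (hout : ∀ ω, out ω = proximalPoint pr G L δ ε e K (x₀ ω) (y₀ ω)
      (fun i j => wx i j ω) (fun i j => wy i j ω) (k' ω)) :
    (∃ (x' : Ω → Vec n) (y' : Ω → Vec m), Measurable x' ∧ Measurable y' ∧
      NearInExpectation Pb (max (e / Real.sqrt L) (e / Real.sqrt (ε / (2 * pr.Dq))))
        (fun ω => (out ω).x) (fun ω => (out ω).y) x' y' ∧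
      StationaryInExpectation Pb pr (max (2 * Real.sqrt (2 * L) * e) (ε / 2)) x' y' ∧
      Integrable (fun ω => pr.maxH (x' ω)) Pb ∧
      ∫ ω, pr.maxH (x' ω) ∂Pb
        ≤ 2 * (∫ ω, pr.maxH (x₀ ω) ∂Pb) - pr.Hstar + ε * pr.Dq / 2) ∧
    NearlyStationaryInExpectation Pb pr
      (max (max (2 * Real.sqrt (2 * L) * e) (ε / 2))
        (max (e / Real.sqrt L) (e / Real.sqrt (ε / (2 * pr.Dq)))))
      (fun ω => (out ω).x) (fun ω => (out ω).y) ∧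
    ∀ ω, (out ω).xCalls ≤ K * innerBound pr L δ ε e ∧
      (out ω).yCalls ≤ K * innerBound pr L δ ε e := by
  have hb : 0 < ε / (2 * pr.Dq) := by positivity
  have hbD : ε / (2 * pr.Dq) * pr.Dq = ε / 2 := by field_simp
  obtain ⟨x', y', hx', hy', hnear, hstat, hI, hV⟩ :=
    (hin.isInexactProx hpr hG hL hε hδ he hDq).exists_stationary hpr hL hb he hbD hint hK hε hDq
      hin.measurable_index hin.law_index hin.indep_index
  obtain rfl : out = _ := funext hout
  refine ⟨⟨x', y', hx', hy', hnear, hstat, hI, hV⟩, ⟨x', y', hx', hy',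
    ⟨hnear.1, hnear.2.trans (le_max_right _ _)⟩, hstat.mono (le_max_left _ _)⟩, fun ω => ?_⟩
  have hcalls := outerRun_calls (pr := pr) (G := G) (L := L) (δ := δ) (ε := ε) (e := e) (x₀ ω)
    (y₀ ω) (fun i j => wx i j ω) (fun i j => wy i j ω) K
  have hT := Nat.mul_le_mul_left K (sapdT_le_innerBound hL hε hδ he hDq)
  exact ⟨hcalls.1.trans_le hT, hcalls.2.trans_le hT⟩
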